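/- Let $S$ be a set and let $T=(T,\eta,\mu)$ be a cartesian monad on $\mathbf{Set}/S$, i.e. the functor $T$ preserves pullbacks and all naturality squares of $\eta$ and $\mu$ are pullbacks. A \emph{$T$-multicategory} $C$ consists of a diagram $TC_0 \xleftarrow{\mathrm{dom}} C_1 \xrightarrow{\mathrm{cod}} C_0$ in $\mathbf{Set}/S$ together with a composition $TC_1\times_{TC_0}C_1\to C_1$ and identities $C_0\to C_1$ satisfying the associativity and unit laws (a monad in the bicategory of $T$-spans); with the evident structure-preserving maps these form a category $T\text{-}\mathbf{Multicat}$, which has finite products. Every $T$-multicategory $C$ has an underlying category object $|C|$ in $\mathbf{Set}/S$, whose objects are those of $C$ and whose arrows are the arrows of $C$ with domain in the image of $\eta_{C_0}$; hence for each $s\in S$ there is a category $|C|(s)$. A \emph{$T$-structured category} $D$ is a category object $D_1\rightrightarrows D_0$ in the category of $T$-algebras; its underlying $T$-multicategory has object of objects $D_0$ and object of arrows $TD_0\times_{D_0}D_1$, the pullback of the algebra structure $TD_0\to D_0$ along the domain map $D_1\to D_0$. Let $A$ be (the underlying $T$-multicategory of) a $T$-structured category. Then $A$ is exponentiable in $T\text{-}\mathbf{Multicat}$: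 the functor $A\times -$ has a right adjoint $B\mapsto[A,B]$. Moreover, for every $T$-multicategory $B$ and every $s\in S$, the objects of $[A,B]$ over $s$ are the functors $|A|(s)\to|B|(s)$: if $\mathrm{ev}\colon A\times[A,B]\to B$ denotes evaluation, then sending an object $e$ of $[A,B]$ over $s$ to the functor $a\mapsto \mathrm{ev}(a,e)$, $f\mapsto\mathrm{ev}(f,1_e)$ is a bijection from the fibre of $[A,B]_0$ over $s$ to the set of functors $|A|(s)\to|B|(s)$. -/

import Mathlib

open CategoryTheory CategoryTheory.Limits

universe v u

attribute [local simp] pullback.lift_fst pullback.lift_snd pullback.lift_fst_assoc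
  pullback.lift_snd_assoc prod.lift_fst prod.lift_snd prod.lift_fst_assoc prod.lift_snd_assoc

/-- A monad `T` on `E` is cartesian if its functor part preserves pullbacks and every naturality
square of its unit and of its multiplication is a pullback. -/
structure IsCartesianMonad {E : Type u} [Category.{v} E] (T : Monad E) : Prop where
  preservesPullbacks : PreservesLimitsOfShape WalkingCospan T.toFunctor
  unit_cartesian : NatTrans.Equifibered T.η
  mult_cartesian : NatTrans.Equifibered T.μ

/-- A `T`-multicategory: a graph `T C₀ ← C₁ → C₀` in `E` with a composition on
`C₁ ∘ C₁ = T C₁ ×_{T C₀} C₁` and identities, satisfying associativity and unit laws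
(a monad in the bicategory of `T`-spans). A generalized element `(w, f)` of `C₁ ∘ C₁` is a
"`T`-family" `w` of arrows together with an arrow `f` whose domain is the family of codomains
of `w`. -/
structure TMulticat {E : Type u} [Category.{v} E] [HasFiniteLimits E] (T : Monad E) where
  /-- the object of objects -/
  C₀ : E
  /-- the object of arrows -/
  C₁ : E
  dom : C₁ ⟶ T.obj C₀
  cod : C₁ ⟶ C₀
  comp : pullback (T.map cod) dom ⟶ C₁
  ids : C₀ ⟶ C₁
  ids_dom : ids ≫ dom = T.η.app C₀
  ids_cod : ids ≫ cod = 𝟙 C₀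
  comp_dom : comp ≫ dom =
    pullback.fst (T.map cod) dom ≫ T.map dom ≫ T.μ.app C₀
  comp_cod : comp ≫ cod = pullback.snd (T.map cod) dom ≫ cod
  /-- `f ∘ (1, …, 1) = f` -/
  comp_ids : pullback.lift (f := T.map cod) (g := dom) (dom ≫ T.map ids) (𝟙 C₁)
      (by rw [Category.assoc, ← T.map_comp, ids_cod, T.map_id, Category.comp_id, Category.id_comp])
      ≫ comp = 𝟙 C₁
  /-- `1 ∘ f = f` -/
  ids_comp : pullback.lift (f := T.map cod) (g := dom) (T.η.app C₁) (cod ≫ ids)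
      (by rw [Category.assoc, ids_dom]; exact (T.η.naturality cod).symm)
      ≫ comp = 𝟙 C₁
  /-- Associativity, on `(C₁ ∘ C₁) ∘ C₁ = T (C₁ ∘ C₁) ×_{T C₀} C₁`. -/
  assoc :
    pullback.lift (f := T.map cod) (g := dom)
      (pullback.fst (T.map (pullback.snd (T.map cod) dom ≫ cod)) dom ≫ T.map comp)
      (pullback.snd (T.map (pullback.snd (T.map cod) dom ≫ cod)) dom)
      (by rw [Category.assoc, ← T.map_comp, comp_cod]; exact pullback.condition) ≫ comp =
    pullback.lift (f := T.map cod) (g := dom)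
      (pullback.fst (T.map (pullback.snd (T.map cod) dom ≫ cod)) dom ≫
        T.map (pullback.fst (T.map cod) dom) ≫ T.μ.app C₁)
      (pullback.lift (f := T.map cod) (g := dom)
        (pullback.fst (T.map (pullback.snd (T.map cod) dom ≫ cod)) dom ≫
          T.map (pullback.snd (T.map cod) dom))
        (pullback.snd (T.map (pullback.snd (T.map cod) dom ≫ cod)) dom)
        (by rw [Category.assoc, ← T.map_comp]; exact pullback.condition) ≫ comp)
      (by
        rw [Category.assoc, Category.assoc, Category.assoc, comp_dom, pullback.lift_fst_assoc,
          Category.assoc, ← CategoryTheory.Monad.mu_naturality, ← Functor.map_comp_assoc,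
          ← Functor.map_comp_assoc, pullback.condition]) ≫ comp

namespace TMulticat

variable {E : Type u} [Category.{v} E] [HasFiniteLimits E] {T : Monad E}

/-- The composite of a `T`-family of arrows `w` and an arrow `f`, for generalized elements. -/
noncomputable def compOf (C : TMulticat T) {X : E} (w : X ⟶ T.obj C.C₁) (f : X ⟶ C.C₁)
    (h : w ≫ T.map C.cod = f ≫ C.dom) : X ⟶ C.C₁ :=
  pullback.lift w f h ≫ C.comp

/-- A map (functor) of `T`-multicategories. -/
@[ext]
structure Hom (C D : TMulticat T) where
  f₀ : C.C₀ ⟶ D.C₀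
  f₁ : C.C₁ ⟶ D.C₁
  dom_comm : f₁ ≫ D.dom = C.dom ≫ T.map f₀
  cod_comm : f₁ ≫ D.cod = C.cod ≫ f₀
  ids_comm : C.ids ≫ f₁ = f₀ ≫ D.ids
  comp_comm : C.comp ≫ f₁ =
    pullback.lift (f := T.map D.cod) (g := D.dom)
      (pullback.fst (T.map C.cod) C.dom ≫ T.map f₁) (pullback.snd (T.map C.cod) C.dom ≫ f₁)
      (by rw [Category.assoc, Category.assoc, ← T.map_comp, cod_comm, dom_comm, T.map_comp,
            pullback.condition_assoc]) ≫ D.comp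

section lemmas

variable (C : TMulticat T) {X Y : E}

lemma precomp_compOf (k : Y ⟶ X) (w : X ⟶ T.obj C.C₁) (f : X ⟶ C.C₁)
    (h : w ≫ T.map C.cod = f ≫ C.dom) :
    k ≫ C.compOf w f h = C.compOf (k ≫ w) (k ≫ f) (by simp [h]) := by
  unfold compOf
  rw [← Category.assoc]
  congr 1
  apply pullback.hom_ext <;> simp

lemma compOf_congr {w w' : X ⟶ T.obj C.C₁} {f f' : X ⟶ C.C₁} (hw : w = w') (hf : f = f')
    (h : w ≫ T.map C.cod = f ≫ C.dom) :
    C.compOf w f h = C.compOf w' f' (by rw [← hw, ← hf, h]) := by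
  subst hw hf; rfl

lemma compOf_dom (w : X ⟶ T.obj C.C₁) (f : X ⟶ C.C₁) (h : w ≫ T.map C.cod = f ≫ C.dom) :
    C.compOf w f h ≫ C.dom = w ≫ T.map C.dom ≫ T.μ.app C.C₀ := by
  simp [compOf, C.comp_dom]

lemma compOf_cod (w : X ⟶ T.obj C.C₁) (f : X ⟶ C.C₁) (h : w ≫ T.map C.cod = f ≫ C.dom) :
    C.compOf w f h ≫ C.cod = f ≫ C.cod := by
  simp [compOf, C.comp_cod]

lemma comp_eq_compOf :
    C.comp = C.compOf (pullback.fst _ _) (pullback.snd _ _) pullback.condition := by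
  have : pullback.lift (pullback.fst (T.map C.cod) C.dom) (pullback.snd (T.map C.cod) C.dom)
      pullback.condition = 𝟙 _ := by apply pullback.hom_ext <;> simp
  rw [compOf, this, Category.id_comp]

lemma compOf_ids (f : X ⟶ C.C₁) (w : X ⟶ T.obj C.C₁) (hw : w = f ≫ C.dom ≫ T.map C.ids)
    (h : w ≫ T.map C.cod = f ≫ C.dom) : C.compOf w f h = f := by
  subst hw
  refine Eq.trans ?_ ((f ≫= C.comp_ids).trans (Category.comp_id f))
  rw [compOf, ← Category.assoc f (pullback.lift _ _ _)]
  congr 1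
  apply pullback.hom_ext <;> simp

lemma ids_compOf (f : X ⟶ C.C₁) (w : X ⟶ T.obj C.C₁) (g : X ⟶ C.C₁)
    (hw : w = f ≫ T.η.app C.C₁) (hg : g = f ≫ C.cod ≫ C.ids)
    (h : w ≫ T.map C.cod = g ≫ C.dom) : C.compOf w g h = f := by
  subst hw hg
  refine Eq.trans ?_ ((f ≫= C.ids_comp).trans (Category.comp_id f))
  rw [compOf, ← Category.assoc f (pullback.lift _ _ _)]
  congr 1
  apply pullback.hom_ext <;> simp

lemma compOf_assoc (t : X ⟶ T.obj (pullback (T.map C.cod) C.dom)) (f : X ⟶ C.C₁)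
    (h : t ≫ T.map (pullback.snd (T.map C.cod) C.dom ≫ C.cod) = f ≫ C.dom) :
    C.compOf (t ≫ T.map C.comp) f (by rw [Category.assoc, ← T.map_comp, C.comp_cod, h]) =
    C.compOf (t ≫ T.map (pullback.fst (T.map C.cod) C.dom) ≫ T.μ.app C.C₁)
      (C.compOf (t ≫ T.map (pullback.snd (T.map C.cod) C.dom)) f
        (by rw [Category.assoc, ← T.map_comp, h]))
      (by
        rw [compOf_dom, Category.assoc, Category.assoc, Category.assoc, ← T.mu_naturality,
          ← Functor.map_comp_assoc, ← Functor.map_comp_assoc, pullback.condition]) := by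
  have := pullback.lift t f h ≫= C.assoc
  simp only [← Category.assoc] at this
  refine Eq.trans ?_ (this.trans ?_)
  · rw [compOf]
    congr 1
    apply pullback.hom_ext <;> simp
  · rw [compOf]
    congr 1
    apply pullback.hom_ext
    · simp
    · simp only [Category.assoc, pullback.lift_snd]
      rw [compOf, ← Category.assoc]
      congr 1
      apply pullback.hom_ext <;> simp

variable {C}

lemma Hom.compOf_comm {D : TMulticat T} (F : Hom C D) (w : X ⟶ T.obj C.C₁) (f : X ⟶ C.C₁)
    (h : w ≫ T.map C.cod = f ≫ C.dom) :
    C.compOf w f h ≫ F.f₁ = D.compOf (w ≫ T.map F.f₁) (f ≫ F.f₁)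
      (by rw [Category.assoc, Category.assoc, ← T.map_comp, F.cod_comm, F.dom_comm, T.map_comp,
            reassoc_of% h]) := by
  rw [compOf, Category.assoc, F.comp_comm, ← Category.assoc, compOf]
  congr 1
  apply pullback.hom_ext <;> simp

end lemmas

/-- The category of `T`-multicategories and their maps. -/
instance : Category (TMulticat T) where
  Hom := Hom
  id C :=
    { f₀ := 𝟙 _
      f₁ := 𝟙 _
      dom_comm := by simp
      cod_comm := by simp
      ids_comm := by simp
      comp_comm := by
        rw [Category.comp_id]
        refine C.comp_eq_compOf.trans (C.compOf_congr ?_ ?_ _) <;> simp }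
  comp {C D K} F G :=
    { f₀ := F.f₀ ≫ G.f₀
      f₁ := F.f₁ ≫ G.f₁
      dom_comm := by
        rw [Category.assoc, G.dom_comm, ← Category.assoc, F.dom_comm, T.map_comp, Category.assoc]
      cod_comm := by
        rw [Category.assoc, G.cod_comm, ← Category.assoc, F.cod_comm, Category.assoc]
      ids_comm := by
        rw [← Category.assoc, F.ids_comm, Category.assoc, G.ids_comm, Category.assoc]
      comp_comm := by
        rw [← Category.assoc, C.comp_eq_compOf, F.compOf_comm, G.compOf_comm]
        refine K.compOf_congr ?_ ?_ _ <;> simp }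
  id_comp F := by apply Hom.ext <;> simp
  comp_id F := by apply Hom.ext <;> simp
  assoc F G H := by apply Hom.ext <;> simp

@[simp] lemma id_f₀ (C : TMulticat T) : Hom.f₀ (𝟙 C) = 𝟙 C.C₀ := rfl
@[simp] lemma id_f₁ (C : TMulticat T) : Hom.f₁ (𝟙 C) = 𝟙 C.C₁ := rfl
@[simp] lemma comp_f₀ {C D K : TMulticat T} (F : C ⟶ D) (G : D ⟶ K) :
    Hom.f₀ (F ≫ G) = F.f₀ ≫ G.f₀ := rfl
@[simp] lemma comp_f₁ {C D K : TMulticat T} (F : C ⟶ D) (G : D ⟶ K) :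
    Hom.f₁ (F ≫ G) = F.f₁ ≫ G.f₁ := rfl

lemma hom_ext {C D : TMulticat T} {F G : C ⟶ D} (h₀ : F.f₀ = G.f₀) (h₁ : F.f₁ = G.f₁) : F = G :=
  Hom.ext h₀ h₁

/-- The terminal `T`-multicategory, with graph `T 1 ← T 1 → 1`. -/
noncomputable def terminal (T : Monad E) : TMulticat T where
  C₀ := ⊤_ E
  C₁ := T.obj (⊤_ E)
  dom := 𝟙 _
  cod := terminal.from _
  comp := pullback.fst _ _ ≫ T.μ.app _
  ids := T.η.app _
  ids_dom := Category.comp_id _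
  ids_cod := Subsingleton.elim _ _
  comp_dom := by simp
  comp_cod := Subsingleton.elim _ _
  comp_ids := by simp [T.right_unit]
  ids_comp := by simp [T.left_unit]
  assoc := by simp [T.assoc]

/-- The map to the terminal `T`-multicategory. -/
noncomputable def toTerminal (C : TMulticat T) : C ⟶ terminal T where
  f₀ := terminal.from C.C₀
  f₁ := C.dom ≫ T.map (terminal.from C.C₀)
  dom_comm := Category.comp_id _
  cod_comm := terminal.hom_ext _ _
  ids_comm := by
    refine (Category.assoc _ _ _).symm.trans ?_
    rw [C.ids_dom]
    exact (T.η.naturality _).symm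
  comp_comm := by
    have h : C.comp ≫ C.dom ≫ T.map (terminal.from C.C₀) =
        (pullback.fst (T.map C.cod) C.dom ≫ T.map (C.dom ≫ T.map (terminal.from C.C₀))) ≫
          T.μ.app (⊤_ E) := by
      rw [← Category.assoc, C.comp_dom, Category.assoc, Category.assoc, ← T.mu_naturality,
        T.map_comp, Category.assoc, Category.assoc]
    refine h.trans (Eq.trans ?_ (Category.assoc _ _ _))
    exact (congrArg (· ≫ T.μ.app (⊤_ E)) (pullback.lift_fst _ _ _)).symm

/-- The terminal `T`-multicategory is terminal. -/
noncomputable def terminalIsTerminal (T : Monad E) : IsTerminal (terminal T) :=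
  IsTerminal.ofUniqueHom (fun C => toTerminal C) (fun C F => by
    have h₀ : F.f₀ = (toTerminal C).f₀ := terminal.hom_ext _ _
    apply hom_ext h₀
    have h : F.f₁ ≫ (terminal T).dom = F.f₁ := Category.comp_id _
    have h' : (toTerminal C).f₁ ≫ (terminal T).dom = (toTerminal C).f₁ := Category.comp_id _
    rw [← h, ← h', F.dom_comm, (toTerminal C).dom_comm, h₀])

section Prod

variable (C D : TMulticat T)

/-- The object of arrows of the product of `C` and `D`: a domain in `T (C₀ × D₀)` together with
an arrow of `C` and an arrow of `D` with the corresponding domains. -/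
noncomputable abbrev prodArr : E :=
  pullback (prod.lift (T.map (prod.fst : C.C₀ ⨯ D.C₀ ⟶ _)) (T.map (prod.snd : C.C₀ ⨯ D.C₀ ⟶ _)))
    (prod.map C.dom D.dom)

/-- The domain of an arrow of the product. -/
noncomputable def prodDom : prodArr C D ⟶ T.obj (C.C₀ ⨯ D.C₀) := pullback.fst _ _

/-- The first component of an arrow of the product. -/
noncomputable def prodFst : prodArr C D ⟶ C.C₁ := pullback.snd _ _ ≫ prod.fst

/-- The second component of an arrow of the product. -/
noncomputable def prodSnd : prodArr C D ⟶ D.C₁ := pullback.snd _ _ ≫ prod.snd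

lemma prodFst_dom : prodFst C D ≫ C.dom = prodDom C D ≫ T.map prod.fst := by
  have := pullback.condition (f := prod.lift (T.map (prod.fst : C.C₀ ⨯ D.C₀ ⟶ _))
    (T.map (prod.snd : C.C₀ ⨯ D.C₀ ⟶ _))) (g := prod.map C.dom D.dom) =≫ prod.fst
  simpa [prodFst, prodDom] using this.symm

lemma prodSnd_dom : prodSnd C D ≫ D.dom = prodDom C D ≫ T.map prod.snd := by
  have := pullback.condition (f := prod.lift (T.map (prod.fst : C.C₀ ⨯ D.C₀ ⟶ _))
    (T.map (prod.snd : C.C₀ ⨯ D.C₀ ⟶ _))) (g := prod.map C.dom D.dom) =≫ prod.snd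
  simpa [prodSnd, prodDom] using this.symm

variable {C D}

lemma prodArr_hom_ext {X : E} {f g : X ⟶ prodArr C D}
    (h : f ≫ prodDom C D = g ≫ prodDom C D)
    (h₁ : f ≫ prodFst C D = g ≫ prodFst C D)
    (h₂ : f ≫ prodSnd C D = g ≫ prodSnd C D) : f = g := by
  apply pullback.hom_ext h
  apply Limits.prod.hom_ext
  · simpa [prodFst] using h₁
  · simpa [prodSnd] using h₂

section lift

variable {X : E} (d : X ⟶ T.obj (C.C₀ ⨯ D.C₀)) (f : X ⟶ C.C₁) (g : X ⟶ D.C₁)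
    (hf : f ≫ C.dom = d ≫ T.map prod.fst) (hg : g ≫ D.dom = d ≫ T.map prod.snd)

/-- The map into the object of arrows of the product with given domain and components. -/
noncomputable def prodArrLift : X ⟶ prodArr C D :=
  pullback.lift d (prod.lift f g) (by apply Limits.prod.hom_ext <;> simp [hf, hg])

@[simp] lemma prodArrLift_dom : prodArrLift d f g hf hg ≫ prodDom C D = d := by
  simp [prodArrLift, prodDom]

@[simp] lemma prodArrLift_fst : prodArrLift d f g hf hg ≫ prodFst C D = f := by
  simp [prodArrLift, prodFst]

@[simp] lemma prodArrLift_snd : prodArrLift d f g hf hg ≫ prodSnd C D = g := by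
  simp [prodArrLift, prodSnd]

end lift

variable (C D)

/-- The codomain of an arrow of the product. -/
noncomputable def prodCod : prodArr C D ⟶ C.C₀ ⨯ D.C₀ :=
  prod.lift (prodFst C D ≫ C.cod) (prodSnd C D ≫ D.cod)

@[simp] lemma prodCod_fst : prodCod C D ≫ prod.fst = prodFst C D ≫ C.cod := by simp [prodCod]

@[simp] lemma prodCod_snd : prodCod C D ≫ prod.snd = prodSnd C D ≫ D.cod := by simp [prodCod]

section comp

variable {C D} {X : E} (w : X ⟶ T.obj (prodArr C D)) (p : X ⟶ prodArr C D)

lemma prod_comp_fst (h : w ≫ T.map (prodCod C D) = p ≫ prodDom C D) :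
    (w ≫ T.map (prodFst C D)) ≫ T.map C.cod = (p ≫ prodFst C D) ≫ C.dom := by
  rw [Category.assoc, Category.assoc, ← T.map_comp, ← prodCod_fst, prodFst_dom, T.map_comp,
    reassoc_of% h]

lemma prod_comp_snd (h : w ≫ T.map (prodCod C D) = p ≫ prodDom C D) :
    (w ≫ T.map (prodSnd C D)) ≫ T.map D.cod = (p ≫ prodSnd C D) ≫ D.dom := by
  rw [Category.assoc, Category.assoc, ← T.map_comp, ← prodCod_snd, prodSnd_dom, T.map_comp,
    reassoc_of% h]

/-- Composition in the product is componentwise. -/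
noncomputable def prodCompOf (h : w ≫ T.map (prodCod C D) = p ≫ prodDom C D) :
    X ⟶ prodArr C D :=
  prodArrLift (w ≫ T.map (prodDom C D) ≫ T.μ.app (C.C₀ ⨯ D.C₀))
    (C.compOf (w ≫ T.map (prodFst C D)) (p ≫ prodFst C D) (prod_comp_fst w p h))
    (D.compOf (w ≫ T.map (prodSnd C D)) (p ≫ prodSnd C D) (prod_comp_snd w p h))
    (by
      rw [compOf_dom, Category.assoc, Category.assoc, Category.assoc, ← T.mu_naturality,
        ← Functor.map_comp_assoc, ← Functor.map_comp_assoc, prodFst_dom])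
    (by
      rw [compOf_dom, Category.assoc, Category.assoc, Category.assoc, ← T.mu_naturality,
        ← Functor.map_comp_assoc, ← Functor.map_comp_assoc, prodSnd_dom])

variable (h : w ≫ T.map (prodCod C D) = p ≫ prodDom C D)

lemma prodCompOf_dom :
    prodCompOf w p h ≫ prodDom C D = w ≫ T.map (prodDom C D) ≫ T.μ.app (C.C₀ ⨯ D.C₀) := by
  simp [prodCompOf]

lemma prodCompOf_fst : prodCompOf w p h ≫ prodFst C D =
    C.compOf (w ≫ T.map (prodFst C D)) (p ≫ prodFst C D) (prod_comp_fst w p h) := by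
  simp [prodCompOf]

lemma prodCompOf_snd : prodCompOf w p h ≫ prodSnd C D =
    D.compOf (w ≫ T.map (prodSnd C D)) (p ≫ prodSnd C D) (prod_comp_snd w p h) := by
  simp [prodCompOf]

lemma prodCompOf_cod : prodCompOf w p h ≫ prodCod C D = p ≫ prodCod C D := by
  apply Limits.prod.hom_ext
  · rw [Category.assoc, Category.assoc, prodCod_fst, ← Category.assoc, prodCompOf_fst,
      compOf_cod, Category.assoc]
  · rw [Category.assoc, Category.assoc, prodCod_snd, ← Category.assoc, prodCompOf_snd,
      compOf_cod, Category.assoc]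

lemma precomp_prodCompOf {Y : E} (k : Y ⟶ X) : k ≫ prodCompOf w p h =
    prodCompOf (k ≫ w) (k ≫ p) (by rw [Category.assoc, h, Category.assoc]) := by
  apply prodArr_hom_ext
  · simp only [Category.assoc, prodCompOf_dom]
  · rw [Category.assoc, prodCompOf_fst, prodCompOf_fst, precomp_compOf]
    exact compOf_congr _ (Category.assoc _ _ _).symm (Category.assoc _ _ _).symm _
  · rw [Category.assoc, prodCompOf_snd, prodCompOf_snd, precomp_compOf]
    exact compOf_congr _ (Category.assoc _ _ _).symm (Category.assoc _ _ _).symm _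

lemma prodCompOf_congr {w' : X ⟶ T.obj (prodArr C D)} {p' : X ⟶ prodArr C D}
    (hw : w = w') (hp : p = p') :
    prodCompOf w p h = prodCompOf w' p' (by rw [← hw, ← hp, h]) := by
  subst hw hp; rfl

end comp

/-- The composition of the product. -/
noncomputable def prodComp : pullback (T.map (prodCod C D)) (prodDom C D) ⟶ prodArr C D :=
  prodCompOf (pullback.fst _ _) (pullback.snd _ _) pullback.condition

variable {C D} in
lemma lift_prodComp {X : E} (w : X ⟶ T.obj (prodArr C D)) (p : X ⟶ prodArr C D)
    (h : w ≫ T.map (prodCod C D) = p ≫ prodDom C D) :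
    pullback.lift w p h ≫ prodComp C D = prodCompOf w p h := by
  rw [prodComp, precomp_prodCompOf]
  apply prodCompOf_congr <;> simp

/-- The map on composable pairs induced by the first projection. -/
noncomputable def prodPairsFst : pullback (T.map (prodCod C D)) (prodDom C D) ⟶
    pullback (T.map C.cod) C.dom :=
  pullback.lift (pullback.fst _ _ ≫ T.map (prodFst C D)) (pullback.snd _ _ ≫ prodFst C D)
    (prod_comp_fst _ _ pullback.condition)

/-- The map on composable pairs induced by the second projection. -/
noncomputable def prodPairsSnd : pullback (T.map (prodCod C D)) (prodDom C D) ⟶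
    pullback (T.map D.cod) D.dom :=
  pullback.lift (pullback.fst _ _ ≫ T.map (prodSnd C D)) (pullback.snd _ _ ≫ prodSnd C D)
    (prod_comp_snd _ _ pullback.condition)

lemma prodComp_fst : prodComp C D ≫ prodFst C D = prodPairsFst C D ≫ C.comp :=
  prodCompOf_fst _ _ _

lemma prodComp_snd : prodComp C D ≫ prodSnd C D = prodPairsSnd C D ≫ D.comp :=
  prodCompOf_snd _ _ _

/-- The identities of the product. -/
noncomputable def prodIds : C.C₀ ⨯ D.C₀ ⟶ prodArr C D :=
  prodArrLift (T.η.app (C.C₀ ⨯ D.C₀)) (prod.fst ≫ C.ids) (prod.snd ≫ D.ids)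
    (by rw [Category.assoc, C.ids_dom]; exact T.η.naturality _)
    (by rw [Category.assoc, D.ids_dom]; exact T.η.naturality _)

lemma prodIds_fst : prodIds C D ≫ prodFst C D = prod.fst ≫ C.ids := by simp [prodIds]

lemma prodIds_snd : prodIds C D ≫ prodSnd C D = prod.snd ≫ D.ids := by simp [prodIds]

lemma prodIds_dom : prodIds C D ≫ prodDom C D = T.η.app (C.C₀ ⨯ D.C₀) := by simp [prodIds]

lemma prodIds_cod : prodIds C D ≫ prodCod C D = 𝟙 _ := by
  apply Limits.prod.hom_ext
  · rw [Category.assoc, prodCod_fst, ← Category.assoc, prodIds_fst, Category.assoc, C.ids_cod]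
    simp
  · rw [Category.assoc, prodCod_snd, ← Category.assoc, prodIds_snd, Category.assoc, D.ids_cod]
    simp

lemma prod_comp_ids (h : (prodDom C D ≫ T.map (prodIds C D)) ≫ T.map (prodCod C D) =
    𝟙 _ ≫ prodDom C D) :
    pullback.lift (prodDom C D ≫ T.map (prodIds C D)) (𝟙 _) h ≫ prodComp C D = 𝟙 _ := by
  rw [lift_prodComp]
  apply prodArr_hom_ext
  · rw [prodCompOf_dom, Category.assoc, ← Functor.map_comp_assoc, prodIds_dom, T.right_unit]
    simp
  · rw [prodCompOf_fst, compOf_ids]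
    rw [Category.assoc, ← T.map_comp, prodIds_fst, Category.id_comp, T.map_comp,
      ← Category.assoc, ← prodFst_dom, Category.assoc]
  · rw [prodCompOf_snd, compOf_ids]
    rw [Category.assoc, ← T.map_comp, prodIds_snd, Category.id_comp, T.map_comp,
      ← Category.assoc, ← prodSnd_dom, Category.assoc]

lemma prod_ids_comp (h : T.η.app (prodArr C D) ≫ T.map (prodCod C D) =
    (prodCod C D ≫ prodIds C D) ≫ prodDom C D) :
    pullback.lift (T.η.app (prodArr C D)) (prodCod C D ≫ prodIds C D) h ≫ prodComp C D =
      𝟙 _ := by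
  rw [lift_prodComp]
  apply prodArr_hom_ext
  · rw [prodCompOf_dom, ← Category.assoc, ← T.unit_naturality, Category.assoc, T.left_unit]
    simp
  · rw [prodCompOf_fst, Category.id_comp]
    apply ids_compOf
    · exact (T.η.naturality _).symm
    · rw [Category.assoc, prodIds_fst, ← Category.assoc, prodCod_fst, Category.assoc]
  · rw [prodCompOf_snd, Category.id_comp]
    apply ids_compOf
    · exact (T.η.naturality _).symm
    · rw [Category.assoc, prodIds_snd, ← Category.assoc, prodCod_snd, Category.assoc]

variable {C D} in
lemma prodCompOf_assoc {X : E} (t : X ⟶ T.obj (pullback (T.map (prodCod C D)) (prodDom C D)))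
    (p : X ⟶ prodArr C D)
    (h : t ≫ T.map (pullback.snd (T.map (prodCod C D)) (prodDom C D)) ≫ T.map (prodCod C D) =
      p ≫ prodDom C D)
    (h₁ : (t ≫ T.map (prodComp C D)) ≫ T.map (prodCod C D) = p ≫ prodDom C D)
    (h₂ : (t ≫ T.map (pullback.snd (T.map (prodCod C D)) (prodDom C D))) ≫ T.map (prodCod C D) =
      p ≫ prodDom C D)
    (h₃ : (t ≫ T.map (pullback.fst (T.map (prodCod C D)) (prodDom C D)) ≫ T.μ.app _) ≫
        T.map (prodCod C D) =
      prodCompOf (t ≫ T.map (pullback.snd (T.map (prodCod C D)) (prodDom C D))) p h₂ ≫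
        prodDom C D) :
    prodCompOf (t ≫ T.map (prodComp C D)) p h₁ =
      prodCompOf (t ≫ T.map (pullback.fst (T.map (prodCod C D)) (prodDom C D)) ≫ T.μ.app _)
        (prodCompOf (t ≫ T.map (pullback.snd (T.map (prodCod C D)) (prodDom C D))) p h₂) h₃ := by
  apply prodArr_hom_ext
  · rw [prodCompOf_dom, prodCompOf_dom]
    simp only [Category.assoc]
    rw [← Functor.map_comp_assoc, prodComp, prodCompOf_dom, ← T.mu_naturality_assoc]
    simp [T.assoc]
  · rw [prodCompOf_fst, prodCompOf_fst]
    refine Eq.trans (compOf_congr _ ?_ rfl _) ((compOf_assoc C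
      (t ≫ T.map (prodPairsFst C D)) (p ≫ prodFst C D) ?_).trans (compOf_congr _ ?_ ?_ _))
    · rw [Category.assoc, Category.assoc, ← T.map_comp, ← T.map_comp, prodComp_fst]
    · rw [Category.assoc, ← T.map_comp, Category.assoc, prodFst_dom, ← reassoc_of% h,
        ← T.map_comp, ← T.map_comp]
      simp [prodPairsFst]
    · simp only [Category.assoc]
      rw [← Functor.map_comp_assoc, ← T.mu_naturality, ← Functor.map_comp_assoc, prodPairsFst,
        pullback.lift_fst]
    · rw [prodCompOf_fst]
      apply compOf_congr _ _ rfl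
      rw [Category.assoc, Category.assoc, ← T.map_comp, ← T.map_comp, prodPairsFst,
        pullback.lift_snd]
  · rw [prodCompOf_snd, prodCompOf_snd]
    refine Eq.trans (compOf_congr _ ?_ rfl _) ((compOf_assoc D
      (t ≫ T.map (prodPairsSnd C D)) (p ≫ prodSnd C D) ?_).trans (compOf_congr _ ?_ ?_ _))
    · rw [Category.assoc, Category.assoc, ← T.map_comp, ← T.map_comp, prodComp_snd]
    · rw [Category.assoc, ← T.map_comp, Category.assoc, prodSnd_dom, ← reassoc_of% h,
        ← T.map_comp, ← T.map_comp]
      simp [prodPairsSnd]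
    · simp only [Category.assoc]
      rw [← Functor.map_comp_assoc, ← T.mu_naturality, ← Functor.map_comp_assoc, prodPairsSnd,
        pullback.lift_fst]
    · rw [prodCompOf_snd]
      apply compOf_congr _ _ rfl
      rw [Category.assoc, Category.assoc, ← T.map_comp, ← T.map_comp, prodPairsSnd,
        pullback.lift_snd]

/-- The product of two `T`-multicategories: objects are pairs of objects, and an arrow is a pair
of arrows together with a common domain in `T (C₀ × D₀)`. -/
noncomputable def product : TMulticat T where
  C₀ := C.C₀ ⨯ D.C₀
  C₁ := prodArr C D
  dom := prodDom C D
  cod := prodCod C D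
  comp := prodComp C D
  ids := prodIds C D
  ids_dom := prodIds_dom C D
  ids_cod := prodIds_cod C D
  comp_dom := prodCompOf_dom _ _ _
  comp_cod := prodCompOf_cod _ _ _
  comp_ids := prod_comp_ids C D _
  ids_comp := prod_ids_comp C D _
  assoc := by
    rw [lift_prodComp, lift_prodComp]
    refine (prodCompOf_assoc _ _ ?_ _ ?_ ?_).trans ?_
    · rw [← T.map_comp]; exact pullback.condition
    · rw [Category.assoc, ← T.map_comp]; exact pullback.condition
    · rw [prodCompOf_dom, Category.assoc, Category.assoc, Category.assoc, ← T.mu_naturality,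
        ← Functor.map_comp_assoc, ← Functor.map_comp_assoc, pullback.condition]
    · exact prodCompOf_congr _ _ _ rfl (lift_prodComp _ _ _).symm

/-- The first projection of the product. -/
noncomputable def projFst : product C D ⟶ C where
  f₀ := Limits.prod.fst
  f₁ := prodFst C D
  dom_comm := prodFst_dom C D
  cod_comm := (prodCod_fst C D).symm
  ids_comm := prodIds_fst C D
  comp_comm := prodComp_fst C D

/-- The second projection of the product. -/
noncomputable def projSnd : product C D ⟶ D where
  f₀ := Limits.prod.snd
  f₁ := prodSnd C D
  dom_comm := prodSnd_dom C D
  cod_comm := (prodCod_snd C D).symm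
  ids_comm := prodIds_snd C D
  comp_comm := prodComp_snd C D

section pairing

variable {C D} {K : TMulticat T} (F : K ⟶ C) (G : K ⟶ D)

/-- The action on arrows of the map into the product induced by two maps. -/
noncomputable def pairingArr : K.C₁ ⟶ prodArr C D :=
  prodArrLift (K.dom ≫ T.map (prod.lift F.f₀ G.f₀)) F.f₁ G.f₁
    (by rw [F.dom_comm, Category.assoc, ← T.map_comp, prod.lift_fst])
    (by rw [G.dom_comm, Category.assoc, ← T.map_comp, prod.lift_snd])

lemma pairingArr_dom :
    pairingArr F G ≫ prodDom C D = K.dom ≫ T.map (prod.lift F.f₀ G.f₀) :=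
  prodArrLift_dom _ _ _ _ _

lemma pairingArr_fst : pairingArr F G ≫ prodFst C D = F.f₁ := prodArrLift_fst _ _ _ _ _

lemma pairingArr_snd : pairingArr F G ≫ prodSnd C D = G.f₁ := prodArrLift_snd _ _ _ _ _

lemma pairingArr_cod :
    pairingArr F G ≫ prodCod C D = K.cod ≫ prod.lift F.f₀ G.f₀ := by
  apply Limits.prod.hom_ext
  · rw [Category.assoc, prodCod_fst, ← Category.assoc, pairingArr_fst, F.cod_comm, Category.assoc,
      prod.lift_fst]
  · rw [Category.assoc, prodCod_snd, ← Category.assoc, pairingArr_snd, G.cod_comm, Category.assoc,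
      prod.lift_snd]

lemma ids_pairingArr : K.ids ≫ pairingArr F G = prod.lift F.f₀ G.f₀ ≫ prodIds C D := by
  apply prodArr_hom_ext
  · rw [Category.assoc, Category.assoc, pairingArr_dom, prodIds_dom, ← Category.assoc,
      K.ids_dom, T.unit_naturality]
  · rw [Category.assoc, Category.assoc, pairingArr_fst, prodIds_fst, F.ids_comm,
      prod.lift_fst_assoc]
  · rw [Category.assoc, Category.assoc, pairingArr_snd, prodIds_snd, G.ids_comm,
      prod.lift_snd_assoc]

lemma comp_pairingArr (h : (pullback.fst (T.map K.cod) K.dom ≫ T.map (pairingArr F G)) ≫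
      T.map (prodCod C D) = (pullback.snd (T.map K.cod) K.dom ≫ pairingArr F G) ≫ prodDom C D) :
    K.comp ≫ pairingArr F G = prodCompOf (pullback.fst (T.map K.cod) K.dom ≫
      T.map (pairingArr F G)) (pullback.snd (T.map K.cod) K.dom ≫ pairingArr F G) h := by
  apply prodArr_hom_ext
  · rw [prodCompOf_dom, Category.assoc, pairingArr_dom, Category.assoc,
      ← Functor.map_comp_assoc, pairingArr_dom, ← Category.assoc, K.comp_dom, T.map_comp]
    simp only [Category.assoc, T.mu_naturality]
  · rw [prodCompOf_fst, Category.assoc, pairingArr_fst, F.comp_comm]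
    exact compOf_congr _ (by rw [Category.assoc, ← T.map_comp, pairingArr_fst])
      (by rw [Category.assoc, pairingArr_fst]) _
  · rw [prodCompOf_snd, Category.assoc, pairingArr_snd, G.comp_comm]
    exact compOf_congr _ (by rw [Category.assoc, ← T.map_comp, pairingArr_snd])
      (by rw [Category.assoc, pairingArr_snd]) _

/-- The map into the product induced by two maps. -/
noncomputable def pairing : K ⟶ product C D where
  f₀ := prod.lift F.f₀ G.f₀
  f₁ := pairingArr F G
  dom_comm := pairingArr_dom F G
  cod_comm := pairingArr_cod F G
  ids_comm := ids_pairingArr F G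
  comp_comm := (comp_pairingArr F G _).trans (lift_prodComp _ _ _).symm

end pairing

lemma pairing_projFst {K : TMulticat T} (F : K ⟶ C) (G : K ⟶ D) :
    pairing F G ≫ projFst C D = F :=
  hom_ext (prod.lift_fst _ _) (pairingArr_fst F G)

lemma pairing_projSnd {K : TMulticat T} (F : K ⟶ C) (G : K ⟶ D) :
    pairing F G ≫ projSnd C D = G :=
  hom_ext (prod.lift_snd _ _) (pairingArr_snd F G)

/-- The product of `T`-multicategories has the universal property of a binary product. -/
noncomputable def prodIsLimit : IsLimit (BinaryFan.mk (projFst C D) (projSnd C D)) :=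
  BinaryFan.IsLimit.mk _ (fun F G => pairing F G) (fun F G => pairing_projFst C D F G)
    (fun F G => pairing_projSnd C D F G) (by
      intro K F G (H : K ⟶ product C D) hF hG
      have h₀ : H.f₀ = (pairing F G).f₀ := by
        apply Limits.prod.hom_ext
        · exact (congrArg Hom.f₀ hF).trans (prod.lift_fst _ _).symm
        · exact (congrArg Hom.f₀ hG).trans (prod.lift_snd _ _).symm
      apply hom_ext h₀
      apply prodArr_hom_ext
      · exact H.dom_comm.trans (Eq.trans (congrArg (fun k => K.dom ≫ T.map k) h₀)
          (pairing F G).dom_comm.symm)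
      · exact (congrArg Hom.f₁ hF).trans (pairingArr_fst F G).symm
      · exact (congrArg Hom.f₁ hG).trans (pairingArr_snd F G).symm)

end Prod

/-- The category of `T`-multicategories with its finite products. -/
noncomputable instance : CartesianMonoidalCategory (TMulticat T) :=
  .ofChosenFiniteProducts ⟨asEmptyCone (terminal T), terminalIsTerminal T⟩
    (fun C D => ⟨BinaryFan.mk (projFst C D) (projSnd C D), prodIsLimit C D⟩)

/-- The objects of the underlying category of `C` at `X`: the `X`-indexed objects of `C`. -/
@[ext]
structure Unary (C : TMulticat T) (X : E) where
  obj : X ⟶ C.C₀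

/-- The morphisms of the underlying category of `C` at `X`: the `X`-indexed unary arrows of `C`,
i.e. arrows whose domain is a single object (is in the image of the unit of `T`). -/
@[ext]
structure Unary.Hom {C : TMulticat T} {X : E} (a b : C.Unary X) where
  arr : X ⟶ C.C₁
  dom_eq : arr ≫ C.dom = a.obj ≫ T.η.app C.C₀
  cod_eq : arr ≫ C.cod = b.obj

lemma unary_condition {C : TMulticat T} {X : E} {a b c : C.Unary X} (f : Unary.Hom a b)
    (g : Unary.Hom b c) : (f.arr ≫ T.η.app C.C₁) ≫ T.map C.cod = g.arr ≫ C.dom := by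
  rw [Category.assoc, ← T.unit_naturality, ← Category.assoc, f.cod_eq, g.dom_eq]

/-- The underlying category object `|C|` of a `T`-multicategory (keep the objects and only the unary
arrows), externally: the category of generalized elements of `|C|` at stage `X`. -/
noncomputable instance (C : TMulticat T) (X : E) : Category (C.Unary X) where
  Hom := Unary.Hom
  id a := ⟨a.obj ≫ C.ids, by rw [Category.assoc, C.ids_dom],
    by rw [Category.assoc, C.ids_cod, Category.comp_id]⟩
  comp {a b c} f g := ⟨C.compOf (f.arr ≫ T.η.app C.C₁) g.arr (unary_condition f g),
    by
      rw [compOf_dom, Category.assoc, ← T.unit_naturality_assoc, T.left_unit]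
      exact (congrArg (f.arr ≫ ·) (Category.comp_id _)).trans f.dom_eq,
    by rw [compOf_cod, g.cod_eq]⟩
  id_comp {a b} f := by
    apply Unary.Hom.ext
    apply compOf_ids
    rw [Category.assoc, T.unit_naturality, ← Category.assoc, ← f.dom_eq, Category.assoc]
  comp_id {a b} f := by
    apply Unary.Hom.ext
    apply ids_compOf _ _ _ _ rfl
    exact (congrArg (· ≫ C.ids) f.cod_eq).symm.trans (Category.assoc _ _ _)
  assoc {a b c d} f g h := by
    apply Unary.Hom.ext
    have hfg := unary_condition f g
    have e₁ : (pullback.lift (f.arr ≫ T.η.app C.C₁) g.arr hfg ≫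
        T.η.app (pullback (T.map C.cod) C.dom)) ≫
        T.map (pullback.snd (T.map C.cod) C.dom) = g.arr ≫ T.η.app C.C₁ := by
      rw [Category.assoc, ← T.unit_naturality, pullback.lift_snd_assoc]
    refine (compOf_congr _ ?_ rfl _).trans ((compOf_assoc C
      (pullback.lift (f.arr ≫ T.η.app C.C₁) g.arr hfg ≫
        T.η.app (pullback (T.map C.cod) C.dom)) h.arr ?_).trans
      (compOf_congr _ ?_ (compOf_congr _ e₁ rfl _) _))
    · change (C.compOf _ _ hfg) ≫ _ = _
      rw [compOf, Category.assoc, Category.assoc]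
      exact congrArg (_ ≫ ·) (T.η.naturality C.comp)
    · rw [T.map_comp, ← Category.assoc, e₁]
      exact unary_condition g h
    · rw [Category.assoc, ← T.unit_naturality_assoc, pullback.lift_fst_assoc, T.left_unit]
      exact Category.comp_id _

lemma Unary.id_arr {C : TMulticat T} {X : E} (a : C.Unary X) :
    Unary.Hom.arr (𝟙 a) = a.obj ≫ C.ids := rfl

lemma Unary.comp_arr {C : TMulticat T} {X : E} {a b c : C.Unary X} (f : a ⟶ b) (g : b ⟶ c) :
    Unary.Hom.arr (f ≫ g) =
      C.compOf (f.arr ≫ T.η.app C.C₁) g.arr (unary_condition f g) := rfl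

/-- A map of `T`-multicategories induces a functor between the underlying categories. -/
noncomputable def Hom.unary {C D : TMulticat T} (F : Hom C D) (X : E) :
    C.Unary X ⥤ D.Unary X where
  obj a := ⟨a.obj ≫ F.f₀⟩
  map {a b} f := ⟨f.arr ≫ F.f₁,
    by rw [Category.assoc, F.dom_comm, ← Category.assoc, f.dom_eq, Category.assoc, Category.assoc,
        T.unit_naturality],
    by rw [Category.assoc, F.cod_comm, ← Category.assoc, f.cod_eq]⟩
  map_id a := by
    apply Unary.Hom.ext
    change (a.obj ≫ C.ids) ≫ F.f₁ = (a.obj ≫ F.f₀) ≫ D.ids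
    rw [Category.assoc, F.ids_comm, Category.assoc]
  map_comp {a b c} f g := by
    apply Unary.Hom.ext
    refine (F.compOf_comm _ _ _).trans (compOf_congr _ ?_ rfl _)
    rw [Category.assoc, Category.assoc, T.unit_naturality]

section pairWith

variable {A K : TMulticat T} {X : E}

/-- For an `X`-indexed object `e` of `K` and a unary arrow `f` of `A`, the arrow `(f, 1_e)` of
`A × K`. -/
noncomputable def pairWithArr (e : X ⟶ K.C₀) {a b : A.Unary X} (f : a ⟶ b) : X ⟶ prodArr A K :=
  prodArrLift (prod.lift a.obj e ≫ T.η.app (A.C₀ ⨯ K.C₀)) f.arr (e ≫ K.ids)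
    (by rw [f.dom_eq, Category.assoc, ← T.unit_naturality, prod.lift_fst_assoc])
    (by rw [Category.assoc, K.ids_dom, Category.assoc, ← T.unit_naturality, prod.lift_snd_assoc])

variable (e : X ⟶ K.C₀) {a b c : A.Unary X} (f : a ⟶ b) (g : b ⟶ c)

lemma pairWithArr_dom :
    pairWithArr e f ≫ prodDom A K = prod.lift a.obj e ≫ T.η.app (A.C₀ ⨯ K.C₀) :=
  prodArrLift_dom _ _ _ _ _

lemma pairWithArr_fst : pairWithArr e f ≫ prodFst A K = f.arr := prodArrLift_fst _ _ _ _ _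

lemma pairWithArr_snd : pairWithArr e f ≫ prodSnd A K = e ≫ K.ids := prodArrLift_snd _ _ _ _ _

lemma pairWithArr_cod : pairWithArr e f ≫ prodCod A K = prod.lift b.obj e := by
  apply Limits.prod.hom_ext
  · rw [Category.assoc, prodCod_fst, ← Category.assoc, pairWithArr_fst, f.cod_eq, prod.lift_fst]
  · rw [Category.assoc, prodCod_snd, ← Category.assoc, pairWithArr_snd, Category.assoc, K.ids_cod,
      prod.lift_snd, Category.comp_id]

lemma pairWithArr_id : pairWithArr e (𝟙 a) = prod.lift a.obj e ≫ prodIds A K := by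
  apply prodArr_hom_ext
  · rw [pairWithArr_dom, Category.assoc, prodIds_dom]
  · rw [pairWithArr_fst, Category.assoc, prodIds_fst, prod.lift_fst_assoc, Unary.id_arr]
  · rw [pairWithArr_snd, Category.assoc, prodIds_snd, prod.lift_snd_assoc]

lemma pairWithArr_comp (h : (pairWithArr e f ≫ T.η.app (prodArr A K)) ≫ T.map (prodCod A K) =
    pairWithArr e g ≫ prodDom A K) : pairWithArr e (f ≫ g) =
      prodCompOf (pairWithArr e f ≫ T.η.app (prodArr A K)) (pairWithArr e g) h := by
  apply prodArr_hom_ext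
  · rw [prodCompOf_dom, pairWithArr_dom, Category.assoc, ← T.unit_naturality_assoc, T.left_unit]
    exact (pairWithArr_dom e f).symm.trans (congrArg (pairWithArr e f ≫ ·) (Category.comp_id _).symm)
  · rw [prodCompOf_fst, pairWithArr_fst, Unary.comp_arr]
    refine compOf_congr _ ?_ (pairWithArr_fst e g).symm _
    rw [Category.assoc, ← T.unit_naturality, ← Category.assoc, pairWithArr_fst]
  · rw [prodCompOf_snd, pairWithArr_snd]
    refine (ids_compOf K (e ≫ K.ids) _ _ ?_ ?_ _).symm
    · rw [Category.assoc, ← T.unit_naturality, ← Category.assoc, pairWithArr_snd]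
    · rw [pairWithArr_snd, Category.assoc, ← Category.assoc K.ids, K.ids_cod, Category.id_comp]

variable (A) in
/-- For an `X`-indexed object `e` of `K`, the functor `a ↦ (a, e)`, `f ↦ (f, 1_e)`. -/
noncomputable def pairWith : A.Unary X ⥤ (product A K).Unary X where
  obj a := ⟨prod.lift a.obj e⟩
  map f := ⟨pairWithArr e f, pairWithArr_dom e f, pairWithArr_cod e f⟩
  map_id _ := Unary.Hom.ext (pairWithArr_id e)
  map_comp f g := Unary.Hom.ext ((pairWithArr_comp e f g _).trans (lift_prodComp _ _ _).symm)

end pairWith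

/-- Evaluation of a map `G : A × K ⟶ B` at an `X`-indexed object `e` of `K`: the functor
`|A|(X) ⥤ |B|(X)` given by `a ↦ G(a, e)` and `f ↦ G(f, 1_e)`. -/
noncomputable def evalAt {A K B : TMulticat T} (G : product A K ⟶ B) {X : E} (e : X ⟶ K.C₀) :
    A.Unary X ⥤ B.Unary X :=
  pairWith A e ⋙ Hom.unary G X

end TMulticat

/-- A `T`-structured category: a category object in the category of `T`-algebras. Thus it has a
`T`-algebra of objects and a `T`-algebra of arrows, with domain, codomain, identities and
composition being maps of algebras. The pullback `D₁ ×_{D₀} D₁` of algebras is computed in `E`,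
with the componentwise structure map, so that `comp_alg` says that `comp` is an algebra map. -/
structure TStructCat {E : Type u} [Category.{v} E] [HasFiniteLimits E] (T : Monad E) where
  /-- the algebra of objects -/
  D₀ : T.Algebra
  /-- the algebra of arrows -/
  D₁ : T.Algebra
  dom : D₁ ⟶ D₀
  cod : D₁ ⟶ D₀
  ids : D₀ ⟶ D₁
  comp : pullback cod.f dom.f ⟶ D₁.A
  comp_alg : T.map comp ≫ D₁.a =
    pullback.lift (f := cod.f) (g := dom.f) (T.map (pullback.fst cod.f dom.f) ≫ D₁.a)
      (T.map (pullback.snd cod.f dom.f) ≫ D₁.a)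
      (by rw [Category.assoc, Category.assoc, ← cod.h, ← dom.h, ← Functor.map_comp_assoc,
            ← Functor.map_comp_assoc, pullback.condition]) ≫ comp
  ids_dom : ids ≫ dom = 𝟙 D₀
  ids_cod : ids ≫ cod = 𝟙 D₀
  comp_dom : comp ≫ dom.f = pullback.fst cod.f dom.f ≫ dom.f
  comp_cod : comp ≫ cod.f = pullback.snd cod.f dom.f ≫ cod.f
  /-- `f ∘ 1 = f` -/
  comp_ids : pullback.lift (f := cod.f) (g := dom.f) (dom.f ≫ ids.f) (𝟙 D₁.A)
      (by rw [Category.assoc, ← Monad.Algebra.comp_f, ids_cod, Monad.Algebra.id_f,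
            Category.comp_id, Category.id_comp]) ≫ comp = 𝟙 D₁.A
  /-- `1 ∘ f = f` -/
  ids_comp : pullback.lift (f := cod.f) (g := dom.f) (𝟙 D₁.A) (cod.f ≫ ids.f)
      (by rw [Category.assoc, ← Monad.Algebra.comp_f, ids_dom, Monad.Algebra.id_f,
            Category.comp_id, Category.id_comp]) ≫ comp = 𝟙 D₁.A
  /-- Associativity, on `(D₁ ×_{D₀} D₁) ×_{D₀} D₁`. -/
  assoc :
    pullback.lift (f := cod.f) (g := dom.f)
      (pullback.fst (pullback.snd cod.f dom.f ≫ cod.f) dom.f ≫ comp)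
      (pullback.snd (pullback.snd cod.f dom.f ≫ cod.f) dom.f)
      (by rw [Category.assoc, comp_cod]; exact pullback.condition) ≫ comp =
    pullback.lift (f := cod.f) (g := dom.f)
      (pullback.fst (pullback.snd cod.f dom.f ≫ cod.f) dom.f ≫ pullback.fst cod.f dom.f)
      (pullback.lift (f := cod.f) (g := dom.f)
        (pullback.fst (pullback.snd cod.f dom.f ≫ cod.f) dom.f ≫ pullback.snd cod.f dom.f)
        (pullback.snd (pullback.snd cod.f dom.f ≫ cod.f) dom.f)
        (by rw [Category.assoc]; exact pullback.condition) ≫ comp)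
      (by rw [Category.assoc, Category.assoc, comp_dom, pullback.lift_fst_assoc, Category.assoc,
            pullback.condition]) ≫ comp

namespace TStructCat

variable {E : Type u} [Category.{v} E] [HasFiniteLimits E] {T : Monad E} (D : TStructCat T)

lemma ids_dom_f : D.ids.f ≫ D.dom.f = 𝟙 _ := congrArg Monad.Algebra.Hom.f D.ids_dom

lemma ids_cod_f : D.ids.f ≫ D.cod.f = 𝟙 _ := congrArg Monad.Algebra.Hom.f D.ids_cod

/-- Composition of generalized elements of the object of arrows. -/
noncomputable def compOf {X : E} (f g : X ⟶ D.D₁.A) (h : f ≫ D.cod.f = g ≫ D.dom.f) :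
    X ⟶ D.D₁.A :=
  pullback.lift f g h ≫ D.comp

section lemmas

variable {X Y : E} (f g : X ⟶ D.D₁.A) (h : f ≫ D.cod.f = g ≫ D.dom.f)

lemma compOf_dom : D.compOf f g h ≫ D.dom.f = f ≫ D.dom.f := by
  rw [compOf, Category.assoc, D.comp_dom, pullback.lift_fst_assoc]

lemma compOf_cod : D.compOf f g h ≫ D.cod.f = g ≫ D.cod.f := by
  rw [compOf, Category.assoc, D.comp_cod, pullback.lift_snd_assoc]

lemma compOf_congr {f' g' : X ⟶ D.D₁.A} (hf : f = f') (hg : g = g') :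
    D.compOf f g h = D.compOf f' g' (by rw [← hf, ← hg, h]) := by
  subst hf hg; rfl

lemma precomp_compOf (k : Y ⟶ X) : k ≫ D.compOf f g h =
    D.compOf (k ≫ f) (k ≫ g) (by rw [Category.assoc, h, Category.assoc]) := by
  rw [compOf, compOf, ← Category.assoc]
  congr 1
  apply pullback.hom_ext <;> simp

lemma compOf_alg : T.map (D.compOf f g h) ≫ D.D₁.a =
    D.compOf (T.map f ≫ D.D₁.a) (T.map g ≫ D.D₁.a)
      (by rw [Category.assoc, Category.assoc, ← D.cod.h, ← D.dom.h, ← Functor.map_comp_assoc,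
            ← Functor.map_comp_assoc, h]) := by
  rw [compOf, T.map_comp, Category.assoc, D.comp_alg, compOf, ← Category.assoc]
  congr 1
  apply pullback.hom_ext
  · rw [Category.assoc, pullback.lift_fst, pullback.lift_fst, ← Functor.map_comp_assoc,
      pullback.lift_fst]
  · rw [Category.assoc, pullback.lift_snd, pullback.lift_snd, ← Functor.map_comp_assoc,
      pullback.lift_snd]

lemma compOf_ids (hf : f = g ≫ D.dom.f ≫ D.ids.f) : D.compOf f g h = g := by
  subst hf
  refine Eq.trans ?_ ((g ≫= D.comp_ids).trans (Category.comp_id g))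
  rw [compOf, ← Category.assoc g (pullback.lift _ _ _)]
  congr 1
  apply pullback.hom_ext <;> simp

lemma ids_compOf (hg : g = f ≫ D.cod.f ≫ D.ids.f) : D.compOf f g h = f := by
  subst hg
  refine Eq.trans ?_ ((f ≫= D.ids_comp).trans (Category.comp_id f))
  rw [compOf, ← Category.assoc f (pullback.lift _ _ _)]
  congr 1
  apply pullback.hom_ext <;> simp

lemma compOf_assoc (k : X ⟶ D.D₁.A) (h' : g ≫ D.cod.f = k ≫ D.dom.f) :
    D.compOf (D.compOf f g h) k (by rw [compOf_cod, h']) =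
      D.compOf f (D.compOf g k h') (by rw [compOf_dom, h]) := by
  have := pullback.lift (f := pullback.snd D.cod.f D.dom.f ≫ D.cod.f) (g := D.dom.f)
    (pullback.lift f g h) k (by rw [pullback.lift_snd_assoc, h']) ≫= D.assoc
  simp only [← Category.assoc] at this
  refine Eq.trans ?_ (this.trans ?_)
  · rw [compOf]
    congr 1
    apply pullback.hom_ext <;> simp [compOf]
  · rw [compOf]
    congr 1
    apply pullback.hom_ext
    · simp
    · simp only [Category.assoc, pullback.lift_snd]
      rw [compOf, ← Category.assoc]
      congr 1
      apply pullback.hom_ext <;> simp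

end lemmas

/-- The object of arrows of the underlying `T`-multicategory, `T D₀ ×_{D₀} D₁`: a multi-arrow from
`x` in `T D₀` to `a` is an arrow of `D` from the "tensor product" of `x` (given by the algebra
structure of `D₀`) to `a`. -/
noncomputable abbrev multiArr : E := pullback D.D₀.a D.dom.f

/-- The codomain of a multi-arrow. -/
noncomputable def multiCod : D.multiArr ⟶ D.D₀.A := pullback.snd _ _ ≫ D.cod.f

lemma multi_condition {X : E} (w : X ⟶ T.obj D.multiArr) (p : X ⟶ D.multiArr)
    (h : w ≫ T.map D.multiCod = p ≫ pullback.fst D.D₀.a D.dom.f) :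
    (w ≫ T.map (pullback.snd D.D₀.a D.dom.f) ≫ D.D₁.a) ≫ D.cod.f =
      (p ≫ pullback.snd D.D₀.a D.dom.f) ≫ D.dom.f := by
  rw [Category.assoc, Category.assoc, Category.assoc, ← D.cod.h, ← pullback.condition,
    ← reassoc_of% h, ← Functor.map_comp_assoc]
  rfl

/-- Composition of multi-arrows: the domains are multiplied, and a `T`-family of arrows of `D` is
turned into one arrow by the algebra structure of `D₁`, then composed in `D`. -/
noncomputable def multiCompOf {X : E} (w : X ⟶ T.obj D.multiArr) (p : X ⟶ D.multiArr)
    (h : w ≫ T.map D.multiCod = p ≫ pullback.fst D.D₀.a D.dom.f) : X ⟶ D.multiArr :=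
  pullback.lift (w ≫ T.map (pullback.fst D.D₀.a D.dom.f) ≫ T.μ.app D.D₀.A)
    (D.compOf (w ≫ T.map (pullback.snd D.D₀.a D.dom.f) ≫ D.D₁.a)
      (p ≫ pullback.snd D.D₀.a D.dom.f) (D.multi_condition w p h))
    (by
      rw [compOf_dom, Category.assoc, Category.assoc, Category.assoc, Category.assoc, ← D.dom.h,
        D.D₀.assoc, ← Functor.map_comp_assoc, ← Functor.map_comp_assoc, pullback.condition])

section multi

variable {X Y : E} (w : X ⟶ T.obj D.multiArr) (p : X ⟶ D.multiArr)
    (h : w ≫ T.map D.multiCod = p ≫ pullback.fst D.D₀.a D.dom.f)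

lemma multiCompOf_fst : D.multiCompOf w p h ≫ pullback.fst D.D₀.a D.dom.f =
    w ≫ T.map (pullback.fst D.D₀.a D.dom.f) ≫ T.μ.app D.D₀.A :=
  pullback.lift_fst _ _ _

lemma multiCompOf_snd : D.multiCompOf w p h ≫ pullback.snd D.D₀.a D.dom.f =
    D.compOf (w ≫ T.map (pullback.snd D.D₀.a D.dom.f) ≫ D.D₁.a)
      (p ≫ pullback.snd D.D₀.a D.dom.f) (D.multi_condition w p h) :=
  pullback.lift_snd _ _ _

lemma multiCompOf_cod : D.multiCompOf w p h ≫ D.multiCod = p ≫ D.multiCod := by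
  rw [multiCod, ← Category.assoc, multiCompOf_snd, compOf_cod, Category.assoc]

lemma multiCompOf_congr {w' : X ⟶ T.obj D.multiArr} {p' : X ⟶ D.multiArr} (hw : w = w')
    (hp : p = p') : D.multiCompOf w p h = D.multiCompOf w' p' (by rw [← hw, ← hp, h]) := by
  subst hw hp; rfl

lemma precomp_multiCompOf (k : Y ⟶ X) : k ≫ D.multiCompOf w p h =
    D.multiCompOf (k ≫ w) (k ≫ p) (by rw [Category.assoc, h, Category.assoc]) := by
  apply pullback.hom_ext
  · rw [Category.assoc, multiCompOf_fst, multiCompOf_fst, Category.assoc]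
  · rw [Category.assoc, multiCompOf_snd, multiCompOf_snd, precomp_compOf]
    exact D.compOf_congr _ _ _ (Category.assoc _ _ _).symm (Category.assoc _ _ _).symm

/-- The composition of the underlying `T`-multicategory. -/
noncomputable def multiComp :
    pullback (T.map D.multiCod) (pullback.fst D.D₀.a D.dom.f) ⟶ D.multiArr :=
  D.multiCompOf (pullback.fst _ _) (pullback.snd _ _) pullback.condition

lemma lift_multiComp : pullback.lift w p h ≫ D.multiComp = D.multiCompOf w p h := by
  rw [multiComp, precomp_multiCompOf]
  apply multiCompOf_congr
  · exact pullback.lift_fst _ _ _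
  · exact pullback.lift_snd _ _ _

/-- The identities of the underlying `T`-multicategory. -/
noncomputable def multiIds : D.D₀.A ⟶ D.multiArr :=
  pullback.lift (T.η.app D.D₀.A) D.ids.f (by rw [D.D₀.unit, ids_dom_f])

lemma multiIds_fst : D.multiIds ≫ pullback.fst D.D₀.a D.dom.f = T.η.app D.D₀.A :=
  pullback.lift_fst _ _ _

lemma multiIds_snd : D.multiIds ≫ pullback.snd D.D₀.a D.dom.f = D.ids.f :=
  pullback.lift_snd _ _ _

lemma multi_comp_ids (h : (pullback.fst D.D₀.a D.dom.f ≫ T.map D.multiIds) ≫ T.map D.multiCod =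
    𝟙 _ ≫ pullback.fst D.D₀.a D.dom.f) :
    pullback.lift (pullback.fst D.D₀.a D.dom.f ≫ T.map D.multiIds) (𝟙 _) h ≫ D.multiComp =
      𝟙 _ := by
  rw [lift_multiComp]
  apply pullback.hom_ext
  · rw [multiCompOf_fst, Category.assoc, ← Functor.map_comp_assoc, multiIds_fst, T.right_unit]
    exact (Category.comp_id _).trans (Category.id_comp _).symm
  · rw [multiCompOf_snd]
    refine (D.compOf_ids _ _ _ ?_)
    rw [Category.id_comp, Category.assoc, ← Functor.map_comp_assoc, multiIds_snd, D.ids.h,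
      pullback.condition_assoc]

lemma multi_ids_comp (h : T.η.app D.multiArr ≫ T.map D.multiCod =
    (D.multiCod ≫ D.multiIds) ≫ pullback.fst D.D₀.a D.dom.f) :
    pullback.lift (T.η.app D.multiArr) (D.multiCod ≫ D.multiIds) h ≫ D.multiComp = 𝟙 _ := by
  rw [lift_multiComp]
  have e : T.η.app D.multiArr ≫ T.map (pullback.snd D.D₀.a D.dom.f) ≫ D.D₁.a =
      pullback.snd D.D₀.a D.dom.f := by
    refine (T.η.naturality_assoc _ _).symm.trans ?_
    rw [D.D₁.unit]
    exact Category.comp_id _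
  apply pullback.hom_ext
  · rw [multiCompOf_fst]
    refine (T.η.naturality_assoc _ _).symm.trans ?_
    rw [T.left_unit]
    exact (Category.comp_id _).trans (Category.id_comp _).symm
  · rw [multiCompOf_snd, Category.id_comp]
    refine (D.ids_compOf _ _ _ ?_).trans e
    rw [Category.assoc, multiIds_snd, multiCod, Category.assoc]
    exact congrArg (· ≫ D.cod.f ≫ D.ids.f) e.symm

variable {D} in
lemma multiCompOf_assoc
    (t : X ⟶ T.obj (pullback (T.map D.multiCod) (pullback.fst D.D₀.a D.dom.f)))
    (h₁ : (t ≫ T.map D.multiComp) ≫ T.map D.multiCod = p ≫ pullback.fst D.D₀.a D.dom.f)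
    (h₂ : (t ≫ T.map (pullback.snd (T.map D.multiCod) (pullback.fst D.D₀.a D.dom.f))) ≫
      T.map D.multiCod = p ≫ pullback.fst D.D₀.a D.dom.f)
    (h₃ : (t ≫ T.map (pullback.fst (T.map D.multiCod) (pullback.fst D.D₀.a D.dom.f)) ≫
        T.μ.app D.multiArr) ≫ T.map D.multiCod =
      D.multiCompOf (t ≫ T.map (pullback.snd (T.map D.multiCod)
        (pullback.fst D.D₀.a D.dom.f))) p h₂ ≫ pullback.fst D.D₀.a D.dom.f) :
    D.multiCompOf (t ≫ T.map D.multiComp) p h₁ =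
      D.multiCompOf (t ≫ T.map (pullback.fst (T.map D.multiCod) (pullback.fst D.D₀.a D.dom.f)) ≫
        T.μ.app D.multiArr)
        (D.multiCompOf (t ≫ T.map (pullback.snd (T.map D.multiCod)
          (pullback.fst D.D₀.a D.dom.f))) p h₂) h₃ := by
  apply pullback.hom_ext
  · rw [multiCompOf_fst, multiCompOf_fst]
    simp only [Category.assoc]
    rw [← Functor.map_comp_assoc, multiComp, multiCompOf_fst, ← T.mu_naturality_assoc]
    simp [T.assoc]
  · rw [multiCompOf_snd, multiCompOf_snd]
    have e : (t ≫ T.map D.multiComp) ≫ T.map (pullback.snd D.D₀.a D.dom.f) ≫ D.D₁.a =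
        t ≫ D.compOf
          (T.map (pullback.fst (T.map D.multiCod) (pullback.fst D.D₀.a D.dom.f) ≫
            T.map (pullback.snd D.D₀.a D.dom.f) ≫ D.D₁.a) ≫ D.D₁.a)
          (T.map (pullback.snd (T.map D.multiCod) (pullback.fst D.D₀.a D.dom.f) ≫
            pullback.snd D.D₀.a D.dom.f) ≫ D.D₁.a)
          (by
            rw [Category.assoc, Category.assoc, ← D.cod.h, ← D.dom.h, ← Functor.map_comp_assoc,
              ← Functor.map_comp_assoc, D.multi_condition _ _ pullback.condition]) := by
      rw [Category.assoc, ← Functor.map_comp_assoc, multiComp, multiCompOf_snd, compOf_alg]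
    refine (D.compOf_congr _ _ _ (e.trans (D.precomp_compOf _ _ _ _)) rfl).trans
      ((D.compOf_assoc _ _ _ _ ?_).trans (D.compOf_congr _ _ _ ?_ ?_))
    · rw [← D.multi_condition _ _ h₂]
      simp only [Category.assoc, T.map_comp]
    · simp only [Category.assoc, T.map_comp]
      rw [← D.D₁.assoc, T.mu_naturality_assoc]
    · rw [multiCompOf_snd]
      apply D.compOf_congr _ _ _ _ rfl
      simp only [Category.assoc, T.map_comp]

end multi

/-- The underlying `T`-multicategory of a `T`-structured category. -/
noncomputable def underlying : TMulticat T where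
  C₀ := D.D₀.A
  C₁ := D.multiArr
  dom := pullback.fst D.D₀.a D.dom.f
  cod := D.multiCod
  comp := D.multiComp
  ids := D.multiIds
  ids_dom := D.multiIds_fst
  ids_cod := by rw [multiCod, ← Category.assoc, multiIds_snd, ids_cod_f]
  comp_dom := D.multiCompOf_fst _ _ _
  comp_cod := D.multiCompOf_cod _ _ _
  comp_ids := D.multi_comp_ids _
  ids_comp := D.multi_ids_comp _
  assoc := by
    rw [lift_multiComp, lift_multiComp]
    refine (multiCompOf_assoc _ _ _ ?_ ?_).trans ?_
    · rw [Category.assoc, ← T.map_comp]; exact pullback.condition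
    · rw [multiCompOf_fst, Category.assoc, Category.assoc, Category.assoc, ← T.mu_naturality,
        ← Functor.map_comp_assoc, ← Functor.map_comp_assoc, pullback.condition]
    · exact D.multiCompOf_congr _ _ _ rfl (D.lift_multiComp _ _ _).symm

end TStructCat

/-- The one-point family over `s : S`. Maps from it to an object of `Over S` are the elements of the
fibre of that object over `s`. -/
def pointOver {S : Type u} (s : S) : Over S := Over.mk (TypeCat.ofHom fun _ : PUnit.{u + 1} => s)

/-- The category `|B|(s)`: the fibre over `s` of the underlying category of a multicategory. -/
abbrev TMulticat.fibre {S : Type u} {T : Monad (Over S)} (B : TMulticat T) (s : S) : Type u :=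
  B.Unary (pointOver s)

/-! A multi-arrow of `A` is a family `x` in `T A₀` together with an arrow `g` of `A` that starts at
the tensor product `⊗x`. It factors as the universal multi-arrow `x → ⊗x`, given by the identity of
`⊗x`, followed by the unary arrow `g`. A map `A × C ⟶ B` is therefore determined by two kinds of
values. At pairs (unary arrow, identity of `C`) it gives functors `F_c : |A| → |B|` indexed by the
objects `c` of `C` (`Action`). At pairs (universal multi-arrow, arrow of `C`) it gives, for each
arrow from a family `(cᵢ)` to `c`, a transformation whose components are arrows of `B` from the
family `F_{cᵢ}(aᵢ)` to `F_c(⊗a)`, natural in the `aᵢ` (`Cells`). Conversely, such data compatible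
with identities and composition (`Lax`) define a map; the main computation is `compOf_laxApp`, and
the correspondence is `toLax_injective` with `toLax_ofLax`. This half does not use that `T` is
cartesian.

Hence `[A, B]` must have the functors as objects and the transformations as arrows. A `Classifier`
is a universal family of each. Over `Set/S` it exists because both kinds of families are determined
by their values at points, and these values can be prescribed freely: the representing object is the
disjoint union of the values at points (`exists_representation`, `nonempty_classifier`).

Cartesianness makes the classifier a multicategory. Composing transformations requires splitting a
family that lies over a multiplied domain into a family of families (`family_isPullback`). Identity
transformations exist because a family over a unit is itself a unit (`exists_unit_eq`). Changing the
index object requires lifting families along it (`exists_reindex`). The axioms of the multicategory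
and its universal property (`existsUnique_hom`) then follow by comparing classified transformations
inside `B`.

Finally, an object of `[A, B]` over `s` is an `Action` indexed by one point over `s`, which is the
same as a functor `|A|(s) → |B|(s)` (`evalAt_bijective`). -/

/-! ### Simplification rules for the unit and multiplication of a monad. -/

namespace CategoryTheory.Monad

variable {E : Type u} [Category.{v} E] (T : Monad E) {X Y Z : E}

/-- The component of the unit, with the identity functor removed from its type. -/
def ηAt (X : E) : X ⟶ T.obj X := T.η.app X

/-- The component of the multiplication, with the composite functor removed from its type. -/
def μAt (X : E) : T.obj (T.obj X) ⟶ T.obj X := T.μ.app X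

@[simp]
lemma ηAt_map (f : X ⟶ Y) : T.ηAt X ≫ T.map f = f ≫ T.ηAt Y :=
  (T.η.naturality f).symm

@[simp]
lemma ηAt_map_assoc (f : X ⟶ Y) {W : E} (ψ : _ ⟶ W) :
    T.ηAt X ≫ T.map f ≫ ψ = f ≫ T.ηAt Y ≫ ψ := by
  simp only [← Category.assoc, ηAt_map]

@[simp]
lemma map_map_μAt (f : X ⟶ Y) :
    T.map (T.map f) ≫ T.μAt Y = T.μAt X ≫ T.map f := T.μ.naturality f

@[simp]
lemma map_map_μAt_assoc (f : X ⟶ Y) {W : E} (ψ : _ ⟶ W) :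
    T.map (T.map f) ≫ T.μAt Y ≫ ψ = T.μAt X ≫ T.map f ≫ ψ := by
  simp only [← Category.assoc, map_map_μAt]

@[simp]
lemma ηAt_μAt : T.ηAt (T.obj X) ≫ T.μAt X = 𝟙 (T.obj X) := T.left_unit X

@[simp]
lemma ηAt_μAt_assoc {W : E} (ψ : _ ⟶ W) :
    T.ηAt (T.obj X) ≫ T.μAt X ≫ ψ = ψ := by
  simp only [← Category.assoc, ηAt_μAt, Category.id_comp]

@[simp]
lemma map_ηAt_μAt : T.map (T.ηAt X) ≫ T.μAt X = 𝟙 (T.obj X) := T.right_unit X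

@[simp]
lemma map_μAt_μAt : T.map (T.μAt X) ≫ T.μAt X = T.μAt (T.obj X) ≫ T.μAt X :=
  T.assoc X

section prod

variable [HasFiniteLimits E] {X' Y' : E} (f : X ⟶ Y) (g : X' ⟶ Y')

@[simp]
lemma map_prodMap_fst :
    T.map (prod.map f g) ≫ T.map prod.fst = T.map prod.fst ≫ T.map f := by
  rw [← T.map_comp, prod.map_fst, T.map_comp]

@[simp]
lemma map_prodMap_fst_assoc {W : E} (ψ : _ ⟶ W) :
    T.map (prod.map f g) ≫ T.map prod.fst ≫ ψ = T.map prod.fst ≫ T.map f ≫ ψ := by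
  simp only [← Category.assoc, map_prodMap_fst]

@[simp]
lemma map_prodMap_snd :
    T.map (prod.map f g) ≫ T.map prod.snd = T.map prod.snd ≫ T.map g := by
  rw [← T.map_comp, prod.map_snd, T.map_comp]

@[simp]
lemma map_prodLift_fst (a : Z ⟶ X) (b : Z ⟶ Y) :
    T.map (prod.lift a b) ≫ T.map prod.fst = T.map a := by
  rw [← T.map_comp, prod.lift_fst]

@[simp]
lemma map_prodLift_fst_assoc (a : Z ⟶ X) (b : Z ⟶ Y) {W : E} (ψ : _ ⟶ W) :
    T.map (prod.lift a b) ≫ T.map prod.fst ≫ ψ = T.map a ≫ ψ := by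
  simp only [← Category.assoc, map_prodLift_fst]

@[simp]
lemma map_prodLift_snd (a : Z ⟶ X) (b : Z ⟶ Y) :
    T.map (prod.lift a b) ≫ T.map prod.snd = T.map b := by
  rw [← T.map_comp, prod.lift_snd]

@[simp]
lemma map_prodLift_snd_assoc (a : Z ⟶ X) (b : Z ⟶ Y) {W : E} (ψ : _ ⟶ W) :
    T.map (prod.lift a b) ≫ T.map prod.snd ≫ ψ = T.map b ≫ ψ := by
  simp only [← Category.assoc, map_prodLift_snd]

@[simp]
lemma map_prodLift_prodMap (a : Z ⟶ X) (b : Z ⟶ X') :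
    T.map (prod.lift a b) ≫ T.map (prod.map f g) = T.map (prod.lift (a ≫ f) (b ≫ g)) := by
  rw [← T.map_comp, prod.lift_map]

@[simp]
lemma map_prodLift_prodMap_assoc (a : Z ⟶ X) (b : Z ⟶ X') {W : E} (ψ : _ ⟶ W) :
    T.map (prod.lift a b) ≫ T.map (prod.map f g) ≫ ψ = T.map (prod.lift (a ≫ f) (b ≫ g)) ≫ ψ := by
  simp only [← Category.assoc, map_prodLift_prodMap]

end prod

end CategoryTheory.Monad

open CategoryTheory.Monad

/-! ### Composition in a `T`-multicategory on generalized elements. -/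

namespace TMulticat

variable {E : Type u} [Category.{v} E] [HasFiniteLimits E] {T : Monad E}

section

variable (C : TMulticat T) {X Y : E}

@[simp]
lemma ids_dom_ηAt : C.ids ≫ C.dom = T.ηAt C.C₀ := C.ids_dom

@[simp]
lemma ids_dom_ηAt_assoc {W : E} (ψ : _ ⟶ W) :
    C.ids ≫ C.dom ≫ ψ = T.ηAt C.C₀ ≫ ψ := by
  simp only [← Category.assoc, ids_dom_ηAt]

attribute [simp] ids_cod

@[simp]
lemma ids_cod_assoc {W : E} (k : _ ⟶ W) : C.ids ≫ C.cod ≫ k = k := by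
  simp only [← Category.assoc, ids_cod, Category.id_comp]

@[simp]
lemma map_ids_cod : T.map C.ids ≫ T.map C.cod = 𝟙 _ := by
  rw [← T.map_comp, ids_cod, T.map_id]

@[simp]
lemma compOf_dom_μAt (w : X ⟶ T.obj C.C₁) (f : X ⟶ C.C₁) (h : w ≫ T.map C.cod = f ≫ C.dom) :
    C.compOf w f h ≫ C.dom = w ≫ T.map C.dom ≫ T.μAt C.C₀ := C.compOf_dom w f h

attribute [simp] compOf_cod

@[simp]
lemma compOf_cod_assoc (w : X ⟶ T.obj C.C₁) (f : X ⟶ C.C₁) (h : w ≫ T.map C.cod = f ≫ C.dom)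
    {W : E} (k : _ ⟶ W) : C.compOf w f h ≫ C.cod ≫ k = f ≫ C.cod ≫ k := by
  simp only [← Category.assoc, compOf_cod]

@[simp]
lemma map_compOf_cod (w : X ⟶ T.obj C.C₁) (f : X ⟶ C.C₁) (h : w ≫ T.map C.cod = f ≫ C.dom) :
    T.map (C.compOf w f h) ≫ T.map C.cod = T.map f ≫ T.map C.cod := by
  simp only [← T.map_comp, compOf_cod]

lemma ids_compOf' (f : X ⟶ C.C₁) (w : X ⟶ T.obj C.C₁) (g : X ⟶ C.C₁)
    (hw : w = f ≫ T.ηAt C.C₁) (hg : g = f ≫ C.cod ≫ C.ids)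
    (h : w ≫ T.map C.cod = g ≫ C.dom) : C.compOf w g h = f := C.ids_compOf f w g hw hg h

/-- Associativity for a family, indexed by a generalized element of `T Y`, of composites of
`Y`-indexed arrows. -/
lemma compOf_map_compOf (y : X ⟶ T.obj Y) (w : Y ⟶ T.obj C.C₁) (f : Y ⟶ C.C₁)
    (h : w ≫ T.map C.cod = f ≫ C.dom) (p : X ⟶ C.C₁)
    (hp : (y ≫ T.map f) ≫ T.map C.cod = p ≫ C.dom)
    (h₁ : (y ≫ T.map (C.compOf w f h)) ≫ T.map C.cod = p ≫ C.dom)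
    (h₂ : (y ≫ T.map w ≫ T.μAt C.C₁) ≫ T.map C.cod =
      C.compOf (y ≫ T.map f) p hp ≫ C.dom) :
    C.compOf (y ≫ T.map (C.compOf w f h)) p h₁ =
      C.compOf (y ≫ T.map w ≫ T.μAt C.C₁) (C.compOf (y ≫ T.map f) p hp) h₂ := by
  refine Eq.trans (compOf_congr _ ?_ rfl _) ((compOf_assoc C
      (y ≫ T.map (pullback.lift w f h)) p ?_).trans (compOf_congr _ ?_ (compOf_congr _ ?_ rfl _) _))
  · rw [Category.assoc, ← T.map_comp]; rfl
  · rw [← hp, T.map_comp, Category.assoc, Category.assoc, ← T.map_comp_assoc, pullback.lift_snd]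
  · rw [Category.assoc, ← Functor.map_comp_assoc, pullback.lift_fst]; rfl
  · simp [← T.map_comp]

/-- Associativity for the composite of a composite with a unary arrow. -/
lemma compOf_eta_compOf (w : X ⟶ T.obj C.C₁) (f : X ⟶ C.C₁)
    (h : w ≫ T.map C.cod = f ≫ C.dom) (p : X ⟶ C.C₁)
    (h₁ : (C.compOf w f h ≫ T.ηAt C.C₁) ≫ T.map C.cod = p ≫ C.dom)
    (h₂ : (f ≫ T.ηAt C.C₁) ≫ T.map C.cod = p ≫ C.dom)
    (h₃ : w ≫ T.map C.cod = C.compOf (f ≫ T.ηAt C.C₁) p h₂ ≫ C.dom) :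
    C.compOf (C.compOf w f h ≫ T.ηAt C.C₁) p h₁ =
      C.compOf w (C.compOf (f ≫ T.ηAt C.C₁) p h₂) h₃ := by
  -- This is the case of a one-element family, `y = η`, of `compOf_map_compOf`; the multiplication
  -- then cancels against the unit.
  refine Eq.trans (compOf_congr _ ?_ rfl _)
    ((C.compOf_map_compOf (T.ηAt X) w f h p ?_ ?_ ?_).trans
      (compOf_congr _ ?_ (compOf_congr _ ?_ rfl _) _)) <;> simp
  · simpa using h₂
  · simpa using h₂
  · exact h

end

/-! ### Values of a map out of a product of multicategories. -/

section pairApp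

@[simp]
lemma prodIds_fst_assoc (C D : TMulticat T) {W : E} (ψ : _ ⟶ W) :
    prodIds C D ≫ prodFst C D ≫ ψ = prod.fst ≫ C.ids ≫ ψ := by
  simp only [← Category.assoc, prodIds_fst]

lemma map_prodFst_dom_assoc (C D : TMulticat T) {W : E} (ψ : _ ⟶ W) :
    T.map (prodFst C D) ≫ T.map C.dom ≫ ψ = T.map (prodDom C D) ≫ T.map (T.map prod.fst) ≫ ψ := by
  rw [← T.map_comp_assoc, prodFst_dom, T.map_comp_assoc]

lemma map_prodSnd_dom_assoc (C D : TMulticat T) {W : E} (ψ : _ ⟶ W) :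
    T.map (prodSnd C D) ≫ T.map D.dom ≫ ψ = T.map (prodDom C D) ≫ T.map (T.map prod.snd) ≫ ψ := by
  rw [← T.map_comp_assoc, prodSnd_dom, T.map_comp_assoc]

@[simp]
lemma prodFst_dom_assoc (C D : TMulticat T) {W : E} (ψ : _ ⟶ W) :
    prodFst C D ≫ C.dom ≫ ψ = prodDom C D ≫ T.map prod.fst ≫ ψ := by
  simp only [← Category.assoc, prodFst_dom]

variable {C D B : TMulticat T} (H : product C D ⟶ B) {X Y : E}

/-- The action on objects of a map out of a product. -/
noncomputable def Hom.pairObj : C.C₀ ⨯ D.C₀ ⟶ B.C₀ := H.f₀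

/-- The action on arrows of a map out of a product. -/
noncomputable def Hom.pairArr : prodArr C D ⟶ B.C₁ := H.f₁

/-- The value of a map out of a product at the arrow with the given domain and components. -/
noncomputable def Hom.pairApp (d : X ⟶ T.obj (C.C₀ ⨯ D.C₀)) (f : X ⟶ C.C₁) (g : X ⟶ D.C₁)
    (hf : f ≫ C.dom = d ≫ T.map prod.fst) (hg : g ≫ D.dom = d ≫ T.map prod.snd) : X ⟶ B.C₁ :=
  prodArrLift d f g hf hg ≫ Hom.pairArr H

variable {d d' : X ⟶ T.obj (C.C₀ ⨯ D.C₀)} {f f' : X ⟶ C.C₁} {g g' : X ⟶ D.C₁}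
  {hf : f ≫ C.dom = d ≫ T.map prod.fst} {hg : g ≫ D.dom = d ≫ T.map prod.snd}
  {hf' : f' ≫ C.dom = d' ≫ T.map prod.fst} {hg' : g' ≫ D.dom = d' ≫ T.map prod.snd}

lemma Hom.pairApp_congr (h₁ : d = d') (h₂ : f = f') (h₃ : g = g') :
    H.pairApp d f g hf hg = H.pairApp d' f' g' hf' hg' := by
  subst h₁ h₂ h₃; rfl

lemma precomp_prodArrLift (k : Y ⟶ X) : k ≫ prodArrLift d f g hf hg =
    prodArrLift (k ≫ d) (k ≫ f) (k ≫ g) (by simp [hf]) (by simp [hg]) := by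
  apply prodArr_hom_ext <;> simp

@[simp] lemma prodArrLift_cod :
    prodArrLift d f g hf hg ≫ prodCod C D = prod.lift (f ≫ C.cod) (g ≫ D.cod) := by
  apply Limits.prod.hom_ext
  · rw [Category.assoc, prodCod_fst, ← Category.assoc, prodArrLift_fst, prod.lift_fst]
  · rw [Category.assoc, prodCod_snd, ← Category.assoc, prodArrLift_snd, prod.lift_snd]

@[simp] lemma prodArrLift_dom_assoc {W : E} (ψ : _ ⟶ W) :
    prodArrLift d f g hf hg ≫ prodDom C D ≫ ψ = d ≫ ψ := by
  rw [← Category.assoc, prodArrLift_dom]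

@[simp] lemma prodArrLift_fst_assoc {W : E} (ψ : _ ⟶ W) :
    prodArrLift d f g hf hg ≫ prodFst C D ≫ ψ = f ≫ ψ := by
  rw [← Category.assoc, prodArrLift_fst]

lemma Hom.precomp_pairApp (k : Y ⟶ X) : k ≫ H.pairApp d f g hf hg =
    H.pairApp (k ≫ d) (k ≫ f) (k ≫ g) (by simp [hf]) (by simp [hg]) := by
  rw [pairApp, ← Category.assoc, precomp_prodArrLift]
  rfl

@[simp]
lemma Hom.pairArr_dom : Hom.pairArr H ≫ B.dom = prodDom C D ≫ T.map (Hom.pairObj H) := H.dom_comm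

@[simp]
lemma Hom.pairArr_cod : Hom.pairArr H ≫ B.cod = prodCod C D ≫ Hom.pairObj H := H.cod_comm

@[simp]
lemma Hom.pairApp_dom : H.pairApp d f g hf hg ≫ B.dom = d ≫ T.map (Hom.pairObj H) := by
  rw [pairApp, Category.assoc, pairArr_dom, ← Category.assoc, prodArrLift_dom]

@[simp]
lemma Hom.pairApp_cod : H.pairApp d f g hf hg ≫ B.cod =
    prod.lift (f ≫ C.cod) (g ≫ D.cod) ≫ Hom.pairObj H := by
  rw [pairApp, Category.assoc, pairArr_cod, ← Category.assoc, prodArrLift_cod]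

/-- The Yoneda step: the whole action on arrows is the value at the generic arrow of the product, so
statements about `pairApp` suffice. -/
lemma Hom.pairArr_eq_pairApp : Hom.pairArr H = H.pairApp (prodDom C D) (prodFst C D) (prodSnd C D)
    (prodFst_dom C D) (prodSnd_dom C D) := by
  refine (Category.id_comp _).symm.trans ?_
  rw [pairApp]
  congr 1
  apply prodArr_hom_ext <;> simp

lemma Hom.pairApp_ids (c : X ⟶ C.C₀) (e : X ⟶ D.C₀) :
    H.pairApp (prod.lift c e ≫ T.ηAt _) (c ≫ C.ids) (e ≫ D.ids)
      (by simp) (by simp) = prod.lift c e ≫ Hom.pairObj H ≫ B.ids := by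
  have : Hom.pairObj H ≫ B.ids = prodIds C D ≫ Hom.pairArr H := H.ids_comm.symm
  rw [this]
  refine Eq.trans (congrArg (· ≫ Hom.pairArr H) ?_) (Category.assoc _ _ _)
  apply prodArr_hom_ext
  · rw [prodArrLift_dom, Category.assoc, prodIds_dom]; rfl
  · simp [prodIds_fst]
  · simp [prodIds_snd]

/-- A map out of a product preserves composites. -/
lemma Hom.compOf_pairApp (y : Y ⟶ T.obj X) {d₁ : Y ⟶ T.obj (C.C₀ ⨯ D.C₀)} {f₁ : Y ⟶ C.C₁}
    {g₁ : Y ⟶ D.C₁} {hf₁ : f₁ ≫ C.dom = d₁ ≫ T.map prod.fst}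
    {hg₁ : g₁ ≫ D.dom = d₁ ≫ T.map prod.snd}
    (hd : y ≫ T.map (prod.lift (f ≫ C.cod) (g ≫ D.cod)) = d₁)
    (h : (y ≫ T.map (H.pairApp d f g hf hg)) ≫ T.map B.cod = H.pairApp d₁ f₁ g₁ hf₁ hg₁ ≫ B.dom)
    (h₁ : (y ≫ T.map f) ≫ T.map C.cod = f₁ ≫ C.dom)
    (h₂ : (y ≫ T.map g) ≫ T.map D.cod = g₁ ≫ D.dom) :
    B.compOf (y ≫ T.map (H.pairApp d f g hf hg)) (H.pairApp d₁ f₁ g₁ hf₁ hg₁) h =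
      H.pairApp (y ≫ T.map d ≫ T.μAt _) (C.compOf (y ≫ T.map f) f₁ h₁)
        (D.compOf (y ≫ T.map g) g₁ h₂)
        (by
          simp only [compOf_dom_μAt, Category.assoc, ← map_map_μAt]
          rw [← T.map_comp_assoc, ← T.map_comp_assoc, hf])
        (by
          simp only [compOf_dom_μAt, Category.assoc, ← map_map_μAt]
          rw [← T.map_comp_assoc, ← T.map_comp_assoc, hg]) := by
  -- Composability in the product includes agreement in `T (C₀ × D₀)`, which agreement of the two
  -- components does not give; this is what `hd` supplies.
  have hc : (y ≫ T.map (prodArrLift d f g hf hg)) ≫ T.map (prodCod C D) =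
      prodArrLift d₁ f₁ g₁ hf₁ hg₁ ≫ prodDom C D := by
    rw [prodArrLift_dom, ← hd, Category.assoc, ← T.map_comp, prodArrLift_cod]
  refine Eq.trans (compOf_congr _ ?_ rfl _) ((H.compOf_comm (C := product C D)
    (y ≫ T.map (prodArrLift d f g hf hg)) (prodArrLift d₁ f₁ g₁ hf₁ hg₁) hc).symm.trans ?_)
  · rw [Category.assoc]; exact congrArg (y ≫ ·) (T.map_comp _ _)
  · refine congrArg (· ≫ Hom.pairArr H) ((lift_prodComp _ _ hc).trans ?_)
    apply prodArr_hom_ext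
    · rw [prodCompOf_dom, prodArrLift_dom, Category.assoc, ← T.map_comp_assoc, prodArrLift_dom]
      rfl
    · refine (prodCompOf_fst _ _ _).trans (Eq.trans ?_ (prodArrLift_fst _ _ _ _ _).symm)
      exact compOf_congr _ (by rw [Category.assoc, ← T.map_comp, prodArrLift_fst])
        (prodArrLift_fst d₁ f₁ g₁ hf₁ hg₁) _
    · refine (prodCompOf_snd _ _ _).trans (Eq.trans ?_ (prodArrLift_snd _ _ _ _ _).symm)
      exact compOf_congr _ (by rw [Category.assoc, ← T.map_comp, prodArrLift_snd])
        (prodArrLift_snd d₁ f₁ g₁ hf₁ hg₁) _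

end pairApp

end TMulticat

/-! ### `T`-structured categories and their multi-arrows on generalized elements. -/

namespace TStructCat

variable {E : Type u} [Category.{v} E] [HasFiniteLimits E] {T : Monad E} (A : TStructCat T)
  {X Y : E}

/-- The algebra structure on objects, as a map between objects of objects of the underlying
multicategory. -/
noncomputable def tensor : T.obj A.underlying.C₀ ⟶ A.underlying.C₀ := A.D₀.a

/-- The source of an arrow of a `T`-structured category. -/
noncomputable def src : A.D₁.A ⟶ A.underlying.C₀ := A.dom.f

/-- The target of an arrow of a `T`-structured category. -/
noncomputable def tgt : A.D₁.A ⟶ A.underlying.C₀ := A.cod.f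

/-- The identity arrows of a `T`-structured category. -/
noncomputable def idArr : A.underlying.C₀ ⟶ A.D₁.A := A.ids.f

/-- The composite of arrows of a `T`-structured category. -/
noncomputable def seq (f g : X ⟶ A.D₁.A) (h : f ≫ A.tgt = g ≫ A.src) : X ⟶ A.D₁.A :=
  A.compOf f g h

@[simp]
lemma ηAt_tensor : T.ηAt _ ≫ A.tensor = 𝟙 _ := A.D₀.unit

@[simp]
lemma ηAt_tensor_assoc {W : E} (ψ : _ ⟶ W) :
    T.ηAt _ ≫ A.tensor ≫ ψ = ψ := by
  simp only [← Category.assoc, ηAt_tensor, Category.id_comp]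

@[simp]
lemma map_tensor_tensor : T.map A.tensor ≫ A.tensor = T.μAt _ ≫ A.tensor := A.D₀.assoc.symm

@[simp]
lemma map_tensor_tensor_assoc {W : E} (ψ : _ ⟶ W) :
    T.map A.tensor ≫ A.tensor ≫ ψ = T.μAt _ ≫ A.tensor ≫ ψ := by
  simp only [← Category.assoc, map_tensor_tensor]

@[simp]
lemma ηAt_alg : T.ηAt A.D₁.A ≫ A.D₁.a = 𝟙 _ := A.D₁.unit

@[simp]
lemma map_alg_alg : T.map A.D₁.a ≫ A.D₁.a = T.μAt _ ≫ A.D₁.a := A.D₁.assoc.symm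

@[simp]
lemma idArr_src : A.idArr ≫ A.src = 𝟙 _ := A.ids_dom_f

@[simp]
lemma idArr_src_assoc {W : E} (ψ : _ ⟶ W) :
    A.idArr ≫ A.src ≫ ψ = ψ := by
  simp only [← Category.assoc, idArr_src, Category.id_comp]

@[simp]
lemma idArr_tgt : A.idArr ≫ A.tgt = 𝟙 _ := A.ids_cod_f

@[simp]
lemma idArr_tgt_assoc {W : E} (ψ : _ ⟶ W) :
    A.idArr ≫ A.tgt ≫ ψ = ψ := by
  simp only [← Category.assoc, idArr_tgt, Category.id_comp]

@[simp]
lemma map_idArr_tgt : T.map A.idArr ≫ T.map A.tgt = 𝟙 _ := by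
  rw [← T.map_comp, idArr_tgt, T.map_id]

@[simp]
lemma alg_src : A.D₁.a ≫ A.src = T.map A.src ≫ A.tensor := A.dom.h.symm

@[simp]
lemma alg_tgt : A.D₁.a ≫ A.tgt = T.map A.tgt ≫ A.tensor := A.cod.h.symm

@[simp]
lemma alg_tgt_assoc {W : E} (ψ : _ ⟶ W) :
    A.D₁.a ≫ A.tgt ≫ ψ = T.map A.tgt ≫ A.tensor ≫ ψ := by
  simp only [← Category.assoc, alg_tgt]

@[simp]
lemma map_idArr_alg : T.map A.idArr ≫ A.D₁.a = A.tensor ≫ A.idArr := A.ids.h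

section seq

variable (f g : X ⟶ A.D₁.A) (h : f ≫ A.tgt = g ≫ A.src)

@[simp]
lemma seq_src : A.seq f g h ≫ A.src = f ≫ A.src := A.compOf_dom f g h

@[simp]
lemma seq_src_assoc {W : E} (ψ : _ ⟶ W) :
    A.seq f g h ≫ A.src ≫ ψ = f ≫ A.src ≫ ψ := by
  simp only [← Category.assoc, seq_src]

@[simp]
lemma seq_tgt : A.seq f g h ≫ A.tgt = g ≫ A.tgt := A.compOf_cod f g h

lemma precomp_seq (k : Y ⟶ X) : k ≫ A.seq f g h = A.seq (k ≫ f) (k ≫ g) (by simp [h]) :=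
  A.precomp_compOf f g h k

variable {A f g} in
lemma seq_congr {f' g' : X ⟶ A.D₁.A} (hf : f = f') (hg : g = g') :
    A.seq f g h = A.seq f' g' (by rw [← hf, ← hg, h]) := by
  subst hf hg; rfl

lemma idArr_seq (hf : f = g ≫ A.src ≫ A.idArr) : A.seq f g h = g := A.compOf_ids f g h hf

lemma seq_idArr (hg : g = f ≫ A.tgt ≫ A.idArr) : A.seq f g h = f := A.ids_compOf f g h hg

end seq

/-- The generalized multi-arrow with domain `x` given by the arrow `g` of `A`. -/
noncomputable def multiMk (x : X ⟶ T.obj A.underlying.C₀) (g : X ⟶ A.D₁.A)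
    (h : x ≫ A.tensor = g ≫ A.src) : X ⟶ A.underlying.C₁ :=
  pullback.lift x g h

/-- The arrow of `A` which gives a multi-arrow. -/
noncomputable def multiSnd : A.underlying.C₁ ⟶ A.D₁.A := pullback.snd A.D₀.a A.dom.f

section

variable (x : X ⟶ T.obj A.underlying.C₀) (g : X ⟶ A.D₁.A) (h : x ≫ A.tensor = g ≫ A.src)

@[simp]
lemma multiMk_dom : A.multiMk x g h ≫ A.underlying.dom = x := pullback.lift_fst _ _ _

@[simp]
lemma multiMk_snd : A.multiMk x g h ≫ A.multiSnd = g := pullback.lift_snd _ _ _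

@[simp]
lemma multiSnd_src : A.multiSnd ≫ A.src = A.underlying.dom ≫ A.tensor :=
  pullback.condition.symm

@[simp]
lemma multiSnd_src_assoc {W : E} (ψ : _ ⟶ W) :
    A.multiSnd ≫ A.src ≫ ψ = A.underlying.dom ≫ A.tensor ≫ ψ := by
  simp only [← Category.assoc, multiSnd_src]

@[simp]
lemma map_multiSnd_src :
    T.map A.multiSnd ≫ T.map A.src = T.map A.underlying.dom ≫ T.map A.tensor := by
  rw [← T.map_comp, multiSnd_src, T.map_comp]

@[simp]
lemma map_multiSnd_src_assoc {W : E} (ψ : _ ⟶ W) :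
    T.map A.multiSnd ≫ T.map A.src ≫ ψ = T.map A.underlying.dom ≫ T.map A.tensor ≫ ψ := by
  simp only [← Category.assoc, map_multiSnd_src]

@[simp]
lemma ids_multiSnd : A.underlying.ids ≫ A.multiSnd = A.idArr := A.multiIds_snd

@[simp]
lemma multiSnd_tgt : A.multiSnd ≫ A.tgt = A.underlying.cod := rfl

@[simp]
lemma multiMk_cod : A.multiMk x g h ≫ A.underlying.cod = g ≫ A.tgt :=
  pullback.lift_snd_assoc _ _ _ _

@[simp]
lemma multiMk_cod_assoc {W : E} (ψ : _ ⟶ W) :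
    A.multiMk x g h ≫ A.underlying.cod ≫ ψ = g ≫ A.tgt ≫ ψ := by
  simp only [← Category.assoc, multiMk_cod]

@[simp]
lemma map_multiMk_cod :
    T.map (A.multiMk x g h) ≫ T.map A.underlying.cod = T.map g ≫ T.map A.tgt := by
  simp only [← T.map_comp, multiMk_cod]

variable {A} in
lemma multi_hom_ext {f g : X ⟶ A.underlying.C₁}
    (h₁ : f ≫ A.underlying.dom = g ≫ A.underlying.dom)
    (h₂ : f ≫ A.multiSnd = g ≫ A.multiSnd) : f = g := pullback.hom_ext h₁ h₂

lemma precomp_multiMk (k : Y ⟶ X) : k ≫ A.multiMk x g h =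
    A.multiMk (k ≫ x) (k ≫ g) (by simp [h]) := by
  apply multi_hom_ext <;> simp

variable {A x g} in
lemma multiMk_congr {x' : X ⟶ T.obj A.underlying.C₀} {g' : X ⟶ A.D₁.A}
    {h' : x' ≫ A.tensor = g' ≫ A.src} (hx : x = x') (hg : g = g') :
    A.multiMk x g h = A.multiMk x' g' h' := by
  subst hx hg; rfl

lemma ids_eq_multiMk : A.underlying.ids = A.multiMk (T.ηAt _) A.idArr (by simp) := rfl

variable {A} in
lemma compOf_multiSnd (w : X ⟶ T.obj A.underlying.C₁) (p : X ⟶ A.underlying.C₁)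
    (h : w ≫ T.map A.underlying.cod = p ≫ A.underlying.dom)
    (h' : (w ≫ T.map A.multiSnd ≫ A.D₁.a) ≫ A.tgt = (p ≫ A.multiSnd) ≫ A.src) :
    A.underlying.compOf w p h ≫ A.multiSnd =
      A.seq (w ≫ T.map A.multiSnd ≫ A.D₁.a) (p ≫ A.multiSnd) h' := by
  exact ((A.lift_multiComp w p h) =≫ _).trans (A.multiCompOf_snd w p h)

/-- The composite of a family of multi-arrows with a multi-arrow. -/
lemma compOf_multiMk (y : Y ⟶ T.obj X) (x₁ : Y ⟶ T.obj A.underlying.C₀) (g₁ : Y ⟶ A.D₁.A)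
    (h₁ : x₁ ≫ A.tensor = g₁ ≫ A.src) (hc)
    (h₂ : (y ≫ T.map g ≫ A.D₁.a) ≫ A.tgt = g₁ ≫ A.src) (h₃) :
    A.underlying.compOf (y ≫ T.map (A.multiMk x g h)) (A.multiMk x₁ g₁ h₁) hc =
      A.multiMk (y ≫ T.map x ≫ T.μAt _) (A.seq (y ≫ T.map g ≫ A.D₁.a) g₁ h₂) h₃ := by
  have e : (y ≫ T.map (A.multiMk x g h)) ≫ T.map A.multiSnd ≫ A.D₁.a =
      y ≫ T.map g ≫ A.D₁.a := by
    rw [Category.assoc, ← T.map_comp_assoc, multiMk_snd]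
  apply multi_hom_ext
  · rw [TMulticat.compOf_dom_μAt, multiMk_dom, Category.assoc, ← T.map_comp_assoc, multiMk_dom]
  · rw [multiMk_snd]
    refine (compOf_multiSnd _ _ _ ?_).trans (A.seq_congr _ e (multiMk_snd _ _ _ _))
    rw [e, h₂, multiMk_snd]

end

end TStructCat

/-! ### Families of functors and families of transformations. -/

namespace TStructCat

variable {E : Type u} [Category.{v} E] [HasFiniteLimits E] {T : Monad E}

/-- An `X`-indexed family of functors from the category of unary arrows of `A` (which is `A` itself,
without its tensor product) to that of `B`. -/
structure Action (A : TStructCat T) (B : TMulticat T) (X : E) where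
  obj : A.underlying.C₀ ⨯ X ⟶ B.C₀
  arr : A.D₁.A ⨯ X ⟶ B.C₁
  arr_dom : arr ≫ B.dom = prod.map A.src (𝟙 X) ≫ obj ≫ T.ηAt _
  arr_cod : arr ≫ B.cod = prod.map A.tgt (𝟙 X) ≫ obj
  arr_ids : ∀ {Y : E} (a : Y ⟶ A.underlying.C₀) (x : Y ⟶ X),
    prod.lift (a ≫ A.idArr) x ≫ arr = prod.lift a x ≫ obj ≫ B.ids
  -- The composability condition `h'` in `B` is quantified rather than proved in the statement; it
  -- always holds, by `unary_cond`.
  arr_seq : ∀ {Y : E} (f g : Y ⟶ A.D₁.A) (h : f ≫ A.tgt = g ≫ A.src) (x : Y ⟶ X) (h'),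
    prod.lift (A.seq f g h) x ≫ arr =
      B.compOf ((prod.lift f x ≫ arr) ≫ T.ηAt _) (prod.lift g x ≫ arr) h'

variable {A : TStructCat T} {B : TMulticat T}

namespace Action

variable {X Y Z : E} (M : Action A B X)

lemma ext' {M N : Action A B X} (h₁ : M.obj = N.obj) (h₂ : M.arr = N.arr) : M = N := by
  cases M; cases N; cases h₁; cases h₂; rfl

/-- The action on generalized objects. -/
noncomputable def onObj (a : Y ⟶ A.underlying.C₀) (x : Y ⟶ X) : Y ⟶ B.C₀ := prod.lift a x ≫ M.obj

/-- The action on generalized arrows. -/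
noncomputable def onArr (g : Y ⟶ A.D₁.A) (x : Y ⟶ X) : Y ⟶ B.C₁ := prod.lift g x ≫ M.arr

variable (a : Y ⟶ A.underlying.C₀) (f g : Y ⟶ A.D₁.A) (x : Y ⟶ X)

@[simp]
lemma precomp_onObj (k : Z ⟶ Y) : k ≫ M.onObj a x = M.onObj (k ≫ a) (k ≫ x) := by
  simp only [onObj, ← Category.assoc, prod.comp_lift]

@[simp]
lemma precomp_onObj_assoc (k : Z ⟶ Y) {W : E} (ψ : _ ⟶ W) :
    k ≫ M.onObj a x ≫ ψ = M.onObj (k ≫ a) (k ≫ x) ≫ ψ := by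
  simp only [← Category.assoc, precomp_onObj]

@[simp]
lemma precomp_onArr (k : Z ⟶ Y) : k ≫ M.onArr g x = M.onArr (k ≫ g) (k ≫ x) := by
  simp [onArr, ← Category.assoc, prod.comp_lift]

@[simp]
lemma onArr_dom : M.onArr g x ≫ B.dom = M.onObj (g ≫ A.src) x ≫ T.ηAt _ := by
  rw [onArr, Category.assoc, M.arr_dom, prod.lift_map_assoc, Category.comp_id, onObj,
    Category.assoc]

@[simp]
lemma onArr_dom_assoc {W : E} (ψ : _ ⟶ W) :
    M.onArr g x ≫ B.dom ≫ ψ = M.onObj (g ≫ A.src) x ≫ T.ηAt _ ≫ ψ := by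
  simp only [← Category.assoc, onArr_dom]

@[simp]
lemma onArr_cod : M.onArr g x ≫ B.cod = M.onObj (g ≫ A.tgt) x := by
  rw [onArr, Category.assoc, M.arr_cod, prod.lift_map_assoc, Category.comp_id, onObj]

@[simp]
lemma onArr_cod_assoc {W : E} (ψ : _ ⟶ W) :
    M.onArr g x ≫ B.cod ≫ ψ = M.onObj (g ≫ A.tgt) x ≫ ψ := by
  simp only [← Category.assoc, onArr_cod]

@[simp] lemma map_onObj : T.map (M.onObj a x) = T.map (prod.lift a x) ≫ T.map M.obj :=
  T.map_comp _ _

@[simp] lemma map_onArr : T.map (M.onArr g x) = T.map (prod.lift g x) ≫ T.map M.arr :=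
  T.map_comp _ _

@[simp]
lemma map_arr_dom : T.map M.arr ≫ T.map B.dom =
    T.map (prod.map A.src (𝟙 X)) ≫ T.map M.obj ≫ T.map (T.ηAt _) := by
  rw [← T.map_comp, M.arr_dom, T.map_comp, T.map_comp]

@[simp]
lemma map_arr_dom_assoc {W : E} (ψ : _ ⟶ W) :
    T.map M.arr ≫ T.map B.dom ≫ ψ = T.map (prod.map A.src (𝟙 X)) ≫ T.map M.obj ≫ T.map (T.ηAt _) ≫ ψ := by
  simp only [← Category.assoc, map_arr_dom]

@[simp]
lemma map_arr_cod :
    T.map M.arr ≫ T.map B.cod = T.map (prod.map A.tgt (𝟙 X)) ≫ T.map M.obj := by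
  rw [← T.map_comp, M.arr_cod, T.map_comp]

lemma onArr_idArr : M.onArr (a ≫ A.idArr) x = M.onObj a x ≫ B.ids :=
  (M.arr_ids a x).trans (Category.assoc _ _ _).symm

lemma onArr_seq (h : f ≫ A.tgt = g ≫ A.src)
    (h' : (M.onArr f x ≫ T.ηAt _) ≫ T.map B.cod = M.onArr g x ≫ B.dom) :
    M.onArr (A.seq f g h) x = B.compOf (M.onArr f x ≫ T.ηAt _) (M.onArr g x) h' :=
  M.arr_seq f g h x h'

/-- Supplies the side condition of `onArr_seq` from composability in `A` alone. -/
lemma unary_cond (h : f ≫ A.tgt = g ≫ A.src) :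
    (M.onArr f x ≫ T.ηAt _) ≫ T.map B.cod = M.onArr g x ≫ B.dom := by
  simp only [Category.assoc, ηAt_map, onArr_cod_assoc, h, onArr_dom]

/-- Reindexing of a family of functors. -/
noncomputable def res (k : Z ⟶ X) : Action A B Z where
  obj := M.onObj prod.fst (prod.snd ≫ k)
  arr := M.onArr prod.fst (prod.snd ≫ k)
  arr_dom := by simp
  arr_cod := by simp
  arr_ids a z := by simp [onArr_idArr]
  arr_seq f g h x h' := by
    have e (g : _ ⟶ A.D₁.A) : prod.lift g x ≫ M.onArr prod.fst (prod.snd ≫ k) =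
        M.onArr g (x ≫ k) := by rw [precomp_onArr]; simp
    simp only [e]
    rw [onArr_seq]

@[simp] lemma onObj_res (k : Z ⟶ X) (a : Y ⟶ A.underlying.C₀) (z : Y ⟶ Z) :
    (M.res k).onObj a z = M.onObj a (z ≫ k) := by
  simp [onObj, res, ← Category.assoc, prod.comp_lift]

@[simp] lemma onArr_res (k : Z ⟶ X) (g : Y ⟶ A.D₁.A) (z : Y ⟶ Z) :
    (M.res k).onArr g z = M.onArr g (z ≫ k) := by
  simp [onArr, res, ← Category.assoc, prod.comp_lift]

lemma obj_eq : M.obj = M.onObj prod.fst prod.snd := by simp [onObj]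

lemma arr_eq : M.arr = M.onArr prod.fst prod.snd := by simp [onArr]

end Action

/-- A family of transformations: for a family `y` of arrows with domain `d` and codomain `c`, and
a family `t` in `T (A₀ × X₀)` over `d`, an arrow of `B` from the family of values at `t` to the
value at the tensor product of the first component of `t`, natural with respect to unary arrows. -/
structure Cells {X₀ X₁ : E} (M : Action A B X₀) (d : X₁ ⟶ T.obj X₀) (c : X₁ ⟶ X₀) where
  app : pullback (T.map (prod.snd : A.underlying.C₀ ⨯ X₀ ⟶ X₀)) d ⟶ B.C₁
  app_dom : app ≫ B.dom = pullback.fst _ _ ≫ T.map M.obj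
  app_cod : app ≫ B.cod =
    M.onObj (pullback.fst _ _ ≫ T.map prod.fst ≫ A.tensor) (pullback.snd _ _ ≫ c)
  -- Naturality for a whole family `t` of arrows of `A` at once: on one side the arrows are tensored
  -- by the algebra `D₁` and act after the component, on the other they act one by one before it.
  natural : ∀ {Y : E} (t : Y ⟶ T.obj (A.D₁.A ⨯ X₀)) (y : Y ⟶ X₁) (h₁ h₂ h₃ h₄),
    B.compOf ((pullback.lift (t ≫ T.map (prod.map A.src (𝟙 X₀))) y h₁ ≫ app) ≫ T.ηAt _)
        (M.onArr (t ≫ T.map prod.fst ≫ A.D₁.a) (y ≫ c)) h₂ =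
      B.compOf (t ≫ T.map M.arr)
        (pullback.lift (t ≫ T.map (prod.map A.tgt (𝟙 X₀))) y h₃ ≫ app) h₄

namespace Cells

variable {X₀ X₁ Y Z : E} {M : Action A B X₀} {d : X₁ ⟶ T.obj X₀} {c : X₁ ⟶ X₀} (N : Cells M d c)

/-- The component of a family of transformations at a generalized element. -/
noncomputable def appAt (t : Y ⟶ T.obj (A.underlying.C₀ ⨯ X₀)) (y : Y ⟶ X₁)
    (h : t ≫ T.map prod.snd = y ≫ d) : Y ⟶ B.C₁ :=
  pullback.lift t y h ≫ N.app

variable {N} in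
lemma appAt_congr {t t' : Y ⟶ T.obj (A.underlying.C₀ ⨯ X₀)} {y y' : Y ⟶ X₁}
    {h : t ≫ T.map prod.snd = y ≫ d} {h' : t' ≫ T.map prod.snd = y' ≫ d} (ht : t = t')
    (hy : y = y') : N.appAt t y h = N.appAt t' y' h' := by
  subst ht hy; rfl

variable (t : Y ⟶ T.obj (A.underlying.C₀ ⨯ X₀)) (y : Y ⟶ X₁) (h : t ≫ T.map prod.snd = y ≫ d)

@[simp]
lemma precomp_appAt (k : Z ⟶ Y) :
    k ≫ N.appAt t y h = N.appAt (k ≫ t) (k ≫ y) (by simp [h]) := by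
  rw [appAt, appAt, ← Category.assoc]
  congr 1
  apply pullback.hom_ext <;> simp

@[simp]
lemma precomp_appAt_assoc (k : Z ⟶ Y) {W : E} (ψ : _ ⟶ W) :
    k ≫ N.appAt t y h ≫ ψ = N.appAt (k ≫ t) (k ≫ y) (by simp [h]) ≫ ψ := by
  simp only [← Category.assoc, precomp_appAt]

@[simp]
lemma appAt_dom : N.appAt t y h ≫ B.dom = t ≫ T.map M.obj := by
  simp [appAt, N.app_dom]

@[simp]
lemma appAt_dom_assoc {W : E} (ψ : _ ⟶ W) :
    N.appAt t y h ≫ B.dom ≫ ψ = t ≫ T.map M.obj ≫ ψ := by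
  simp only [← Category.assoc, appAt_dom]

@[simp]
lemma appAt_cod : N.appAt t y h ≫ B.cod = M.onObj (t ≫ T.map prod.fst ≫ A.tensor) (y ≫ c) := by
  simp [appAt, N.app_cod, Action.precomp_onObj]

@[simp]
lemma appAt_cod_assoc {W : E} (ψ : _ ⟶ W) :
    N.appAt t y h ≫ B.cod ≫ ψ = M.onObj (t ≫ T.map prod.fst ≫ A.tensor) (y ≫ c) ≫ ψ := by
  simp only [← Category.assoc, appAt_cod]

@[simp]
lemma map_appAt_dom : T.map (N.appAt t y h) ≫ T.map B.dom = T.map t ≫ T.map (T.map M.obj) := by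
  rw [← T.map_comp, appAt_dom, T.map_comp]

@[simp]
lemma map_appAt_dom_assoc {W : E} (ψ : _ ⟶ W) :
    T.map (N.appAt t y h) ≫ T.map B.dom ≫ ψ = T.map t ≫ T.map (T.map M.obj) ≫ ψ := by
  simp only [← Category.assoc, map_appAt_dom]

@[simp]
lemma map_appAt_cod : T.map (N.appAt t y h) ≫ T.map B.cod =
    T.map (prod.lift (t ≫ T.map prod.fst ≫ A.tensor) (y ≫ c)) ≫ T.map M.obj := by
  rw [← T.map_comp, appAt_cod, Action.map_onObj]

lemma app_eq : N.app = N.appAt (pullback.fst _ _) (pullback.snd _ _) pullback.condition := by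
  refine (Category.id_comp _).symm.trans ?_
  rw [appAt]
  congr 1
  apply pullback.hom_ext <;> simp

/-- The source and target families are variables with equations, so that the rule applies to any
presentation of them. -/
lemma appAt_natural (t : Y ⟶ T.obj (A.D₁.A ⨯ X₀))
    {t₁ t₂ : Y ⟶ T.obj (A.underlying.C₀ ⨯ X₀)} (ht₁ : t ≫ T.map (prod.map A.src (𝟙 X₀)) = t₁)
    (ht₂ : t ≫ T.map (prod.map A.tgt (𝟙 X₀)) = t₂)
    (h₁ : t₁ ≫ T.map prod.snd = y ≫ d) (h₂ : t₂ ≫ T.map prod.snd = y ≫ d)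
    (h₃ : (N.appAt t₁ y h₁ ≫ T.ηAt _) ≫ T.map B.cod =
      M.onArr (t ≫ T.map prod.fst ≫ A.D₁.a) (y ≫ c) ≫ B.dom)
    (h₄ : (t ≫ T.map M.arr) ≫ T.map B.cod = N.appAt t₂ y h₂ ≫ B.dom) :
    B.compOf (N.appAt t₁ y h₁ ≫ T.ηAt _) (M.onArr (t ≫ T.map prod.fst ≫ A.D₁.a) (y ≫ c)) h₃ =
      B.compOf (t ≫ T.map M.arr) (N.appAt t₂ y h₂) h₄ := by
  subst ht₁ ht₂
  exact N.natural t y h₁ h₃ h₂ h₄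

lemma ext_appAt {N N' : Cells M d c} (h : ∀ {Y : E} (t : Y ⟶ T.obj (A.underlying.C₀ ⨯ X₀))
    (y : Y ⟶ X₁) (hty : t ≫ T.map prod.snd = y ≫ d), N.appAt t y hty = N'.appAt t y hty) : N = N' := by
  have e : N.app = N'.app := by rw [app_eq, app_eq, h]
  cases N; cases N'; cases e; rfl

/-- Reindexing of a family of transformations. -/
noncomputable def res (k : Z ⟶ X₁) : Cells M (k ≫ d) (k ≫ c) where
  app := N.appAt (pullback.fst _ _) (pullback.snd _ _ ≫ k) (by simp [pullback.condition])
  app_dom := by simp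
  app_cod := by simp
  natural t y h₁ h₂ h₃ h₄ := by
    have e (t : _ ⟶ T.obj (A.underlying.C₀ ⨯ X₀)) (h : t ≫ T.map prod.snd = y ≫ k ≫ d) :
        pullback.lift t y h ≫ N.appAt (pullback.fst _ _) (pullback.snd _ _ ≫ k)
          (by simp [pullback.condition]) = N.appAt t (y ≫ k) (by simp [h]) := by
      rw [precomp_appAt]
      exact appAt_congr (by simp) (by simp)
    simp only [e, ← Category.assoc y k c] at h₂ h₄ ⊢
    exact N.natural t (y ≫ k) (by rw [h₁, Category.assoc]) h₂ (by rw [h₃, Category.assoc]) h₄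

lemma appAt_res (k : Z ⟶ X₁) (y : Y ⟶ Z) (h : t ≫ T.map prod.snd = y ≫ k ≫ d) :
    (N.res k).appAt t y h = N.appAt t (y ≫ k) (by rw [h, Category.assoc]) := by
  rw [appAt, res, precomp_appAt]
  exact appAt_congr (by simp) (by simp)

end Cells

end TStructCat

/-! ### Maps `A × C ⟶ B` as families of functors and transformations. -/

namespace TStructCat

open TMulticat (Hom.pairApp Hom.pairObj Hom.pairArr product)

variable {E : Type u} [Category.{v} E] [HasFiniteLimits E] {T : Monad E}

/-- The data equivalent to a map `A × C ⟶ B`: a family of functors indexed by the objects of `C` and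
a family of transformations indexed by the arrows of `C`, compatible with identities and
composition. -/
structure Lax (A : TStructCat T) (B C : TMulticat T) where
  act : Action A B C.C₀
  cells : Cells act C.dom C.cod
  app_ids : ∀ {Y : E} (a : Y ⟶ A.underlying.C₀) (c : Y ⟶ C.C₀) (h),
    cells.appAt (prod.lift a c ≫ T.ηAt _) (c ≫ C.ids) h = act.onObj a c ≫ B.ids
  app_comp : ∀ {X Y : E} (y : X ⟶ T.obj Y) (t : Y ⟶ T.obj (A.underlying.C₀ ⨯ C.C₀))
    (w : Y ⟶ C.C₁) (h) (p : X ⟶ C.C₁) (hp) (h₁) (h₂) (h₃),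
    B.compOf (y ≫ T.map (cells.appAt t w h))
        (cells.appAt (y ≫ T.map (prod.lift (t ≫ T.map prod.fst ≫ A.tensor) (w ≫ C.cod))) p h₁) h₂ =
      cells.appAt (y ≫ T.map t ≫ T.μAt _) (C.compOf (y ≫ T.map w) p hp) h₃

variable {A : TStructCat T} {B C : TMulticat T}

/-- The type of `cells` depends on `act`, but the values `appAt` are maps into `B.C₁` for every
`act`; comparing values avoids transport. -/
lemma Lax.ext' {L L' : Lax A B C} (h₀ : L.act.obj = L'.act.obj) (h₁ : L.act.arr = L'.act.arr)
    (h₂ : ∀ {Y : E} (t : Y ⟶ T.obj (A.underlying.C₀ ⨯ C.C₀)) (y : Y ⟶ C.C₁)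
      (h : t ≫ T.map prod.snd = y ≫ C.dom), L.cells.appAt t y h = L'.cells.appAt t y h) :
    L = L' := by
  obtain ⟨M, N, _, _⟩ := L
  obtain ⟨M', N', _, _⟩ := L'
  obtain rfl : M = M' := Action.ext' h₀ h₁
  obtain rfl : N = N' := Cells.ext_appAt h₂
  rfl

section laxApp

variable (L : Lax A B C) {X Y : E}

/-- The value of the map given by `L` at a general arrow. -/
noncomputable def laxApp (t : Y ⟶ T.obj (A.underlying.C₀ ⨯ C.C₀)) (g : Y ⟶ A.D₁.A) (y : Y ⟶ C.C₁)
    (h : t ≫ T.map prod.snd = y ≫ C.dom) (hg : g ≫ A.src = t ≫ T.map prod.fst ≫ A.tensor) :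
    Y ⟶ B.C₁ :=
  B.compOf (L.cells.appAt t y h ≫ T.ηAt _) (L.act.onArr g (y ≫ C.cod)) (by simp [hg])

variable {L} in
lemma laxApp_congr {t t' : Y ⟶ T.obj (A.underlying.C₀ ⨯ C.C₀)} {g g' : Y ⟶ A.D₁.A}
    {y y' : Y ⟶ C.C₁} {h hg h' hg'} (ht : t = t') (e : g = g') (hy : y = y') :
    laxApp L t g y h hg = laxApp L t' g' y' h' hg' := by
  subst ht e hy; rfl

lemma precomp_laxApp (k : X ⟶ Y) (t : Y ⟶ T.obj (A.underlying.C₀ ⨯ C.C₀)) (g : Y ⟶ A.D₁.A)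
    (y : Y ⟶ C.C₁) (h : t ≫ T.map prod.snd = y ≫ C.dom)
    (hg : g ≫ A.src = t ≫ T.map prod.fst ≫ A.tensor) :
    k ≫ laxApp L t g y h hg =
      laxApp L (k ≫ t) (k ≫ g) (k ≫ y) (by simp [h]) (by simp [hg]) := by
  rw [laxApp, TMulticat.precomp_compOf]
  apply TMulticat.compOf_congr <;> simp

@[simp]
lemma laxApp_dom (t : Y ⟶ T.obj (A.underlying.C₀ ⨯ C.C₀)) (g : Y ⟶ A.D₁.A) (y : Y ⟶ C.C₁)
    (h : t ≫ T.map prod.snd = y ≫ C.dom) (hg : g ≫ A.src = t ≫ T.map prod.fst ≫ A.tensor) :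
    laxApp L t g y h hg ≫ B.dom = t ≫ T.map L.act.obj := by
  simp [laxApp]

@[simp]
lemma laxApp_cod (t : Y ⟶ T.obj (A.underlying.C₀ ⨯ C.C₀)) (g : Y ⟶ A.D₁.A) (y : Y ⟶ C.C₁)
    (h : t ≫ T.map prod.snd = y ≫ C.dom) (hg : g ≫ A.src = t ≫ T.map prod.fst ≫ A.tensor) :
    laxApp L t g y h hg ≫ B.cod = L.act.onObj (g ≫ A.tgt) (y ≫ C.cod) := by
  simp [laxApp]

/-- The values of the map given by `L` are compatible with composition. -/
lemma compOf_laxApp (r : X ⟶ T.obj Y) (t : Y ⟶ T.obj (A.underlying.C₀ ⨯ C.C₀)) (g : Y ⟶ A.D₁.A)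
    (y : Y ⟶ C.C₁) (h hg) (t₁ : X ⟶ T.obj (A.underlying.C₀ ⨯ C.C₀)) (g₁ : X ⟶ A.D₁.A)
    (y₁ : X ⟶ C.C₁) (h₁ hg₁) (ht₁ : t₁ = r ≫ T.map (prod.lift (g ≫ A.tgt) (y ≫ C.cod)))
    (h₂ h₃ h₄ h₅ h₆) :
    B.compOf (r ≫ T.map (laxApp L t g y h hg)) (laxApp L t₁ g₁ y₁ h₁ hg₁) h₂ =
      laxApp L (r ≫ T.map t ≫ T.μAt _) (A.seq (r ≫ T.map g ≫ A.D₁.a) g₁ h₃)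
        (C.compOf (r ≫ T.map y) y₁ h₄) h₅ h₆ := by
  subst ht₁
  have h₄' : r ≫ T.map y ≫ T.map C.cod = y₁ ≫ C.dom := by simpa using h₄
  -- The outer transformation is needed at the sources of the arrows `g` as well as at their
  -- targets, which form `t₁`; `s₁` admits it at the sources.
  have s₁ : (r ≫ T.map (prod.lift (g ≫ A.src) (y ≫ C.cod))) ≫ T.map prod.snd = y₁ ≫ C.dom := by
    simp [h₄']
  -- Naturality moves the inner unary arrows past the outer transformation, where they become a
  -- single tensored arrow.
  have nat : B.compOf (r ≫ T.map (L.act.onArr g (y ≫ C.cod))) (L.cells.appAt _ y₁ h₁)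
        (by simp) =
      B.compOf (L.cells.appAt _ y₁ s₁ ≫ T.ηAt _)
        (L.act.onArr (r ≫ T.map g ≫ A.D₁.a) (y₁ ≫ C.cod)) (by simp) := by
    refine Eq.trans (TMulticat.compOf_congr _ ?_ rfl _)
      ((L.cells.appAt_natural y₁ (r ≫ T.map (prod.lift g (y ≫ C.cod))) ?_ ?_ s₁ h₁ ?_ ?_).symm.trans
        (TMulticat.compOf_congr _ rfl ?_ _))
    all_goals simp
  -- The transformations are now adjacent and combine by `app_comp`.
  have comp : B.compOf (r ≫ T.map (L.cells.appAt t y h)) (L.cells.appAt _ y₁ s₁) (by simp [hg]) =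
      L.cells.appAt (r ≫ T.map t ≫ T.μAt _) (C.compOf (r ≫ T.map y) y₁ h₄) h₅ := by
    refine Eq.trans (TMulticat.compOf_congr _ rfl ?_ _) (L.app_comp r t y h y₁ h₄ ?_ ?_ ?_)
    · exact Cells.appAt_congr (by simp [hg]) rfl
    · simp [h₄']
    · simp
    · exact h₅
  -- After `nat`, the tensored arrow meets the outer `g₁`, and functoriality of the action composes
  -- them in `A`.
  have inner : B.compOf (r ≫ T.map (L.act.onArr g (y ≫ C.cod)))
        (laxApp L _ g₁ y₁ h₁ hg₁) (by simp) =
      B.compOf (L.cells.appAt _ y₁ s₁ ≫ T.ηAt _)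
        (L.act.onArr (A.seq (r ≫ T.map g ≫ A.D₁.a) g₁ h₃) (y₁ ≫ C.cod)) (by simp) := by
    refine (TMulticat.compOf_eta_compOf _ _ _ ?_ _ ?_ ?_ ?_).symm.trans
      ((TMulticat.compOf_congr _ (congrArg (· ≫ T.ηAt _) nat) rfl _).trans
      ((TMulticat.compOf_eta_compOf _ _ _ ?_ _ ?_ ?_ ?_).trans
      (TMulticat.compOf_congr _ rfl (L.act.onArr_seq _ _ _ h₃ ?_).symm _)))
    all_goals simp [hg₁]
  have hg' : T.map g ≫ T.map A.src ≫ A.tensor = T.map t ≫ T.μAt _ ≫ T.map prod.fst ≫ A.tensor := by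
    rw [← T.map_comp_assoc, hg]; simp
  refine (TMulticat.compOf_map_compOf _ _ _ _ _ _ ?_ _ ?_).trans
    ((TMulticat.compOf_congr _ (w' := r ≫ T.map (L.cells.appAt t y h)) ?_ inner _).trans
    ((TMulticat.compOf_eta_compOf _ _ _ ?_ _ ?_ ?_ ?_).symm.trans
    (TMulticat.compOf_congr _ (congrArg (· ≫ T.ηAt _) comp) ?_ _)))
  all_goals simp [hg, hg']

/-- At a universal multi-arrow the unary factor acts by an identity of `B`; this recovers the
transformations from the map. -/
lemma laxApp_idArr (t : Y ⟶ T.obj (A.underlying.C₀ ⨯ C.C₀)) (g : Y ⟶ A.D₁.A) (y : Y ⟶ C.C₁)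
    (h : t ≫ T.map prod.snd = y ≫ C.dom) (hg : g ≫ A.src = t ≫ T.map prod.fst ≫ A.tensor)
    (e : g = t ≫ T.map prod.fst ≫ A.tensor ≫ A.idArr) :
    laxApp L t g y h hg = L.cells.appAt t y h := by
  subst e
  apply TMulticat.ids_compOf' _ _ _ _ rfl
  rw [Cells.appAt_cod_assoc, ← Action.onArr_idArr]
  simp

/-- At a unary arrow over an identity of `C` the transformation factor is an identity of `B`, by
`app_ids`; this recovers the functors from the map. -/
lemma laxApp_ids (t : Y ⟶ T.obj (A.underlying.C₀ ⨯ C.C₀)) (g : Y ⟶ A.D₁.A) (y : Y ⟶ C.C₁)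
    (h : t ≫ T.map prod.snd = y ≫ C.dom) (hg : g ≫ A.src = t ≫ T.map prod.fst ≫ A.tensor)
    (x : Y ⟶ C.C₀) (ht : t = prod.lift (g ≫ A.src) x ≫ T.ηAt _) (hy : y = x ≫ C.ids) :
    laxApp L t g y h hg = L.act.onArr g x := by
  subst ht hy
  refine Eq.trans ?_ (TMulticat.compOf_ids B _ _ rfl (by simp))
  refine TMulticat.compOf_congr _ ?_ (by simp) _
  rw [L.app_ids, Action.onArr_dom_assoc]
  simp

end laxApp

/-! ### From a map `A × C ⟶ B` to its functors and transformations. -/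

section toLax

variable (H : product A.underlying C ⟶ B) {X Y : E}

/-- The value of a map `A × C ⟶ B` at a unary arrow of `A` and an identity of `C`. -/
noncomputable def unaryApp (g : Y ⟶ A.D₁.A) (x : Y ⟶ C.C₀) : Y ⟶ B.C₁ :=
  TMulticat.Hom.pairApp H (prod.lift (g ≫ A.src) x ≫ T.ηAt _)
    (A.multiMk (g ≫ A.src ≫ T.ηAt _) g (by simp)) (x ≫ C.ids) (by simp) (by simp)

/-- The value of a map `A × C ⟶ B` at a universal multi-arrow of `A` and an arrow of `C`. -/
noncomputable def tensorApp (t : Y ⟶ T.obj (A.underlying.C₀ ⨯ C.C₀)) (y : Y ⟶ C.C₁)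
    (h : t ≫ T.map prod.snd = y ≫ C.dom) : Y ⟶ B.C₁ :=
  TMulticat.Hom.pairApp H t
    (A.multiMk (t ≫ T.map prod.fst) (t ≫ T.map prod.fst ≫ A.tensor ≫ A.idArr) (by simp)) y
    (by simp) h.symm

lemma precomp_unaryApp (k : X ⟶ Y) (g : Y ⟶ A.D₁.A) (x : Y ⟶ C.C₀) :
    k ≫ unaryApp H g x = unaryApp H (k ≫ g) (k ≫ x) := by
  rw [unaryApp, TMulticat.Hom.precomp_pairApp]
  apply TMulticat.Hom.pairApp_congr
  · simp [← Category.assoc, prod.comp_lift]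
  · rw [precomp_multiMk]; apply multiMk_congr <;> simp
  · simp

lemma precomp_tensorApp (k : X ⟶ Y) (t : Y ⟶ T.obj (A.underlying.C₀ ⨯ C.C₀)) (y : Y ⟶ C.C₁)
    (h : t ≫ T.map prod.snd = y ≫ C.dom) :
    k ≫ tensorApp H t y h = tensorApp H (k ≫ t) (k ≫ y) (by simp [h]) := by
  rw [tensorApp, TMulticat.Hom.precomp_pairApp]
  apply TMulticat.Hom.pairApp_congr _ rfl _ rfl
  rw [precomp_multiMk]; apply multiMk_congr <;> simp

/-- A map `A × C ⟶ B` at a general arrow, from its values at universal and at unary arrows. -/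
lemma compOf_tensorApp_unaryApp (t : Y ⟶ T.obj (A.underlying.C₀ ⨯ C.C₀)) (y : Y ⟶ C.C₁)
    (h : t ≫ T.map prod.snd = y ≫ C.dom) (g : Y ⟶ A.D₁.A)
    (hg : (t ≫ T.map prod.fst) ≫ A.tensor = g ≫ A.src) (hc) :
    B.compOf (tensorApp H t y h ≫ T.ηAt _) (unaryApp H g (y ≫ C.cod)) hc =
      TMulticat.Hom.pairApp H t (A.multiMk (t ≫ T.map prod.fst) g hg) y (by simp) h.symm := by
  -- A single arrow is rewritten as the family `η ≫ T.map _`, so that `compOf_pairApp` computes the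
  -- composite in the product.
  refine Eq.trans (TMulticat.compOf_congr _ (ηAt_map T _).symm rfl _)
    ((TMulticat.Hom.compOf_pairApp H (T.ηAt _) ?_ ?_ ?_ ?_).trans ?_)
  · simp [← hg]
  · rw [ηAt_map]; exact hc
  · simp [reassoc_of% hg]
  · simp
  · apply TMulticat.Hom.pairApp_congr
    · simp
    · refine (A.compOf_multiMk _ _ _ _ _ _ _ _ ?_ ?_).trans ?_
      · simp [← hg]
      · simp
      · apply multiMk_congr
        · simp
        · apply idArr_seq
          simp [← reassoc_of% hg]
    · apply TMulticat.ids_compOf' <;> simp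

/-- The naturality of the values of a map `A × C ⟶ B` at universal arrows. -/
lemma compOf_unaryApp_tensorApp (t : Y ⟶ T.obj (A.D₁.A ⨯ C.C₀)) (y : Y ⟶ C.C₁)
    (h₁ : (t ≫ T.map (prod.map A.src (𝟙 _))) ≫ T.map prod.snd = y ≫ C.dom)
    (h₂ : (t ≫ T.map (prod.map A.tgt (𝟙 _))) ≫ T.map prod.snd = y ≫ C.dom) (h₃ h₄) :
    B.compOf (tensorApp H (t ≫ T.map (prod.map A.src (𝟙 _))) y h₁ ≫ T.ηAt _)
        (unaryApp H (t ≫ T.map prod.fst ≫ A.D₁.a) (y ≫ C.cod)) h₃ =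
      B.compOf (t ≫ T.map (unaryApp H prod.fst prod.snd))
        (tensorApp H (t ≫ T.map (prod.map A.tgt (𝟙 _))) y h₂) h₄ := by
  have h : t ≫ T.map prod.snd = y ≫ C.dom := by simpa using h₁
  -- Both composites are the value of `H` at one arrow of `A × C`, whose `A`-component is the tensor
  -- product of the arrows in `t`. On the left an identity of `A` is cancelled before it, on the
  -- right after it.
  rw [compOf_tensorApp_unaryApp]
  · refine Eq.symm ((TMulticat.Hom.compOf_pairApp H _ ?_ ?_ ?_ ?_).trans ?_)
    · congr 2
      apply Limits.prod.hom_ext <;> simp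
    · exact h₄
    · simp
    · simp [h]
    · apply TMulticat.Hom.pairApp_congr
      · congr 1
        simp only [T.map_comp, Category.assoc, map_ηAt_μAt, Category.comp_id]
        congr 1
        apply Limits.prod.hom_ext <;> simp
      · refine (A.compOf_multiMk _ _ _ _ _ _ _ _ ?_ ?_).trans ?_
        · simp
        · simp
        · apply multiMk_congr
          · simp
          · apply seq_idArr
            simp
      · apply TMulticat.compOf_ids
        simp [reassoc_of% h]
  · simp

/-- The data of a map `A × C ⟶ B`. -/
noncomputable def toLax : Lax A B C where
  act :=
    { obj := TMulticat.Hom.pairObj H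
      arr := unaryApp H prod.fst prod.snd
      arr_dom := by
        rw [unaryApp, TMulticat.Hom.pairApp_dom, Category.assoc, ηAt_map, ← Category.assoc]
        rw [← Category.assoc]
        congr 2
        apply Limits.prod.hom_ext <;> simp
      arr_cod := by
        rw [unaryApp, TMulticat.Hom.pairApp_cod]
        congr 1
        apply Limits.prod.hom_ext <;> simp
      arr_ids a x := by
        rw [precomp_unaryApp, unaryApp, ← TMulticat.Hom.pairApp_ids]
        apply TMulticat.Hom.pairApp_congr
        · simp
        · rw [ids_eq_multiMk, precomp_multiMk]; apply multiMk_congr <;> simp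
        · simp
      arr_seq f g h x h' := by
        simp only [precomp_unaryApp, prod.lift_fst, prod.lift_snd] at h' ⊢
        refine Eq.symm ((TMulticat.compOf_congr _ (ηAt_map T _).symm rfl _).trans
          ((TMulticat.Hom.compOf_pairApp H (T.ηAt _) ?_ ?_ ?_ ?_).trans ?_))
        · simp [h]
        · rw [ηAt_map]; exact h'
        · simp [reassoc_of% h]
        · simp
        · apply TMulticat.Hom.pairApp_congr
          · simp
          · refine (A.compOf_multiMk _ _ _ _ _ _ _ _ ?_ ?_).trans ?_
            · simp [h]
            · simp
            · apply multiMk_congr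
              · simp
              · apply seq_congr <;> simp
          · apply TMulticat.ids_compOf' <;> simp }
  cells :=
    { app := tensorApp H (pullback.fst _ _) (pullback.snd _ _) pullback.condition
      app_dom := by rw [tensorApp, TMulticat.Hom.pairApp_dom]
      app_cod := by
        rw [tensorApp, TMulticat.Hom.pairApp_cod, Action.onObj]
        simp
      natural t y h₁ h₂ h₃ h₄ := by
        simp only [precomp_tensorApp, pullback.lift_fst, pullback.lift_snd, Action.onArr,
          precomp_unaryApp, prod.lift_fst, prod.lift_snd] at h₂ h₄ ⊢
        exact compOf_unaryApp_tensorApp H t y h₁ h₃ h₂ h₄ }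
  app_ids a c h := by
    rw [Cells.appAt, precomp_tensorApp]
    refine Eq.trans ?_ ((TMulticat.Hom.pairApp_ids H a c).trans (Category.assoc _ _ _).symm)
    apply TMulticat.Hom.pairApp_congr
    · simp
    · rw [ids_eq_multiMk, precomp_multiMk]; apply multiMk_congr <;> simp
    · simp
  app_comp y t w h p hp h₁ h₂ h₃ := by
    simp only [Cells.appAt, precomp_tensorApp, pullback.lift_fst, pullback.lift_snd] at h₂ ⊢
    refine (TMulticat.Hom.compOf_pairApp H _ ?_ h₂ ?_ hp).trans ?_
    · simp
    · simp
    -- A composite of universal multi-arrows is universal: the algebra structure sends a family of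
    -- identities to an identity.
    · apply TMulticat.Hom.pairApp_congr _ rfl _ rfl
      refine (A.compOf_multiMk _ _ _ _ _ _ _ _ ?_ ?_).trans ?_
      · simp
      · simp
      · apply multiMk_congr
        · simp
        · refine (idArr_seq _ _ _ _ ?_).trans ?_ <;> simp

lemma toLax_appAt (t : Y ⟶ T.obj (A.underlying.C₀ ⨯ C.C₀)) (y : Y ⟶ C.C₁)
    (h : t ≫ T.map prod.snd = y ≫ C.dom) : (toLax H).cells.appAt t y h = tensorApp H t y h := by
  simp [Cells.appAt, toLax, precomp_tensorApp]

lemma toLax_onArr (g : Y ⟶ A.D₁.A) (x : Y ⟶ C.C₀) :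
    (toLax H).act.onArr g x = unaryApp H g x := by
  simp [Action.onArr, toLax, precomp_unaryApp]

/-- The factorization of a multi-arrow into a universal and a unary one, applied to the generic
arrow of `A × C`. Injectivity of `toLax` follows at once. -/
lemma pairArr_eq_laxApp : TMulticat.Hom.pairArr H =
    laxApp (toLax H) (TMulticat.prodDom _ _) (TMulticat.prodFst _ _ ≫ A.multiSnd)
      (TMulticat.prodSnd _ _) (TMulticat.prodSnd_dom _ _).symm (by simp) := by
  simp only [laxApp, toLax_appAt, toLax_onArr]
  have hg : (TMulticat.prodDom A.underlying C ≫ T.map prod.fst) ≫ A.tensor =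
      (TMulticat.prodFst A.underlying C ≫ A.multiSnd) ≫ A.src := by simp
  rw [compOf_tensorApp_unaryApp H _ _ _ _ hg, TMulticat.Hom.pairArr_eq_pairApp]
  apply TMulticat.Hom.pairApp_congr _ rfl _ rfl
  apply multi_hom_ext
  · simp [TMulticat.prodFst_dom]
  · simp

/-- A map `A × C ⟶ B` is determined by its data. -/
lemma toLax_injective : Function.Injective (toLax : (product A.underlying C ⟶ B) → Lax A B C) := by
  intro H H' e
  have h₀ : TMulticat.Hom.pairObj H = TMulticat.Hom.pairObj H' :=
    congrArg (fun L : Lax A B C => L.act.obj) e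
  refine TMulticat.hom_ext h₀ ?_
  change TMulticat.Hom.pairArr H = TMulticat.Hom.pairArr H'
  rw [pairArr_eq_laxApp, pairArr_eq_laxApp, e]

end toLax

/-! ### From functors and transformations back to a map `A × C ⟶ B`. -/

section ofLax

variable (L : Lax A B C) {X Y : E}

/-- The action on arrows of the map given by `L`. -/
noncomputable def ofLaxArr : TMulticat.prodArr A.underlying C ⟶ B.C₁ :=
  laxApp L (TMulticat.prodDom _ _) (TMulticat.prodFst _ _ ≫ A.multiSnd)
    (TMulticat.prodSnd _ _) (TMulticat.prodSnd_dom _ _).symm (by simp)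

lemma precomp_ofLaxArr (p : X ⟶ TMulticat.prodArr A.underlying C) : p ≫ ofLaxArr L =
    laxApp L (p ≫ TMulticat.prodDom _ _) (p ≫ TMulticat.prodFst _ _ ≫ A.multiSnd)
      (p ≫ TMulticat.prodSnd _ _) (by simp [TMulticat.prodSnd_dom]) (by simp) :=
  precomp_laxApp L p _ _ _ _ _

/-- `compOf_laxApp` at the generic composable pair of `A × C`, once composition in the product has
been unfolded into its components. -/
lemma ofLaxArr_comp (h) : TMulticat.prodComp _ _ ≫ ofLaxArr L =
    B.compOf (pullback.fst _ _ ≫ T.map (ofLaxArr L)) (pullback.snd _ _ ≫ ofLaxArr L) h := by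
  have c := pullback.condition (f := T.map (TMulticat.prodCod A.underlying C))
    (g := TMulticat.prodDom A.underlying C)
  have c₁ := TMulticat.prod_comp_fst _ _ c
  have c₂ := TMulticat.prod_comp_snd _ _ c
  have s₁ : (pullback.fst (T.map (TMulticat.prodCod A.underlying C)) (TMulticat.prodDom _ _) ≫
      T.map (TMulticat.prodFst A.underlying C ≫ A.multiSnd) ≫ A.D₁.a) ≫ A.tgt =
      (pullback.snd _ _ ≫ TMulticat.prodFst _ _ ≫ A.multiSnd) ≫ A.src := by
    have := c₁ =≫ A.tensor
    simp only [Category.assoc] at this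
    simp only [T.map_comp, Category.assoc, alg_tgt, multiSnd_src, ← this]
    rw [← T.map_comp_assoc A.multiSnd, multiSnd_tgt]
  have e := precomp_ofLaxArr L
    (pullback.snd (T.map (TMulticat.prodCod A.underlying C)) (TMulticat.prodDom _ _))
  rw [precomp_ofLaxArr]
  refine Eq.trans (laxApp_congr ?_ ?_ ?_)
    ((compOf_laxApp L (pullback.fst _ _) _ _ _ _ _ _ _ _ _ _ ?_ ?_ s₁ c₂ ?_ ?_).symm.trans
      (TMulticat.compOf_congr _ rfl e.symm _))
  · exact TMulticat.prodCompOf_dom _ _ _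
  · rw [← Category.assoc]
    refine (congrArg (· ≫ A.multiSnd) (TMulticat.prodCompOf_fst _ _ _)).trans
      ((compOf_multiSnd _ _ _ ?_).trans (seq_congr _ ?_ ?_))
    · simpa using s₁
    · simp
    · simp
  · exact TMulticat.prodCompOf_snd _ _ _
  · rw [← c]
    congr 2
    apply Limits.prod.hom_ext <;> simp
  · rw [← e]; exact h
  · simp [TMulticat.map_prodSnd_dom_assoc]
  · simp [TMulticat.map_prodFst_dom_assoc]

/-- The map `A × C ⟶ B` given by a family of functors and a family of transformations. -/
noncomputable def ofLax : product A.underlying C ⟶ B where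
  f₀ := L.act.obj
  f₁ := ofLaxArr L
  dom_comm := laxApp_dom _ _ _ _ _ _
  cod_comm := by
    refine (laxApp_cod _ _ _ _ _ _).trans ?_
    refine congrArg (· ≫ L.act.obj) ?_
    apply Limits.prod.hom_ext <;> simp [TMulticat.product]
  ids_comm := by
    refine (precomp_ofLaxArr L (TMulticat.prodIds _ _)).trans ?_
    refine (laxApp_ids L _ _ _ _ _ prod.snd ?_ ?_).trans ?_
    · rw [TMulticat.prodIds_dom]
      change T.ηAt _ = _
      refine (Category.id_comp _).symm.trans (congrArg (· ≫ T.ηAt _) ?_)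
      apply Limits.prod.hom_ext <;> simp
    · exact TMulticat.prodIds_snd _ _
    · refine (congrArg (L.act.onArr · prod.snd) ?_).trans
        ((L.act.onArr_idArr prod.fst prod.snd).trans ?_)
      · simp
      · rw [← Action.obj_eq]; rfl
  comp_comm := ofLaxArr_comp L _

/-- The functors are recovered by `laxApp_ids` and the transformations by `laxApp_idArr`. Together
with `toLax_injective` this makes `toLax` a bijection. -/
lemma toLax_ofLax : toLax (ofLax L) = L := by
  apply Lax.ext'
  · rfl
  · refine (precomp_ofLaxArr L _).trans ((laxApp_ids L _ _ _ _ _ prod.snd ?_ ?_).trans ?_)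
    · simp
    · simp
    · simp [Action.arr_eq]
  · intro Y t y h
    rw [toLax_appAt]
    refine (precomp_ofLaxArr L _).trans ((laxApp_idArr L _ _ _ _ _ ?_).trans ?_)
    · simp
    · apply Cells.appAt_congr <;> simp

end ofLax

end TStructCat

/-! ### Pullback squares provided by a cartesian monad. -/

namespace IsCartesianMonad

variable {E : Type u} [Category.{v} E] {T : Monad E}

lemma map_isPullback (hT : IsCartesianMonad T) {P X Y Z : E} {f : P ⟶ X} {g : P ⟶ Y} {h : X ⟶ Z} {k : Y ⟶ Z}
    (sq : IsPullback f g h k) : IsPullback (T.map f) (T.map g) (T.map h) (T.map k) :=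
  have := hT.preservesPullbacks
  sq.map T.toFunctor

lemma unit_isPullback (hT : IsCartesianMonad T) {X Y : E} (f : X ⟶ Y) :
    IsPullback f (T.ηAt X) (T.ηAt Y) (T.map f) := hT.unit_cartesian f

lemma mult_isPullback (hT : IsCartesianMonad T) {X Y : E} (f : X ⟶ Y) :
    IsPullback (T.map (T.map f)) (T.μAt X) (T.μAt Y) (T.map f) := hT.mult_cartesian f

variable [HasPullbacks E]

/-- A family of elements of `T P` indexed by an element `r` of `T Y`, over prescribed elements of
`T K`, is the same as an element of `T P` over the product of the prescribed elements. -/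
lemma family_isPullback (hT : IsCartesianMonad T) {P K Y : E} (p : P ⟶ K) (d : Y ⟶ T.obj K) :
    IsPullback (T.map (pullback.fst (T.map p) d) ≫ T.μAt P) (T.map (pullback.snd (T.map p) d))
      (T.map p) (T.map d ≫ T.μAt K) :=
  -- The image under `T` of the pullback of `T p` and `d`, pasted with the naturality square of `μ`
  -- at `p`.
  (hT.map_isPullback (IsPullback.of_hasPullback (T.map p) d)).flip.paste_vert
    (hT.mult_isPullback p) |>.flip

end IsCartesianMonad

/-! ### Composites and identities of families of transformations. -/

namespace TStructCat

variable {E : Type u} [Category.{v} E] [HasFiniteLimits E] {T : Monad E} {A : TStructCat T}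
  {B : TMulticat T}

section composite

variable {K₀ K₁ X Y : E} {M : Action A B K₀} {d : K₁ ⟶ T.obj K₀} {c : K₁ ⟶ K₀}

/-- The family of elements of `T P` over an element of `T K₁`, for a map `p` to `K₀`. -/
noncomputable def famLift (hT : IsCartesianMonad T) {P : E} (p : P ⟶ K₀) (d : K₁ ⟶ T.obj K₀)
    (t : X ⟶ T.obj P) (w : X ⟶ T.obj K₁) (h : t ≫ T.map p = w ≫ T.map d ≫ T.μAt K₀) :
    X ⟶ T.obj (pullback (T.map p) d) :=
  (hT.family_isPullback p d).lift t w h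

section

variable (hT : IsCartesianMonad T) {P : E} (p : P ⟶ K₀) (d : K₁ ⟶ T.obj K₀)
    (t : X ⟶ T.obj P) (w : X ⟶ T.obj K₁) (h : t ≫ T.map p = w ≫ T.map d ≫ T.μAt K₀)

@[simp] lemma famLift_fst : famLift hT p d t w h ≫ T.map (pullback.fst _ _) ≫ T.μAt P = t :=
  (hT.family_isPullback p d).lift_fst _ _ _

@[simp] lemma famLift_snd : famLift hT p d t w h ≫ T.map (pullback.snd _ _) = w :=
  (hT.family_isPullback p d).lift_snd _ _ _

lemma precomp_famLift (k : Y ⟶ X) : k ≫ famLift hT p d t w h =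
    famLift hT p d (k ≫ t) (k ≫ w) (by simp [h]) := by
  apply (hT.family_isPullback p d).hom_ext
  · simp
  · simp

lemma famLift_map (y : X ⟶ T.obj Y) (t : Y ⟶ T.obj P) (w : Y ⟶ K₁) (h : t ≫ T.map p = w ≫ d)
    (h') : famLift hT p d (y ≫ T.map t ≫ T.μAt P) (y ≫ T.map w) h' =
      y ≫ T.map (pullback.lift t w h) := by
  apply (hT.family_isPullback p d).hom_ext
  · rw [famLift_fst, Category.assoc, ← T.map_comp_assoc, pullback.lift_fst]
  · rw [famLift_snd, Category.assoc, ← T.map_comp, pullback.lift_snd]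

/-- Index the family by the pullback of `T p` and `d` itself, with its two projections as members.
Statements about `compAt` then need proof only for families written as `y ≫ T.map _`. -/
lemma exists_family (hT : IsCartesianMonad T) {P : E} (p : P ⟶ K₀) (d : K₁ ⟶ T.obj K₀)
    (t : X ⟶ T.obj P) (w : X ⟶ T.obj K₁) (h : t ≫ T.map p = w ≫ T.map d ≫ T.μAt K₀) :
    ∃ (Y : E) (y : X ⟶ T.obj Y) (t' : Y ⟶ T.obj P) (w' : Y ⟶ K₁),
    t' ≫ T.map p = w' ≫ d ∧ t = y ≫ T.map t' ≫ T.μAt P ∧ w = y ≫ T.map w' :=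
  ⟨_, famLift hT p d t w h, _, _, pullback.condition, by simp, by simp⟩

end

variable (hT : IsCartesianMonad T) (N : Cells M d c)

/-- The composite of a family of transformations with a transformation. -/
noncomputable def compAt (t : X ⟶ T.obj (A.underlying.C₀ ⨯ K₀)) (w : X ⟶ T.obj K₁) (k : X ⟶ K₁)
    (h : t ≫ T.map prod.snd = w ≫ T.map d ≫ T.μAt K₀) (hw : w ≫ T.map c = k ≫ d) : X ⟶ B.C₁ :=
  B.compOf (famLift hT prod.snd d t w h ≫ T.map N.app)
    (N.appAt (famLift hT prod.snd d t w h ≫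
      T.map (prod.lift (pullback.fst _ _ ≫ T.map prod.fst ≫ A.tensor) (pullback.snd _ _ ≫ c))) k
      (by
        rw [Category.assoc, map_prodLift_snd, T.map_comp, ← Category.assoc, famLift_snd, hw]))
    (by
      rw [Category.assoc, ← T.map_comp, N.app_cod, Action.map_onObj, Cells.appAt_dom,
        Category.assoc])

lemma precomp_compAt (t : X ⟶ T.obj (A.underlying.C₀ ⨯ K₀)) (w : X ⟶ T.obj K₁) (k : X ⟶ K₁)
    (h : t ≫ T.map prod.snd = w ≫ T.map d ≫ T.μAt K₀) (hw : w ≫ T.map c = k ≫ d) (r : Y ⟶ X) :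
    r ≫ compAt hT N t w k h hw =
      compAt hT N (r ≫ t) (r ≫ w) (r ≫ k) (by simp [h]) (by simp [hw]) := by
  rw [compAt, TMulticat.precomp_compOf]
  refine TMulticat.compOf_congr _ ?_ ?_ _
  · rw [← Category.assoc, precomp_famLift]
  · rw [Cells.precomp_appAt]
    apply Cells.appAt_congr _ rfl
    rw [← Category.assoc, precomp_famLift]

lemma compAt_congr {t t' : X ⟶ T.obj (A.underlying.C₀ ⨯ K₀)} {w w' : X ⟶ T.obj K₁}
    {k k' : X ⟶ K₁} {h h' hw hw'} (e₁ : t = t') (e₂ : w = w') (e₃ : k = k') :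
    compAt hT N t w k h hw = compAt hT N t' w' k' h' hw' := by
  subst e₁ e₂ e₃; rfl

/-- The working formula for `compAt`: for an explicitly indexed family the lift through the pullback
disappears and an ordinary composite in `B` remains. -/
lemma compAt_map (y : X ⟶ T.obj Y) (t : Y ⟶ T.obj (A.underlying.C₀ ⨯ K₀)) (w : Y ⟶ K₁)
    (k : X ⟶ K₁) (h : t ≫ T.map prod.snd = w ≫ d) (h₁ hw h₂ h₃) :
    compAt hT N (y ≫ T.map t ≫ T.μAt _) (y ≫ T.map w) k h₁ hw =
      B.compOf (y ≫ T.map (N.appAt t w h)) (N.appAt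
        (y ≫ T.map (prod.lift (t ≫ T.map prod.fst ≫ A.tensor) (w ≫ c))) k h₂) h₃ := by
  refine TMulticat.compOf_congr _ ?_ ?_ _
  · rw [famLift_map hT _ _ y t w h, Category.assoc, ← T.map_comp]; rfl
  · apply Cells.appAt_congr _ rfl
    rw [famLift_map hT _ _ y t w h, Category.assoc, ← T.map_comp, prod.comp_lift]
    simp

lemma compAt_dom (t : X ⟶ T.obj (A.underlying.C₀ ⨯ K₀)) (w : X ⟶ T.obj K₁) (k : X ⟶ K₁)
    (h : t ≫ T.map prod.snd = w ≫ T.map d ≫ T.μAt K₀) (hw : w ≫ T.map c = k ≫ d) :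
    compAt hT N t w k h hw ≫ B.dom = t ≫ T.map M.obj := by
  obtain ⟨Y, y, t, w, h', rfl, rfl⟩ := exists_family hT _ _ t w h
  rw [compAt_map hT N y t w k h' _ _ (by simpa using hw) (by simp)]
  simp

lemma compAt_cod (t : X ⟶ T.obj (A.underlying.C₀ ⨯ K₀)) (w : X ⟶ T.obj K₁) (k : X ⟶ K₁)
    (h : t ≫ T.map prod.snd = w ≫ T.map d ≫ T.μAt K₀) (hw : w ≫ T.map c = k ≫ d) :
    compAt hT N t w k h hw ≫ B.cod = M.onObj (t ≫ T.map prod.fst ≫ A.tensor) (k ≫ c) := by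
  obtain ⟨Y, y, t, w, h', rfl, rfl⟩ := exists_family hT _ _ t w h
  rw [compAt_map hT N y t w k h' _ _ (by simpa using hw) (by simp)]
  simp

/-- Associativity in `B` when the middle layer is a single arrow over each index; the right unit law
of `T` removes the multiplication. -/
lemma compOf_map_unary (y : X ⟶ T.obj Y) (f g : Y ⟶ B.C₁) (p : X ⟶ B.C₁) (h₁ h₂ h₃ h₄) :
    B.compOf (y ≫ T.map f) (B.compOf (y ≫ T.map g) p h₁) h₂ =
      B.compOf (y ≫ T.map (B.compOf (f ≫ T.ηAt _) g h₃)) p h₄ := by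
  refine Eq.symm ((TMulticat.compOf_map_compOf _ _ _ _ _ _ h₁ _ ?_).trans
    (TMulticat.compOf_congr _ ?_ rfl _))
  · simpa using h₂
  · simp

/-- Naturality squares paste: unary arrows pass the outer transformation first, then each member of
the inner family. -/
lemma compAt_natural (t : X ⟶ T.obj (A.D₁.A ⨯ K₀)) (w : X ⟶ T.obj K₁) (k : X ⟶ K₁)
    (h₁ hw h₂ h₃ h₄) :
    B.compOf (compAt hT N (t ≫ T.map (prod.map A.src (𝟙 _))) w k h₁ hw ≫ T.ηAt _)
        (M.onArr (t ≫ T.map prod.fst ≫ A.D₁.a) (k ≫ c)) h₂ =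
      B.compOf (t ≫ T.map M.arr)
        (compAt hT N (t ≫ T.map (prod.map A.tgt (𝟙 _))) w k h₃ hw) h₄ := by
  have h : t ≫ T.map prod.snd = w ≫ T.map d ≫ T.μAt K₀ := by simpa using h₁
  obtain ⟨Y, y, t, w, h', rfl, rfl⟩ := exists_family hT _ _ t w h
  have hw' : y ≫ T.map w ≫ T.map c = k ≫ d := by simpa using hw
  -- One formula for both ends of the square, with `f` the source map or the target map of `A`.
  have e (f : A.D₁.A ⟶ A.underlying.C₀) (h₁ h₂ h₃ h₄) :
      compAt hT N ((y ≫ T.map t ≫ T.μAt _) ≫ T.map (prod.map f (𝟙 _))) (y ≫ T.map w) k h₁ hw =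
        B.compOf (y ≫ T.map (N.appAt (t ≫ T.map (prod.map f (𝟙 _))) w h₂))
          (N.appAt (y ≫ T.map (prod.lift (t ≫ T.map prod.fst ≫ T.map f ≫ A.tensor) (w ≫ c))) k h₃)
          h₄ := by
    refine (compAt_congr hT N ?_ rfl rfl).trans
      ((compAt_map hT N y (t ≫ T.map (prod.map f (𝟙 _))) w k h₂ ?_ hw ?_ ?_).trans
        (TMulticat.compOf_congr _ rfl (Cells.appAt_congr ?_ rfl) _))
    · simp
    · simpa using h
    · simp [hw']
    · simp
    · simp
  have s₁ : (t ≫ T.map (prod.map A.src (𝟙 _))) ≫ T.map prod.snd = w ≫ d := by simpa using h'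
  have s₂ : (t ≫ T.map (prod.map A.tgt (𝟙 _))) ≫ T.map prod.snd = w ≫ d := by simpa using h'
  -- Naturality of the outer transformation, for the family of arrows obtained by tensoring each
  -- member of `t`; the algebra law identifies their total tensor product.
  have inner : B.compOf (N.appAt (y ≫ T.map (prod.lift
          (t ≫ T.map prod.fst ≫ T.map A.src ≫ A.tensor) (w ≫ c))) k (by simp [hw']) ≫ T.ηAt _)
        (M.onArr ((y ≫ T.map t ≫ T.μAt _) ≫ T.map prod.fst ≫ A.D₁.a) (k ≫ c)) (by simp) =
      B.compOf (y ≫ T.map (M.onArr (t ≫ T.map prod.fst ≫ A.D₁.a) (w ≫ c)))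
        (N.appAt (y ≫ T.map (prod.lift
          (t ≫ T.map prod.fst ≫ T.map A.tgt ≫ A.tensor) (w ≫ c))) k (by simp [hw']))
        (by simp) := by
    refine Eq.trans (TMulticat.compOf_congr _ rfl ?_ _)
      ((N.appAt_natural k (y ≫ T.map (prod.lift (t ≫ T.map prod.fst ≫ A.D₁.a) (w ≫ c)))
        ?_ ?_ ?_ ?_ ?_ ?_).trans (TMulticat.compOf_congr _ ?_ rfl _))
    all_goals simp [hw']
  rw [TMulticat.compOf_congr B (congrArg (· ≫ T.ηAt _) (e A.src _ s₁ (by simp [hw']) (by simp)))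
    rfl, TMulticat.compOf_congr B rfl (e A.tgt _ s₂ (by simp [hw']) (by simp))]
  refine (TMulticat.compOf_eta_compOf _ _ _ _ _ _ ?_ ?_).trans
    ((TMulticat.compOf_congr _ rfl inner _).trans
    ((compOf_map_unary _ _ _ _ ?_ _ ?_ ?_).trans
    ((TMulticat.compOf_congr _ (congrArg (y ≫ T.map ·) (N.appAt_natural w t rfl rfl
      s₁ s₂ ?_ ?_)) rfl _).trans
    ((TMulticat.compOf_map_compOf _ _ _ _ _ _ ?_ _ ?_).trans
    (TMulticat.compOf_congr _ ?_ rfl _)))))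
  all_goals simp

/-- The composition of transformations, as a family of transformations. -/
noncomputable def compCells :
    Cells M (pullback.fst (T.map c) d ≫ T.map d ≫ T.μAt K₀) (pullback.snd (T.map c) d ≫ c) where
  app := compAt hT N (pullback.fst _ _) (pullback.snd _ _ ≫ pullback.fst _ _)
    (pullback.snd _ _ ≫ pullback.snd _ _) (by simp [pullback.condition])
    (by simp [pullback.condition])
  app_dom := compAt_dom _ _ _ _ _ _ _
  app_cod := by rw [compAt_cod, Category.assoc]
  natural t y h₁ h₂ h₃ h₄ := by
    have hw : (y ≫ pullback.fst _ _) ≫ T.map c = (y ≫ pullback.snd _ _) ≫ d := by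
      simp [pullback.condition]
    simp only [precomp_compAt, pullback.lift_fst, pullback.lift_snd_assoc, ← Category.assoc y _ c]
      at h₂ h₄ ⊢
    exact compAt_natural hT N t (y ≫ pullback.fst _ _) (y ≫ pullback.snd _ _) (by simpa using h₁) hw
      h₂ (by simpa using h₃) h₄

lemma compCells_appAt (t : X ⟶ T.obj (A.underlying.C₀ ⨯ K₀)) (w : X ⟶ T.obj K₁) (k : X ⟶ K₁)
    (hw : w ≫ T.map c = k ≫ d)
    (h : t ≫ T.map prod.snd =
      pullback.lift w k hw ≫ pullback.fst (T.map c) d ≫ T.map d ≫ T.μAt K₀)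
    (h' : t ≫ T.map prod.snd = w ≫ T.map d ≫ T.μAt K₀) :
    (compCells hT N).appAt t (pullback.lift w k hw) h = compAt hT N t w k h' hw := by
  rw [Cells.appAt, compCells, precomp_compAt]
  apply compAt_congr <;> simp

/-- The map to `B₁` underlying the family of transformations given by identities. -/
noncomputable def idApp (hT : IsCartesianMonad T) (M : Action A B K₀) :
    pullback (T.map (prod.snd : A.underlying.C₀ ⨯ K₀ ⟶ K₀)) (T.ηAt K₀) ⟶ B.C₁ :=
  (hT.unit_isPullback prod.snd).lift (pullback.snd _ _) (pullback.fst _ _)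
    pullback.condition.symm ≫ M.obj ≫ B.ids

/-- An element of `T (P × Q)` over a unit in `T Q` is a unit. -/
lemma exists_unit_eq (hT : IsCartesianMonad T) {P Q : E} (t : X ⟶ T.obj (P ⨯ Q)) (x : X ⟶ Q)
    (h : t ≫ T.map prod.snd = x ≫ T.ηAt Q) : ∃ a, t = prod.lift a x ≫ T.ηAt _ := by
  -- The naturality square of `η` at the second projection is a pullback, so `x` and `t` come from
  -- one element of `P × Q`.
  have sq := hT.unit_isPullback (prod.snd : P ⨯ Q ⟶ Q)
  refine ⟨sq.lift x t h.symm ≫ prod.fst, ?_⟩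
  refine (sq.lift_snd x t h.symm).symm.trans (congrArg (· ≫ T.ηAt _) ?_)
  apply Limits.prod.hom_ext
  · simp
  · rw [sq.lift_fst, prod.lift_snd]

/-- Computes `idApp` at families that are units; by `exists_unit_eq` there are no others. -/
lemma lift_idApp (M : Action A B K₀) (a : X ⟶ A.underlying.C₀) (x : X ⟶ K₀)
    (t : X ⟶ T.obj (A.underlying.C₀ ⨯ K₀)) (ht : t = prod.lift a x ≫ T.ηAt _) (h) :
    pullback.lift t x h ≫ idApp hT M = M.onObj a x ≫ B.ids := by
  subst ht
  rw [idApp, ← Category.assoc, Action.onObj, Category.assoc (prod.lift a x)]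
  refine congrArg (· ≫ M.obj ≫ B.ids) ?_
  apply (hT.unit_isPullback prod.snd).hom_ext
  · rw [Category.assoc, IsPullback.lift_fst, pullback.lift_snd, prod.lift_snd]
  · rw [Category.assoc, IsPullback.lift_snd, pullback.lift_fst]

/-- The family of transformations given by identities. -/
noncomputable def idCells (M : Action A B K₀) : Cells M (T.ηAt K₀) (𝟙 K₀) where
  app := idApp hT M
  app_dom := by
    obtain ⟨a, h₂⟩ := exists_unit_eq hT _ _ (pullback.condition
      (f := T.map (prod.snd : A.underlying.C₀ ⨯ K₀ ⟶ K₀)) (g := T.ηAt K₀))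
    have := lift_idApp hT M a _ _ h₂ pullback.condition
    rw [pullback.lift_fst_snd, Category.id_comp] at this
    rw [this, h₂]
    simp [Action.onObj]
  app_cod := by
    obtain ⟨a, h₂⟩ := exists_unit_eq hT _ _ (pullback.condition
      (f := T.map (prod.snd : A.underlying.C₀ ⨯ K₀ ⟶ K₀)) (g := T.ηAt K₀))
    have := lift_idApp hT M a _ _ h₂ pullback.condition
    rw [pullback.lift_fst_snd, Category.id_comp] at this
    rw [this, h₂]
    simp
  natural t y h₁ h₂ h₃ h₄ := by
    -- The family of arrows is a single arrow `a`, and both sides equal its action by the unit laws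
    -- of `B`.
    obtain ⟨a, rfl⟩ := exists_unit_eq hT t y (by simpa using h₁)
    refine (TMulticat.compOf_ids _ _ _ ?_ _).trans (Eq.trans ?_
      (TMulticat.ids_compOf' _ (M.onArr a y) _ _ ?_ ?_ _).symm)
    · rw [lift_idApp hT M (a ≫ A.src) _ _ (by simp)]
      simp
    · simp
    · simp [Action.onArr]
    · rw [lift_idApp hT M (a ≫ A.tgt) _ _ (by simp)]
      simp

lemma idCells_appAt (M : Action A B K₀) (a : X ⟶ A.underlying.C₀) (x : X ⟶ K₀) (h) :
    (idCells hT M).appAt (prod.lift a x ≫ T.ηAt _) x h = M.onObj a x ≫ B.ids :=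
  lift_idApp hT M a x _ rfl h

end composite

end TStructCat

/-! ### The multicategory structure on a universal family of transformations. -/

namespace TStructCat

variable {E : Type u} [Category.{v} E] [HasFiniteLimits E] {T : Monad E}

/-- A universal family of functors from `A` to `B`, and a universal family of transformations
between them. -/
structure Classifier (A : TStructCat T) (B : TMulticat T) where
  K₀ : E
  act : Action A B K₀
  exists_res_eq : ∀ {X : E} (M : Action A B X), ∃ k : X ⟶ K₀, act.res k = M
  hom_ext₀ : ∀ {X : E} {k k' : X ⟶ K₀}, act.res k = act.res k' → k = k'
  K₁ : E
  dom : K₁ ⟶ T.obj K₀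
  cod : K₁ ⟶ K₀
  cells : Cells act dom cod
  -- Agreement with `N` is expressed on values, since the reindexed universal family has domain `k ≫
  -- dom`, which equals `d` only propositionally.
  exists_hom : ∀ {X : E} {d : X ⟶ T.obj K₀} {c : X ⟶ K₀} (N : Cells act d c),
    ∃ k : X ⟶ K₁, k ≫ dom = d ∧ k ≫ cod = c ∧
      ∀ {Y : E} (t : Y ⟶ T.obj (A.underlying.C₀ ⨯ K₀)) (y : Y ⟶ X)
        (h : t ≫ T.map prod.snd = (y ≫ k) ≫ dom) (h' : t ≫ T.map prod.snd = y ≫ d),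
        cells.appAt t (y ≫ k) h = N.appAt t y h'
  hom_ext₁ : ∀ {X : E} {k k' : X ⟶ K₁}, k ≫ dom = k' ≫ dom → k ≫ cod = k' ≫ cod →
    (∀ {Y : E} (t : Y ⟶ T.obj (A.underlying.C₀ ⨯ K₀)) (y : Y ⟶ X)
      (h : t ≫ T.map prod.snd = (y ≫ k) ≫ dom) (h' : t ≫ T.map prod.snd = (y ≫ k') ≫ dom),
      cells.appAt t (y ≫ k) h = cells.appAt t (y ≫ k') h') → k = k'

namespace Classifier

variable {A : TStructCat T} {B : TMulticat T} (K : Classifier A B) (hT : IsCartesianMonad T)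
  {X Y : E}

/-- The composition of the exponential. -/
noncomputable def comp : pullback (T.map K.cod) K.dom ⟶ K.K₁ :=
  (K.exists_hom (compCells hT K.cells)).choose

@[simp]
lemma comp_dom : K.comp hT ≫ K.dom = pullback.fst _ _ ≫ T.map K.dom ≫ T.μAt _ :=
  (K.exists_hom (compCells hT K.cells)).choose_spec.1

@[simp]
lemma comp_cod : K.comp hT ≫ K.cod = pullback.snd _ _ ≫ K.cod :=
  (K.exists_hom (compCells hT K.cells)).choose_spec.2.1

@[simp]
lemma map_comp_dom : T.map (K.comp hT) ≫ T.map K.dom =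
    T.map (pullback.fst _ _) ≫ T.map (T.map K.dom) ≫ T.map (T.μAt _) := by
  simp only [← T.map_comp, comp_dom]

@[simp]
lemma map_comp_dom_assoc {W : E} (ψ : _ ⟶ W) :
    T.map (K.comp hT) ≫ T.map K.dom ≫ ψ = T.map (pullback.fst _ _) ≫ T.map (T.map K.dom) ≫ T.map (T.μAt _) ≫ ψ := by
  simp only [← Category.assoc, map_comp_dom]

@[simp]
lemma map_comp_cod : T.map (K.comp hT) ≫ T.map K.cod = T.map (pullback.snd _ _) ≫ T.map K.cod := by
  simp only [← T.map_comp, comp_cod]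

/-- The identities of the exponential. -/
noncomputable def ids : K.K₀ ⟶ K.K₁ := (K.exists_hom (idCells hT K.act)).choose

@[simp]
lemma ids_dom : K.ids hT ≫ K.dom = T.ηAt _ :=
  (K.exists_hom (idCells hT K.act)).choose_spec.1

@[simp]
lemma ids_cod : K.ids hT ≫ K.cod = 𝟙 _ :=
  (K.exists_hom (idCells hT K.act)).choose_spec.2.1

@[simp]
lemma map_ids_dom : T.map (K.ids hT) ≫ T.map K.dom = T.map (T.ηAt _) := by
  simp only [← T.map_comp, ids_dom]

@[simp]
lemma map_ids_dom_assoc {W : E} (ψ : _ ⟶ W) :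
    T.map (K.ids hT) ≫ T.map K.dom ≫ ψ = T.map (T.ηAt _) ≫ ψ := by
  simp only [← Category.assoc, map_ids_dom]

@[simp]
lemma map_ids_cod : T.map (K.ids hT) ≫ T.map K.cod = 𝟙 _ := by
  simp only [← T.map_comp, ids_cod, T.map_id]

lemma appAt_ids (a : X ⟶ A.underlying.C₀) (x : X ⟶ K.K₀) (h) :
    K.cells.appAt (prod.lift a x ≫ T.ηAt _) (x ≫ K.ids hT) h = K.act.onObj a x ≫ B.ids :=
  ((K.exists_hom (idCells hT K.act)).choose_spec.2.2 _ _ h (by simp)).trans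
    (idCells_appAt hT K.act a x _)

/-- The defining property of `comp`. The composite is a variable `q` with an equation, so the rule
applies to any expression equal to it. -/
lemma appAt_comp (t : X ⟶ T.obj (A.underlying.C₀ ⨯ K.K₀)) (w : X ⟶ T.obj K.K₁) (k : X ⟶ K.K₁)
    (hw : w ≫ T.map K.cod = k ≫ K.dom) (q : X ⟶ K.K₁) (hq : q = pullback.lift w k hw ≫ K.comp hT)
    (h : t ≫ T.map prod.snd = q ≫ K.dom)
    (h' : t ≫ T.map prod.snd = w ≫ T.map K.dom ≫ T.μAt _) :
    K.cells.appAt t q h = compAt hT K.cells t w k h' hw := by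
  subst hq
  exact ((K.exists_hom (compCells hT K.cells)).choose_spec.2.2 _ _ h (by simpa using h')).trans
    (compCells_appAt hT K.cells t w k hw _ _)

lemma lift_congr {w w' : X ⟶ T.obj K.K₁} {k k' : X ⟶ K.K₁} (hw : w = w') (hk : k = k') (h h') :
    pullback.lift (f := T.map K.cod) (g := K.dom) w k h = pullback.lift w' k' h' := by
  subst hw hk; rfl

lemma precomp_lift (y : Y ⟶ X) (w : X ⟶ T.obj K.K₁) (k : X ⟶ K.K₁) (h) :
    y ≫ pullback.lift (f := T.map K.cod) (g := K.dom) w k h =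
      pullback.lift (y ≫ w) (y ≫ k) (by simp [h]) := by
  apply pullback.hom_ext <;> simp

lemma comp_ids (h) : pullback.lift (f := T.map K.cod) (g := K.dom) (K.dom ≫ T.map (K.ids hT))
    (𝟙 _) h ≫ K.comp hT = 𝟙 _ := by
  apply K.hom_ext₁
  · simp
  · simp
  · intro Y t y h₁ h₂
    have e : t ≫ T.map prod.snd = y ≫ K.dom := by simpa using h₂
    rw [K.appAt_comp hT t (t ≫ T.map (prod.snd ≫ K.ids hT)) y (by simp [e]) _
      (by
        rw [← Category.assoc, precomp_lift]
        congr 1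
        apply lift_congr
        · rw [T.map_comp, reassoc_of% e]
        · simp) h₁ (by simp)]
    -- The family `t` is indexed by its own members: the index object is `A₀ × K₀`, and over its
    -- generic element stands a one-element family with an identity transformation.
    have key := compAt_map hT K.cells t (T.ηAt _) (prod.snd ≫ K.ids hT) y (by simp) (by simp)
      (by simp [e]) (by simp [e]) (by simp)
    refine Eq.trans (compAt_congr hT _ (by simp) rfl rfl) (key.trans ?_)
    refine (TMulticat.compOf_ids _ _ _ ?_ _).trans (Cells.appAt_congr ?_ ?_)
    · have := K.appAt_ids hT (prod.fst : A.underlying.C₀ ⨯ K.K₀ ⟶ _) prod.snd (by simp)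
      rw [Cells.appAt_dom_assoc, Cells.appAt_congr (t' := prod.lift prod.fst prod.snd ≫ T.ηAt _)
        (h' := by simp) (by simp) rfl, this]
      simp [Action.onObj]
    · simp
    · simp

lemma ids_comp (h) : pullback.lift (f := T.map K.cod) (g := K.dom) (T.ηAt _)
    (K.cod ≫ K.ids hT) h ≫ K.comp hT = 𝟙 _ := by
  apply K.hom_ext₁
  · simp
  · simp
  · intro Y t y h₁ h₂
    have e : t ≫ T.map prod.snd = y ≫ K.dom := by simpa using h₂
    rw [K.appAt_comp hT t (T.ηAt _ ≫ T.map y) (y ≫ K.cod ≫ K.ids hT) (by simp) _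
      (by
        rw [← Category.assoc, precomp_lift]
        congr 1
        apply lift_congr
        · simp
        · simp) h₁ (by simp [e])]
    -- Here the outer transformation is an identity, so the family being composed has the single
    -- member `y`.
    have key := compAt_map hT K.cells (T.ηAt _) t y (y ≫ K.cod ≫ K.ids hT) e (by simp [e])
      (by simp) (by simp) (by simp [Action.onObj])
    refine Eq.trans (compAt_congr hT _ (by simp) rfl rfl) (key.trans ?_)
    refine (TMulticat.ids_compOf' _ (K.cells.appAt t y e) _ _ (by simp) ?_ _).trans
      (Cells.appAt_congr rfl (by simp))
    have := K.appAt_ids hT (t ≫ T.map prod.fst ≫ A.tensor) (y ≫ K.cod) (by simp)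
    rw [Cells.appAt_cod_assoc, ← this]
    apply Cells.appAt_congr <;> simp

lemma map_family_condition {P : E} {p : P ⟶ K.K₀} {t : Y ⟶ T.obj P} {w : Y ⟶ K.K₁}
    (h : t ≫ T.map p = w ≫ K.dom) (y : X ⟶ T.obj Y) :
    (y ≫ T.map t ≫ T.μAt _) ≫ T.map p = (y ≫ T.map w) ≫ T.map K.dom ≫ T.μAt _ := by
  simp only [Category.assoc, ← map_map_μAt]
  rw [← T.map_comp_assoc, h, T.map_comp_assoc]

/-- Associativity for transformations. Once `t` is written as a family of families, both sides
become threefold composites in `B`, and associativity of `B` compares them. -/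
lemma compAt_comp (t : X ⟶ T.obj (A.underlying.C₀ ⨯ K.K₀))
    (r : X ⟶ T.obj (pullback (T.map K.cod) K.dom)) (p : X ⟶ K.K₁)
    (e : t ≫ T.map prod.snd = r ≫ T.map (K.comp hT ≫ K.dom) ≫ T.μAt _)
    (hp : r ≫ T.map (K.comp hT ≫ K.cod) = p ≫ K.dom) (h₁ h₂ h₃ h₄ h₅) :
    compAt hT K.cells t (r ≫ T.map (K.comp hT)) p h₁ h₂ =
      compAt hT K.cells t (r ≫ T.map (pullback.fst _ _) ≫ T.μAt _)
        (pullback.lift (f := T.map K.cod) (g := K.dom) (r ≫ T.map (pullback.snd _ _)) p h₃ ≫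
          K.comp hT) h₄ h₅ := by
  -- The first splitting follows the outer family `r` of composable pairs; the second follows,
  -- inside each pair, the family of first factors.
  obtain ⟨Y, y, t, r, h', rfl, rfl⟩ := exists_family hT _ _ t r e
  have h'' : t ≫ T.map prod.snd = (r ≫ pullback.fst _ _) ≫ T.map K.dom ≫ T.μAt _ := by
    simpa using h'
  obtain ⟨Z, z, t, q, hq, rfl, hr⟩ := exists_family hT _ _ t _ h''
  have hzr : (z ≫ T.map q) ≫ T.map K.cod = (r ≫ pullback.snd _ _) ≫ K.dom := by
    rw [← hr, Category.assoc, pullback.condition, Category.assoc]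
  have hs : (z ≫ T.map (prod.lift (t ≫ T.map prod.fst ≫ A.tensor) (q ≫ K.cod))) ≫ T.map prod.snd =
      (r ≫ pullback.snd _ _) ≫ K.dom := by
    rw [← hzr]; simp
  -- `inner` expands the two lower layers and `outer` the two upper ones; they meet in the middle
  -- layer of the threefold composite.
  have inner : K.cells.appAt (z ≫ T.map t ≫ T.μAt _) (r ≫ K.comp hT) (by simpa using h') =
      B.compOf (z ≫ T.map (K.cells.appAt t q hq)) (K.cells.appAt
        (z ≫ T.map (prod.lift (t ≫ T.map prod.fst ≫ A.tensor) (q ≫ K.cod)))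
        (r ≫ pullback.snd _ _) hs) (by simp) := by
    rw [K.appAt_comp hT _ (z ≫ T.map q) (r ≫ pullback.snd _ _) hzr _
      (by
        congr 1
        apply pullback.hom_ext
        · rw [pullback.lift_fst, hr]
        · rw [pullback.lift_snd]) _ (K.map_family_condition hq z)]
    exact compAt_map hT K.cells z t q _ hq _ _ _ _
  have outer : K.cells.appAt
        (y ≫ T.map (z ≫ T.map (prod.lift (t ≫ T.map prod.fst ≫ A.tensor) (q ≫ K.cod))) ≫ T.μAt _)
        (pullback.lift (f := T.map K.cod) (g := K.dom) ((y ≫ T.map r) ≫ T.map (pullback.snd _ _)) p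
          h₃ ≫ K.comp hT) (by rw [K.map_family_condition hs]; simp) = B.compOf (y ≫ T.map (K.cells.appAt
        (z ≫ T.map (prod.lift (t ≫ T.map prod.fst ≫ A.tensor) (q ≫ K.cod)))
        (r ≫ pullback.snd _ _) hs)) (K.cells.appAt (y ≫ T.map (prod.lift
            ((z ≫ T.map t ≫ T.μAt _) ≫ T.map prod.fst ≫ A.tensor) ((r ≫ K.comp hT) ≫ K.cod))) p
              (by simpa using hp)) (by simp) := by
    rw [K.appAt_comp hT _ _ _ h₃ _ rfl _ (by rw [K.map_family_condition hs]; simp)]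
    have key := compAt_map hT K.cells y _ (r ≫ pullback.snd _ _) p hs
      (K.map_family_condition hs y) (by simpa using hp) (by simpa using hp) (by simp)
    refine (compAt_congr hT _ rfl (by simp) rfl).trans
      (key.trans (TMulticat.compOf_congr _ rfl (Cells.appAt_congr ?_ rfl) _))
    simp
  have H₂ := hp
  have H₃ := K.map_family_condition hq (y ≫ T.map z ≫ T.μAt _)
  have H₄ := y ≫= congrArg (T.map · ≫ T.μAt _) hr
  have H₅ := y ≫= congrArg (T.map · ≫ T.μAt _) hzr
  simp only [T.map_comp, Category.assoc, map_map_μAt, map_map_μAt_assoc, comp_cod] at H₂ H₃ H₄ H₅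
  refine Eq.trans (compAt_congr hT _ rfl (Category.assoc _ _ _ |>.trans (by rw [T.map_comp])) rfl)
    ((compAt_map hT K.cells y _ (r ≫ K.comp hT) p (by simpa using h') ?_ ?_ ?_ ?_).trans
    ((TMulticat.compOf_congr _ (congrArg (y ≫ T.map ·) inner) rfl _).trans
    ((TMulticat.compOf_map_compOf _ _ _ _ _ _ ?_ _ ?_).trans
    ((TMulticat.compOf_congr _ rfl outer.symm _).trans
    (Eq.trans (TMulticat.compOf_congr _ ?_ (Cells.appAt_congr ?_ rfl) _)
    ((compAt_map hT K.cells (y ≫ T.map z ≫ T.μAt _) t q _ hq ?_ ?_ ?_ ?_).symm.trans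
    (compAt_congr hT _ ?_ ?_ rfl)))))))
  all_goals simp [H₂, H₃, H₄, reassoc_of% H₄, H₅]

/-- Two maps into `K₁` agree when they classify the same transformations, which reduces the claim to
`compAt_comp`. -/
lemma comp_assoc (r : X ⟶ T.obj (pullback (T.map K.cod) K.dom)) (p : X ⟶ K.K₁) (h₁ h₂ h₃) :
    pullback.lift (f := T.map K.cod) (g := K.dom) (r ≫ T.map (K.comp hT)) p h₁ ≫ K.comp hT =
      pullback.lift (f := T.map K.cod) (g := K.dom) (r ≫ T.map (pullback.fst _ _) ≫ T.μAt _)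
        (pullback.lift (f := T.map K.cod) (g := K.dom) (r ≫ T.map (pullback.snd _ _)) p h₂ ≫
          K.comp hT) h₃ ≫ K.comp hT := by
  apply K.hom_ext₁
  · simp
  · simp
  · intro Z t y c₁ c₂
    have e : t ≫ T.map prod.snd = (y ≫ r) ≫ T.map (K.comp hT ≫ K.dom) ≫ T.μAt _ := by
      simpa using c₁
    have hp : (y ≫ r) ≫ T.map (K.comp hT ≫ K.cod) = (y ≫ p) ≫ K.dom := by
      simpa using y ≫= h₁
    have f₁ : y ≫ pullback.lift (f := T.map K.cod) (g := K.dom) (r ≫ T.map (K.comp hT)) p h₁ =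
        pullback.lift ((y ≫ r) ≫ T.map (K.comp hT)) (y ≫ p) (by simpa using hp) := by
      rw [precomp_lift]; exact K.lift_congr (by simp) rfl _ _
    have f₂ : y ≫ pullback.lift (f := T.map K.cod) (g := K.dom)
        (r ≫ T.map (pullback.fst _ _) ≫ T.μAt _)
        (pullback.lift (f := T.map K.cod) (g := K.dom) (r ≫ T.map (pullback.snd _ _)) p h₂ ≫
          K.comp hT) h₃ =
        pullback.lift ((y ≫ r) ≫ T.map (pullback.fst _ _) ≫ T.μAt _)
          (pullback.lift (f := T.map K.cod) (g := K.dom) ((y ≫ r) ≫ T.map (pullback.snd _ _))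
            (y ≫ p) (by simpa using hp) ≫ K.comp hT) (by simpa using y ≫= h₃) := by
      rw [precomp_lift]
      refine K.lift_congr (by simp) ?_ _ _
      rw [← Category.assoc, precomp_lift]
      exact congrArg (· ≫ K.comp hT) (K.lift_congr (by simp) rfl _ _)
    rw [K.appAt_comp hT t _ _ _ _ (by rw [← Category.assoc, f₁]) c₁ (by simpa using c₁),
      K.appAt_comp hT t _ _ _ _ (by rw [← Category.assoc, f₂]) c₂ (by simpa using c₂)]
    exact K.compAt_comp hT t (y ≫ r) (y ≫ p) e hp _ _ _ _ _

/-- The exponential. -/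
noncomputable def multicat : TMulticat T where
  C₀ := K.K₀
  C₁ := K.K₁
  dom := K.dom
  cod := K.cod
  comp := K.comp hT
  ids := K.ids hT
  ids_dom := K.ids_dom hT
  ids_cod := K.ids_cod hT
  comp_dom := K.comp_dom hT
  comp_cod := K.comp_cod hT
  comp_ids := K.comp_ids hT _
  ids_comp := K.ids_comp hT _
  assoc := K.comp_assoc hT _ _ _ _ _

/-- The universal family on the exponential. -/
noncomputable def lax : Lax A B (K.multicat hT) where
  act := K.act
  cells := K.cells
  app_ids := K.appAt_ids hT
  app_comp y t w h p hp h₁ h₂ h₃ := by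
    have hw : (y ≫ T.map w) ≫ T.map K.cod = p ≫ K.dom := hp
    have := compAt_map hT K.cells y t w p h 
      (K.map_family_condition h y) hw h₁ h₂
    exact this.symm.trans (K.appAt_comp hT _ _ _ hw _ rfl h₃ _).symm

end Classifier

end TStructCat

/-! ### Change of index object, and maps into the exponential. -/

namespace TStructCat

variable {E : Type u} [Category.{v} E] [HasFiniteLimits E] {T : Monad E}

section push

lemma prodMap_isPullback (P : E) {X Y : E} (k : X ⟶ Y) :
    IsPullback (prod.map (𝟙 P) k) (prod.snd : P ⨯ X ⟶ X) (prod.snd : P ⨯ Y ⟶ Y) k :=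
  IsPullback.of_isLimit' ⟨by simp⟩ (PullbackCone.IsLimit.mk _
    (fun s => prod.lift (s.fst ≫ prod.fst) s.snd)
    (fun s => by apply Limits.prod.hom_ext <;> simp [s.condition])
    (fun s => by simp)
    (fun s m h₁ h₂ => by
      apply Limits.prod.hom_ext
      · simp [← h₁]
      · simp [← h₂]))

/-- An element of `T (P × Y)` over an element of `T Y` coming from `T X` comes from `T (P × X)`. -/
lemma exists_reindex (hT : IsCartesianMonad T) {P X Y Z : E} (k : X ⟶ Y) (t : Z ⟶ T.obj (P ⨯ Y))
    (x : Z ⟶ T.obj X) (h : t ≫ T.map prod.snd = x ≫ T.map k) :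
    ∃ s : Z ⟶ T.obj (P ⨯ X), t = s ≫ T.map (prod.map (𝟙 P) k) ∧ s ≫ T.map prod.snd = x :=
  have sq := hT.map_isPullback (prodMap_isPullback P k)
  ⟨sq.lift t x h, (sq.lift_fst _ _ _).symm, sq.lift_snd _ _ _⟩

variable {A : TStructCat T} {B : TMulticat T} {X₀ K₀ X₁ X Y : E} {M : Action A B K₀} {k : X₀ ⟶ K₀}
  {d : X₁ ⟶ T.obj X₀} {c : X₁ ⟶ X₀} (hT : IsCartesianMonad T) (N : Cells (M.res k) d c)

lemma map_res_arr : T.map (M.res k).arr = T.map (prod.map (𝟙 _) k) ≫ T.map M.arr := by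
  rw [← T.map_comp, Action.arr_eq, Action.onArr_res, Action.onArr]
  congr 2
  apply Limits.prod.hom_ext <;> simp

lemma map_res_obj : T.map (M.res k).obj = T.map (prod.map (𝟙 _) k) ≫ T.map M.obj := by
  rw [← T.map_comp, Action.obj_eq, Action.onObj_res, Action.onObj]
  congr 2
  apply Limits.prod.hom_ext <;> simp

/-- The map to `B₁` underlying `pushCells`. -/
noncomputable def pushApp :
    pullback (T.map (prod.snd : A.underlying.C₀ ⨯ K₀ ⟶ K₀)) (d ≫ T.map k) ⟶ B.C₁ :=
  N.appAt ((hT.map_isPullback (prodMap_isPullback _ k)).lift (pullback.fst _ _)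
    (pullback.snd _ _ ≫ d) (by simp [pullback.condition])) (pullback.snd _ _)
    (by rw [IsPullback.lift_snd])

/-- Computes `pushApp` at families lifted from `T (A₀ × X₀)`; by `exists_reindex` every family in
its domain is of this form. -/
lemma lift_pushApp (s : X ⟶ T.obj (A.underlying.C₀ ⨯ X₀)) (x : X ⟶ X₁)
    (hs : s ≫ T.map prod.snd = x ≫ d) (t : X ⟶ T.obj (A.underlying.C₀ ⨯ K₀))
    (ht : t = s ≫ T.map (prod.map (𝟙 _) k)) (h) :
    pullback.lift t x h ≫ pushApp hT N = N.appAt s x hs := by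
  subst ht
  rw [pushApp, Cells.precomp_appAt]
  apply Cells.appAt_congr
  · apply (hT.map_isPullback (prodMap_isPullback _ k)).hom_ext
    · rw [Category.assoc, IsPullback.lift_fst, pullback.lift_fst]
    · rw [Category.assoc, IsPullback.lift_snd, pullback.lift_snd_assoc, hs]
  · simp

/-- A family of transformations for a reindexed family of functors, as a family of transformations
for the original family of functors. -/
noncomputable def pushCells : Cells M (d ≫ T.map k) (c ≫ k) where
  app := pushApp hT N
  app_dom := by
    obtain ⟨s, h₁, h₂⟩ := exists_reindex hT k
      (pullback.fst (T.map (prod.snd : A.underlying.C₀ ⨯ K₀ ⟶ K₀)) (d ≫ T.map k))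
      (pullback.snd _ _ ≫ d) (by simp [pullback.condition])
    have := lift_pushApp hT N s _ h₂ _ h₁ pullback.condition
    rw [pullback.lift_fst_snd, Category.id_comp] at this
    rw [this, h₁, Cells.appAt_dom, map_res_obj, Category.assoc]
  app_cod := by
    obtain ⟨s, h₁, h₂⟩ := exists_reindex hT k
      (pullback.fst (T.map (prod.snd : A.underlying.C₀ ⨯ K₀ ⟶ K₀)) (d ≫ T.map k))
      (pullback.snd _ _ ≫ d) (by simp [pullback.condition])
    have := lift_pushApp hT N s _ h₂ _ h₁ pullback.condition
    rw [pullback.lift_fst_snd, Category.id_comp] at this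
    rw [this, h₁, Cells.appAt_cod]
    simp
  natural t y h₁ h₂ h₃ h₄ := by
    obtain ⟨s, rfl, hs⟩ := exists_reindex hT k t (y ≫ d) (by simpa using h₁)
    have e (f : A.D₁.A ⟶ A.underlying.C₀) (h) (h') : pullback.lift ((s ≫ T.map (prod.map (𝟙 _) k)) ≫
        T.map (prod.map f (𝟙 _))) y h ≫ pushApp hT N =
        N.appAt (s ≫ T.map (prod.map f (𝟙 _))) y h' :=
      lift_pushApp hT N _ _ _ _ (by simp [← T.map_comp]) _
    have s₁ (f : A.D₁.A ⟶ A.underlying.C₀) :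
        (s ≫ T.map (prod.map f (𝟙 _))) ≫ T.map prod.snd = y ≫ d := by simp [hs]
    refine Eq.trans (TMulticat.compOf_congr _ (congrArg (· ≫ T.ηAt _) (e _ _ (s₁ _))) ?_ _)
      ((N.appAt_natural y s rfl rfl (s₁ _) (s₁ _) ?_ ?_).trans
        (TMulticat.compOf_congr _ ?_ (e _ _ (s₁ _)).symm _))
    · simp
    · simp
    · simp [map_res_arr, map_res_obj, ← T.map_comp_assoc]
    · simp [map_res_arr]

lemma pushCells_appAt (s : X ⟶ T.obj (A.underlying.C₀ ⨯ X₀)) (x : X ⟶ X₁)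
    (hs : s ≫ T.map prod.snd = x ≫ d) (h) :
    (pushCells hT N).appAt (s ≫ T.map (prod.map (𝟙 _) k)) x h = N.appAt s x hs :=
  lift_pushApp hT N s x hs _ rfl h

end push

namespace Classifier

variable {A : TStructCat T} {B : TMulticat T} (K : Classifier A B) (hT : IsCartesianMonad T)
  {X Y : E} {C : TMulticat T}

section hom

variable {K hT} (F : C ⟶ K.multicat hT)

/-- The action on objects of a map into the exponential. -/
noncomputable def homObj : C.C₀ ⟶ K.K₀ := F.f₀

/-- The action on arrows of a map into the exponential. -/
noncomputable def homArr : C.C₁ ⟶ K.K₁ := F.f₁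

lemma homArr_dom : homArr F ≫ K.dom = C.dom ≫ T.map (homObj F) := F.dom_comm

lemma homArr_cod : homArr F ≫ K.cod = C.cod ≫ homObj F := F.cod_comm

end hom

/-- The functors of `L` are classified by a map on objects and the transformations by a map on
arrows. The two compatibilities of `L` say that these maps preserve identities and composition. -/
lemma exists_hom_of_lax (L : Lax A B C) : ∃ F : C ⟶ K.multicat hT,
    K.act.res (homObj F) = L.act ∧ ∀ {Y : E} (t : Y ⟶ T.obj (A.underlying.C₀ ⨯ C.C₀)) (y : Y ⟶ C.C₁)
      (h : t ≫ T.map prod.snd = y ≫ C.dom)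
      (h' : (t ≫ T.map (prod.map (𝟙 _) (homObj F))) ≫ T.map prod.snd = (y ≫ homArr F) ≫ K.dom),
      K.cells.appAt (t ≫ T.map (prod.map (𝟙 _) (homObj F))) (y ≫ homArr F) h' = L.cells.appAt t y h := by
  obtain ⟨M, N, app_ids, app_comp⟩ := L
  obtain ⟨k, rfl⟩ := K.exists_res_eq M
  -- The transformations of `L` are between functors indexed by `C₀`; they must be pushed along `k`
  -- before the universal family over `K₀` can classify them.
  obtain ⟨f, hd, hc, hf⟩ := K.exists_hom (pushCells hT N)
  have key {Y : E} (t : Y ⟶ T.obj (A.underlying.C₀ ⨯ C.C₀)) (y : Y ⟶ C.C₁)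
      (h : t ≫ T.map prod.snd = y ≫ C.dom)
      (h' : (t ≫ T.map (prod.map (𝟙 _) k)) ≫ T.map prod.snd = (y ≫ f) ≫ K.dom) :
      K.cells.appAt (t ≫ T.map (prod.map (𝟙 _) k)) (y ≫ f) h' = N.appAt t y h :=
    (hf _ y h' (by rw [h', Category.assoc, hd])).trans (pushCells_appAt hT N t y h _)
  have ids_comm : C.ids ≫ f = k ≫ K.ids hT := by
    apply K.hom_ext₁
    · simp [hd]
    · simp [hc]
    · intro Y t y h h'
      obtain ⟨a, rfl⟩ := exists_unit_eq hT t (y ≫ k) (by rw [h']; simp)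
      have e : (prod.lift a (y ≫ k) ≫ T.ηAt _ : Y ⟶ T.obj (A.underlying.C₀ ⨯ K.K₀)) =
        (prod.lift a y ≫ T.ηAt _) ≫ T.map (prod.map (𝟙 _) k) := by simp
      refine (Cells.appAt_congr (h' := by rw [← e, h]; simp) e (Category.assoc y C.ids f).symm).trans
        ((key _ (y ≫ C.ids) (by simp) _).trans ((app_ids a y _).trans ?_))
      rw [Action.onObj_res, ← K.appAt_ids hT a (y ≫ k) (by simp)]
      exact Cells.appAt_congr rfl (Category.assoc _ _ _)
  have cond : (pullback.fst (T.map C.cod) C.dom ≫ T.map f) ≫ T.map K.cod =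
      (pullback.snd (T.map C.cod) C.dom ≫ f) ≫ K.dom := by
    rw [Category.assoc, Category.assoc, ← T.map_comp, hc, hd, T.map_comp, pullback.condition_assoc]
  have comp_comm : C.comp ≫ f = pullback.lift (f := T.map K.cod) (g := K.dom)
      (pullback.fst (T.map C.cod) C.dom ≫ T.map f) (pullback.snd (T.map C.cod) C.dom ≫ f) cond ≫
      K.comp hT := by
    have hdom : C.comp ≫ C.dom = pullback.fst _ _ ≫ T.map C.dom ≫ T.μAt _ := C.comp_dom
    apply K.hom_ext₁
    · simp only [Category.assoc, hd, comp_dom, pullback.lift_fst_assoc, ← T.map_comp_assoc]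
      simp [reassoc_of% hdom]
    · simp only [Category.assoc, hc, comp_cod, pullback.lift_snd_assoc, reassoc_of% C.comp_cod]
    · intro Y t y h h'
      -- Lift the test family from `K₀` to `C₀`, then split it along the composable pair `y`, so
      -- that `app_comp` and `compAt_map` apply to the same data.
      obtain ⟨s, rfl, hs⟩ := exists_reindex hT k t (y ≫ C.comp ≫ C.dom) (by
        rw [h]; simp only [Category.assoc, hd])
      have hs' : s ≫ T.map prod.snd = (y ≫ pullback.fst _ _) ≫ T.map C.dom ≫ T.μAt _ := by
        rw [hs, hdom, Category.assoc]
      obtain ⟨Z, z, s, w, hw, rfl, hy⟩ := exists_family hT _ _ s _ hs'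
      have h₁ : (z ≫ T.map w) ≫ T.map C.cod = (y ≫ pullback.snd _ _) ≫ C.dom := by
        rw [← hy, Category.assoc, pullback.condition, Category.assoc]
      have hw' : (s ≫ T.map (prod.map (𝟙 _) k)) ≫ T.map prod.snd = (w ≫ f) ≫ K.dom := by
        simp [reassoc_of% hw, hd]
      have h₂ : (z ≫ T.map (w ≫ f)) ≫ T.map K.cod = (y ≫ pullback.snd _ _ ≫ f) ≫ K.dom := by
        rw [T.map_comp, Category.assoc, Category.assoc, ← T.map_comp, hc, T.map_comp]
        simp only [Category.assoc, hd, ← reassoc_of% h₁]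
      have hyC : y ≫ C.comp = C.compOf (z ≫ T.map w) (y ≫ pullback.snd _ _) h₁ := by
        rw [TMulticat.compOf]
        congr 1
        apply pullback.hom_ext <;> simp [hy]
      have lhs : N.appAt (z ≫ T.map s ≫ T.μAt _) (y ≫ C.comp) (by rw [hs, Category.assoc]) = _ :=
        (Cells.appAt_congr (h' := by rw [← hyC, hs, Category.assoc]) rfl hyC).trans
          (app_comp z s w hw (y ≫ pullback.snd _ _) h₁ (by simp [← h₁]) (by simp) _).symm
      have rhs := K.appAt_comp hT ((z ≫ T.map s ≫ T.μAt _) ≫ T.map (prod.map (𝟙 _) k))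
        (z ≫ T.map (w ≫ f)) (y ≫ pullback.snd _ _ ≫ f) h₂ _
        (by
          rw [← Category.assoc, precomp_lift]
          exact congrArg (· ≫ K.comp hT)
            (K.lift_congr (by rw [T.map_comp, ← reassoc_of% hy]) rfl _ _))
        h' (by simpa using K.map_family_condition hw' z)
      have key' := compAt_map hT K.cells z (s ≫ T.map (prod.map (𝟙 _) k)) (w ≫ f)
        (y ≫ pullback.snd _ _ ≫ f) hw' (K.map_family_condition hw' z) h₂ (by simpa using h₂)
        (by simp)
      refine ((Cells.appAt_congr rfl (Category.assoc y C.comp f).symm).trans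
        ((key _ (y ≫ C.comp) (by rw [hs, Category.assoc])
          (by rw [h]; simp only [Category.assoc])).trans lhs)).trans (Eq.trans ?_
          (rhs.trans ((compAt_congr hT _ (by simp) rfl rfl).trans key')).symm)
      refine TMulticat.compOf_congr _ (congrArg (z ≫ T.map ·) (key s w hw hw').symm) ?_ _
      refine (key _ _ _ ?_).symm.trans (Cells.appAt_congr ?_ (Category.assoc _ _ _))
      · simp only [Category.assoc, hd, ← reassoc_of% h₁]
        simp
      · simp [hc]
  exact ⟨⟨k, f, hd, hc, ids_comm, comp_comm⟩, rfl, key⟩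

/-- It is enough to test on families coming from `T (A₀ × C₀)`, since `exists_reindex` lifts every
family over the domain of an arrow in the image of `F`. -/
lemma hom_ext_of_lax {F F' : C ⟶ K.multicat hT} (h₀ : K.act.res (homObj F) = K.act.res (homObj F'))
    (h₁ : ∀ {Y : E} (t : Y ⟶ T.obj (A.underlying.C₀ ⨯ C.C₀)) (y : Y ⟶ C.C₁)
      (_ : t ≫ T.map prod.snd = y ≫ C.dom)
      (h : (t ≫ T.map (prod.map (𝟙 _) (homObj F))) ≫ T.map prod.snd = (y ≫ homArr F) ≫ K.dom)
      (h' : (t ≫ T.map (prod.map (𝟙 _) (homObj F'))) ≫ T.map prod.snd = (y ≫ homArr F') ≫ K.dom),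
      K.cells.appAt (t ≫ T.map (prod.map (𝟙 _) (homObj F))) (y ≫ homArr F) h =
        K.cells.appAt (t ≫ T.map (prod.map (𝟙 _) (homObj F'))) (y ≫ homArr F') h') : F = F' := by
  have e := K.hom_ext₀ h₀
  refine TMulticat.hom_ext e (K.hom_ext₁ (k := homArr F) (k' := homArr F') ?_ ?_ ?_)
  · exact (homArr_dom F).trans (Eq.trans (by rw [e]) (homArr_dom F').symm)
  · exact (homArr_cod F).trans (Eq.trans (by rw [e]) (homArr_cod F').symm)
  · intro Y t y h h'
    have h'' : t ≫ T.map prod.snd = (y ≫ C.dom) ≫ T.map (homObj F) := by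
      rw [h, Category.assoc, Category.assoc, homArr_dom]
    obtain ⟨s, hs, hs'⟩ := exists_reindex hT (homObj F) t (y ≫ C.dom) h''
    refine (Cells.appAt_congr hs rfl).trans ((h₁ s y hs' (hs ▸ h) (e ▸ hs ▸ h')).trans
      (Cells.appAt_congr ?_ rfl))
    rw [hs, e]

end Classifier

end TStructCat

/-! ### Closedness from an objectwise universal property. -/

namespace CategoryTheory

open MonoidalCategory

section closed

variable {C : Type u} [Category.{v} C] [MonoidalCategory C] {A : C} {K : C → C}
  {ev : ∀ B, A ⊗ K B ⟶ B}

/-- An object is closed if each functor `A ⊗ - ⟶ B` has a representing object. -/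
theorem nonempty_closed_of_existsUnique
    (h : ∀ {X B : C} (H : A ⊗ X ⟶ B), ∃! F : X ⟶ K B, A ◁ F ≫ ev B = H) :
    Nonempty (Closed A) := by
  let e (X B : C) : ((tensorLeft A).obj X ⟶ B) ≃ (X ⟶ K B) :=
    (Equiv.ofBijective (fun F : X ⟶ K B => A ◁ F ≫ ev B)
      ⟨fun F F' e => (h (A ◁ F' ≫ ev B)).unique e rfl, fun H => (h H).exists⟩).symm
  refine ⟨⟨_, Adjunction.adjunctionOfEquivRight (F := tensorLeft A) (G_obj := K) e ?_⟩⟩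
  intro X' X B f g
  apply (e X' B).symm.injective
  rw [Equiv.symm_apply_apply]
  have : A ◁ (e X B g) ≫ ev B = g := (e X B).symm_apply_apply g
  change A ◁ f ≫ g = A ◁ (f ≫ e X B g) ≫ ev B
  rw [MonoidalCategory.whiskerLeft_comp, Category.assoc, this]

/-- The theorem concerns an arbitrary `Closed` structure. Its internal hom and `K B` both represent
maps out of `A ⊗ -`, so they are isomorphic compatibly with evaluation. -/
theorem exists_iso_of_existsUnique [Closed A]
    (h : ∀ {X B : C} (H : A ⊗ X ⟶ B), ∃! F : X ⟶ K B, A ◁ F ≫ ev B = H) (B : C) :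
    ∃ φ : (ihom A).obj B ≅ K B, A ◁ φ.hom ≫ ev B = (ihom.ev A).app B := by
  obtain ⟨F, hF, -⟩ := h ((ihom.ev A).app B)
  have hG := MonoidalClosed.uncurry_eq (MonoidalClosed.curry (ev B))
  rw [MonoidalClosed.uncurry_curry] at hG
  refine ⟨⟨F, MonoidalClosed.curry (ev B), ?_, ?_⟩, hF⟩
  · apply MonoidalClosed.uncurry_injective
    rw [MonoidalClosed.uncurry_eq, MonoidalClosed.uncurry_eq, MonoidalCategory.whiskerLeft_comp,
      Category.assoc, ← hG]
    simpa using hF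
  · refine (h (ev B)).unique ?_ ?_
    · rw [MonoidalCategory.whiskerLeft_comp, Category.assoc]
      exact (congrArg (_ ≫ ·) hF).trans hG.symm
    · simp

end closed

end CategoryTheory

/-! ### Evaluation and precomposition in the second factor. -/

namespace TMulticat

variable {E : Type u} [Category.{v} E] [HasFiniteLimits E] {T : Monad E} {A B C D : TMulticat T}
  {X : E}

/-- The product of a multicategory with a map. -/
noncomputable def pairMap (A : TMulticat T) (F : C ⟶ D) : product A C ⟶ product A D :=
  pairing (projFst A C) (projSnd A C ≫ F)

lemma whiskerLeft_eq_pairMap (F : C ⟶ D) :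
    MonoidalCategoryStruct.whiskerLeft A F = pairMap A F := by
  apply CartesianMonoidalCategory.hom_ext
  · rw [CartesianMonoidalCategory.whiskerLeft_fst]
    exact (pairing_projFst _ _ _ _).symm
  · rw [CartesianMonoidalCategory.whiskerLeft_snd]
    exact (pairing_projSnd _ _ _ _).symm

section

variable (F : C ⟶ D) (G : product A D ⟶ B)

lemma prodLift_snd_comp {P Y Z : E} (f : Y ⟶ Z) :
    prod.lift (prod.fst : P ⨯ Y ⟶ P) (prod.snd ≫ f) = prod.map (𝟙 P) f := by
  apply Limits.prod.hom_ext <;> simp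

@[simp] lemma prodArrLift_snd_assoc {d : X ⟶ T.obj (C.C₀ ⨯ D.C₀)} {f : X ⟶ C.C₁} {g : X ⟶ D.C₁}
    {hf : f ≫ C.dom = d ≫ T.map prod.fst} {hg : g ≫ D.dom = d ≫ T.map prod.snd} {W : E}
    (ψ : _ ⟶ W) : prodArrLift d f g hf hg ≫ prodSnd C D ≫ ψ = g ≫ ψ := by
  rw [← Category.assoc, prodArrLift_snd]

lemma pairArr_pairMap : Hom.pairArr (pairMap A F ≫ G) =
    prodArrLift (prodDom A C ≫ T.map (prod.map (𝟙 _) F.f₀)) (prodFst A C) (prodSnd A C ≫ F.f₁)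
      (by simp [prodFst_dom]) (by rw [Category.assoc, F.dom_comm, ← Category.assoc, prodSnd_dom]
                                  simp) ≫
    Hom.pairArr G := by
  refine congrArg (· ≫ Hom.pairArr G) ?_
  apply prodArr_hom_ext
  · refine (pairingArr_dom _ _).trans (Eq.trans ?_ (prodArrLift_dom _ _ _ _ _).symm)
    exact congrArg (prodDom A C ≫ T.map ·) (prodLift_snd_comp F.f₀)
  · exact (pairingArr_fst _ _).trans (prodArrLift_fst _ _ _ _ _).symm
  · exact (pairingArr_snd _ _).trans (prodArrLift_snd _ _ _ _ _).symm

lemma pairObj_pairMap : Hom.pairObj (pairMap A F ≫ G) = prod.map (𝟙 _) F.f₀ ≫ Hom.pairObj G :=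
  congrArg (· ≫ Hom.pairObj G) (prodLift_snd_comp F.f₀)

lemma pairApp_pairMap (d : X ⟶ T.obj (A.C₀ ⨯ C.C₀)) (f : X ⟶ A.C₁) (g : X ⟶ C.C₁) (hf) (hg)
    (hf' : f ≫ A.dom = (d ≫ T.map (prod.map (𝟙 _) F.f₀)) ≫ T.map prod.fst)
    (hg' : (g ≫ F.f₁) ≫ D.dom = (d ≫ T.map (prod.map (𝟙 _) F.f₀)) ≫ T.map prod.snd) :
    Hom.pairApp (pairMap A F ≫ G) d f g hf hg =
      Hom.pairApp G (d ≫ T.map (prod.map (𝟙 _) F.f₀)) f (g ≫ F.f₁) hf' hg' := by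
  rw [Hom.pairApp, pairArr_pairMap, ← Category.assoc, precomp_prodArrLift, Hom.pairApp]
  refine congrArg (· ≫ Hom.pairArr G) ?_
  apply prodArr_hom_ext <;> simp

lemma Unary.hom_heq {a a' b b' : B.Unary X} (ha : a = a') (hb : b = b') {f : a ⟶ b} {g : a' ⟶ b'}
    (h : Unary.Hom.arr f = Unary.Hom.arr g) : HEq f g := by
  subst ha hb
  exact heq_of_eq (Unary.Hom.ext h)

/-- The underlying maps into `B.C₁` have a type independent of the endpoints, so comparing them
replaces heterogeneous equality of morphisms. -/
lemma Unary.functor_ext {Φ Ψ : A.Unary X ⥤ B.Unary X} (h₀ : ∀ a, (Φ.obj a).obj = (Ψ.obj a).obj)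
    (h₁ : ∀ {a b : A.Unary X} (f : a ⟶ b),
      Unary.Hom.arr (Φ.map f) = Unary.Hom.arr (Ψ.map f)) : Φ = Ψ :=
  Functor.hext (fun a => Unary.ext (h₀ a)) (fun a b f =>
    Unary.hom_heq (Unary.ext (h₀ a)) (Unary.ext (h₀ b)) (h₁ f))

lemma evalAt_map_arr (G : product A D ⟶ B) (e : X ⟶ D.C₀) {a b : A.Unary X} (f : a ⟶ b) :
    Unary.Hom.arr ((evalAt G e).map f) = Hom.pairApp G (prod.lift a.obj e ≫ T.ηAt _) f.arr
      (e ≫ D.ids) (by rw [f.dom_eq]; simp; rfl) (by simp) := rfl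

/-- Holds because `F` preserves identities. It carries the bijection on objects from the constructed
exponential to an arbitrary one. -/
lemma evalAt_pairMap (e : X ⟶ C.C₀) : evalAt (pairMap A F ≫ G) e = evalAt G (e ≫ F.f₀) := by
  apply Unary.functor_ext
  · intro a
    change prod.lift a.obj e ≫ Hom.pairObj (pairMap A F ≫ G) =
      prod.lift a.obj (e ≫ F.f₀) ≫ Hom.pairObj G
    rw [pairObj_pairMap, prod.lift_map_assoc, Category.comp_id]
  · intro a b f
    rw [evalAt_map_arr, evalAt_map_arr]
    refine (pairApp_pairMap F G _ _ _ _ _ ?_ ?_).trans (Hom.pairApp_congr _ ?_ rfl ?_)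
    · rw [f.dom_eq]; simp; rfl
    · rw [Category.assoc, Category.assoc, reassoc_of% F.ids_comm]; simp
    · simp
    · rw [Category.assoc, Category.assoc, F.ids_comm]

end

end TMulticat

/-! ### The universal property of the exponential. -/

namespace TStructCat

open TMulticat

variable {E : Type u} [Category.{v} E] [HasFiniteLimits E] {T : Monad E} {A : TStructCat T}
  {B C D : TMulticat T} {X : E}

lemma Lax.appAt_congr {L L' : Lax A B C} (e : L = L') (t : X ⟶ T.obj (A.underlying.C₀ ⨯ C.C₀))
    (y : X ⟶ C.C₁) (h : t ≫ T.map prod.snd = y ≫ C.dom) :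
    L.cells.appAt t y h = L'.cells.appAt t y h := by
  subst e; rfl

lemma unaryApp_pairMap (F : C ⟶ D) (G : product A.underlying D ⟶ B) (g : X ⟶ A.D₁.A)
    (x : X ⟶ C.C₀) : unaryApp (pairMap A.underlying F ≫ G) g x = unaryApp G g (x ≫ F.f₀) := by
  refine (pairApp_pairMap F G _ _ _ _ _ ?_ ?_).trans (Hom.pairApp_congr _ ?_ rfl ?_)
  · simp
  · rw [Category.assoc, Category.assoc, reassoc_of% F.ids_comm]; simp
  · simp
  · rw [Category.assoc, Category.assoc, F.ids_comm]

lemma tensorApp_pairMap (F : C ⟶ D) (G : product A.underlying D ⟶ B)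
    (t : X ⟶ T.obj (A.underlying.C₀ ⨯ C.C₀)) (y : X ⟶ C.C₁) (h : t ≫ T.map prod.snd = y ≫ C.dom)
    (h' : (t ≫ T.map (prod.map (𝟙 _) F.f₀)) ≫ T.map prod.snd = (y ≫ F.f₁) ≫ D.dom) :
    tensorApp (pairMap A.underlying F ≫ G) t y h =
      tensorApp G (t ≫ T.map (prod.map (𝟙 _) F.f₀)) (y ≫ F.f₁) h' := by
  refine (pairApp_pairMap F G _ _ _ _ _ ?_ h'.symm).trans (Hom.pairApp_congr _ rfl ?_ rfl)
  · simp
  · apply multiMk_congr <;> simp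

/-- Precomposition with `A × F` becomes reindexing of the data, so transposing a map turns into
classifying its `Lax` data. -/
lemma toLax_pairMap_act (F : C ⟶ D) (G : product A.underlying D ⟶ B) :
    (toLax (pairMap A.underlying F ≫ G)).act = (toLax G).act.res F.f₀ := by
  apply Action.ext'
  · refine (pairObj_pairMap F G).trans ?_
    rw [Action.obj_eq, Action.onObj_res]
    refine congrArg (· ≫ Hom.pairObj G) ?_
    apply Limits.prod.hom_ext <;> simp
  · rw [Action.arr_eq, Action.arr_eq, Action.onArr_res, toLax_onArr, toLax_onArr, unaryApp_pairMap]

lemma toLax_pairMap_appAt (F : C ⟶ D) (G : product A.underlying D ⟶ B)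
    (t : X ⟶ T.obj (A.underlying.C₀ ⨯ C.C₀)) (y : X ⟶ C.C₁) (h : t ≫ T.map prod.snd = y ≫ C.dom)
    (h' : (t ≫ T.map (prod.map (𝟙 _) F.f₀)) ≫ T.map prod.snd = (y ≫ F.f₁) ≫ D.dom) :
    (toLax (pairMap A.underlying F ≫ G)).cells.appAt t y h =
      (toLax G).cells.appAt (t ≫ T.map (prod.map (𝟙 _) F.f₀)) (y ≫ F.f₁) h' := by
  rw [toLax_appAt, toLax_appAt, tensorApp_pairMap]

lemma evalAt_obj_obj (G : product A.underlying D ⟶ B) (e : X ⟶ D.C₀) (a : A.underlying.Unary X) :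
    ((evalAt G e).obj a).obj = (toLax G).act.onObj a.obj e := rfl

/-- A unary multi-arrow is recovered from its arrow in `A`, because its domain is a unit; hence
evaluation at `e` is the action of `G` at `e`. -/
lemma evalAt_map_arr_eq (G : product A.underlying D ⟶ B) (e : X ⟶ D.C₀)
    {a b : A.underlying.Unary X} (f : a ⟶ b) :
    Unary.Hom.arr ((evalAt G e).map f) = (toLax G).act.onArr (f.arr ≫ A.multiSnd) e := by
  have ha : f.arr ≫ A.underlying.dom = a.obj ≫ T.ηAt _ := f.dom_eq
  rw [toLax_onArr, evalAt_map_arr]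
  refine Hom.pairApp_congr _ ?_ ?_ rfl
  · simp [reassoc_of% ha]
  · apply multi_hom_ext <;> simp [ha, reassoc_of% ha]

namespace Classifier

variable (K : Classifier A B) (hT : IsCartesianMonad T)

/-- The evaluation map of the exponential. -/
noncomputable def ev : product A.underlying (K.multicat hT) ⟶ B := ofLax (K.lax hT)

/-- After `toLax`, the transpose of `H` is any map classifying the data of `H`: existence is
`exists_hom_of_lax`, uniqueness is `hom_ext_of_lax`. -/
lemma existsUnique_hom (H : product A.underlying C ⟶ B) :
    ∃! F : C ⟶ K.multicat hT, pairMap A.underlying F ≫ K.ev hT = H := by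
  have act (F : C ⟶ K.multicat hT) :
      (toLax (pairMap A.underlying F ≫ K.ev hT)).act = K.act.res (homObj F) := by
    rw [toLax_pairMap_act, ev, toLax_ofLax]; rfl
  have appAt (F : C ⟶ K.multicat hT) {Y : E} (t : Y ⟶ T.obj (A.underlying.C₀ ⨯ C.C₀))
      (y : Y ⟶ C.C₁) (h)
      (h' : (t ≫ T.map (prod.map (𝟙 _) (homObj F))) ≫ T.map prod.snd = (y ≫ homArr F) ≫ K.dom) :
      (toLax (pairMap A.underlying F ≫ K.ev hT)).cells.appAt t y h =
        K.cells.appAt (t ≫ T.map (prod.map (𝟙 _) (homObj F))) (y ≫ homArr F) h' := by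
    rw [toLax_pairMap_appAt F (K.ev hT) t y h h']
    exact Lax.appAt_congr (toLax_ofLax (K.lax hT)) _ _ _
  obtain ⟨F, hF₀, hF₁⟩ := K.exists_hom_of_lax hT (toLax H)
  refine ⟨F, ?_, ?_⟩
  · apply toLax_injective
    have e := (act F).trans hF₀
    refine Lax.ext' (by rw [e]) (by rw [e]) ?_
    intro Y t y h
    have h' : (t ≫ T.map (prod.map (𝟙 _) (homObj F))) ≫ T.map prod.snd =
        (y ≫ homArr F) ≫ K.dom := by
      rw [Category.assoc y, homArr_dom, ← reassoc_of% h]; simp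
    exact (appAt F t y h h').trans (hF₁ t y h h')
  · rintro F' rfl
    apply K.hom_ext_of_lax hT
    · rw [hF₀, act]
    · intro Y t y hty h h'
      rw [hF₁ t y hty, appAt F' t y hty]

end Classifier

end TStructCat

/-! ### Families of sets and their points. -/

namespace pointOver

variable {S : Type u} {X Y Z : Over S} {s s' : S}

/-- The point given by an element of a family. -/
def ofElem (x : X.left) : pointOver (X.hom x) ⟶ X := Over.homMk (TypeCat.ofHom fun _ => x)

-- An induction principle that replaces the base `s` by the base of an actual element, so that no
-- transport between fibres remains.
@[elab_as_elim]
lemma hom_cases {motive : ∀ s, (pointOver s ⟶ X) → Prop} (h : ∀ x, motive _ (ofElem x)) (s : S)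
    (p : pointOver s ⟶ X) : motive s p := by
  obtain ⟨x, hx⟩ : ∃ x, x = p.left PUnit.unit := ⟨_, rfl⟩
  have hs : X.hom x = s := by
    rw [hx]
    exact ConcreteCategory.congr_hom (Over.w p) PUnit.unit
  subst hs
  have : p = ofElem x := by
    ext
    exact hx.symm
  rw [this]
  exact h x

lemma hom_ext {f g : X ⟶ Y} (h : ∀ s (p : pointOver s ⟶ X), p ≫ f = p ≫ g) : f = g := by
  ext x
  exact ConcreteCategory.congr_hom (congrArg CommaMorphism.left (h _ (ofElem x))) PUnit.unit

/-- No compatibility is required of `m`: the only maps between points are identities (`base_eq`,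
`end_eq`). -/
lemma exists_glue (m : ∀ s, (pointOver s ⟶ X) → (pointOver s ⟶ Y)) :
    ∃ f : X ⟶ Y, ∀ s p, p ≫ f = m s p := by
  refine ⟨Over.homMk (TypeCat.ofHom fun x => (m _ (ofElem x)).left PUnit.unit) ?_, ?_⟩
  · ext x
    exact ConcreteCategory.congr_hom (Over.w (m _ (ofElem x))) PUnit.unit
  · intro s p
    induction s, p using hom_cases with
    | h x => ext; rfl

lemma base_eq (r : pointOver s ⟶ pointOver s') : s = s' :=
  (ConcreteCategory.congr_hom (Over.w r) PUnit.unit).symm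

lemma end_eq (r : pointOver s ⟶ pointOver s) : r = 𝟙 _ := by
  ext; rfl

section representable

variable (F : Over S → Type u) (res : ∀ {X Y : Over S}, (Y ⟶ X) → F X → F Y)

/-- A contravariant set-valued functor on families of sets which is determined by its values at
points is representable. -/
lemma exists_representation
    (res_res : ∀ {X Y Z : Over S} (k : Y ⟶ X) (p : Z ⟶ Y) (M : F X), res p (res k M) = res (p ≫ k) M)
    (ext : ∀ {X : Over S} {M N : F X}, (∀ s (p : pointOver s ⟶ X), res p M = res p N) → M = N)
    (glue : ∀ {X : Over S} (m : ∀ s, (pointOver s ⟶ X) → F (pointOver s)),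
      ∃ M : F X, ∀ s p, res p M = m s p) :
    ∃ (K : Over S) (U : F K), (∀ {X : Over S} (M : F X), ∃ k : X ⟶ K, res k U = M) ∧
      ∀ {X : Over S} {k k' : X ⟶ K}, res k U = res k' U → k = k' := by
  -- The fibre of the representing object over `s` must be the set of values at a point over `s`.
  let K : Over S := Over.mk (TypeCat.ofHom fun x : (Σ s, F (pointOver s)) => x.1)
  have exists_elem (s) (p : pointOver s ⟶ K) : ∃ M : F (pointOver s),
      (p.left PUnit.unit : Σ s, F (pointOver s)) = ⟨s, M⟩ := by
    induction s, p using hom_cases with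
    | h x => exact ⟨x.2, rfl⟩
  choose elem elem_spec using exists_elem
  -- The universal element is glued from the tautological values: at a point of `K` it is the value
  -- which that point names.
  obtain ⟨U, hU⟩ := glue elem
  refine ⟨K, U, fun {X} M => ?_, fun {X k k'} h => ?_⟩
  · refine ⟨Over.homMk (TypeCat.ofHom fun x =>
      (⟨X.hom x, res (ofElem x) M⟩ : Σ s, F (pointOver s))) rfl, ?_⟩
    apply ext
    intro s p
    rw [res_res, hU]
    induction s, p using hom_cases with
    | h x =>
      have := elem_spec _ (ofElem x ≫ Over.homMk (V := K) (TypeCat.ofHom fun x =>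
        (⟨X.hom x, res (ofElem x) M⟩ : Σ s, F (pointOver s))) rfl)
      exact (eq_of_heq (Sigma.mk.inj this).2).symm
  · apply hom_ext
    intro s p
    have e : elem s (p ≫ k) = elem s (p ≫ k') := by
      rw [← hU, ← hU, ← res_res, ← res_res, h]
    ext
    exact (elem_spec s (p ≫ k)).trans ((congrArg (fun M => (⟨s, M⟩ : Σ s, F (pointOver s))) e).trans
      (elem_spec s (p ≫ k')).symm)

end representable

end pointOver

/-! ### Existence of universal families over sets. -/

namespace TStructCat

variable {S : Type u} {T : Monad (Over S)} {A : TStructCat T} {B : TMulticat T} {X : Over S}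

lemma Action.res_res {X Y Z : Over S} (k : Y ⟶ X) (p : Z ⟶ Y) (M : Action A B X) :
    (M.res k).res p = M.res (p ≫ k) := by
  apply Action.ext' <;> simp [Action.obj_eq, Action.arr_eq]

/-- A point of `A₀ × X` or of `A₁ × X` has a component in `X`, and the value there is already a
value of the restriction to that component. -/
lemma Action.ext_res {M N : Action A B X} (h : ∀ s (p : pointOver s ⟶ X), M.res p = N.res p) :
    M = N := by
  have onObj_eq (M : Action A B X) {s} (q : pointOver s ⟶ A.underlying.C₀ ⨯ X) : q ≫ M.obj =
      (M.res (q ≫ prod.snd)).onObj (q ≫ prod.fst) (𝟙 _) := by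
    simp [Action.obj_eq]
  have onArr_eq (M : Action A B X) {s} (q : pointOver s ⟶ A.D₁.A ⨯ X) : q ≫ M.arr =
      (M.res (q ≫ prod.snd)).onArr (q ≫ prod.fst) (𝟙 _) := by
    simp [Action.arr_eq]
  apply Action.ext'
  · apply pointOver.hom_ext
    intro s p
    rw [onObj_eq, onObj_eq, h]
  · apply pointOver.hom_ext
    intro s p
    rw [onArr_eq, onArr_eq, h]

lemma Action.exists_glue (m : ∀ s, (pointOver s ⟶ X) → Action A B (pointOver s)) :
    ∃ M : Action A B X, ∀ s p, M.res p = m s p := by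
  obtain ⟨obj, hobj⟩ := pointOver.exists_glue (X := A.underlying.C₀ ⨯ X)
    (fun s q => (m s (q ≫ prod.snd)).onObj (q ≫ prod.fst) (𝟙 _))
  obtain ⟨arr, harr⟩ := pointOver.exists_glue (X := A.D₁.A ⨯ X)
    (fun s q => (m s (q ≫ prod.snd)).onArr (q ≫ prod.fst) (𝟙 _))
  -- All the laws of the glued family are equations between maps of families of sets; they are
  -- checked at points, where these formulas reduce them to the laws of `m s x`.
  have hobj' {s} (a : pointOver s ⟶ A.underlying.C₀) (x : pointOver s ⟶ X) :
      prod.lift a x ≫ obj = (m s x).onObj a (𝟙 _) := by simp [hobj]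
  have harr' {s} (g : pointOver s ⟶ A.D₁.A) (x : pointOver s ⟶ X) :
      prod.lift g x ≫ arr = (m s x).onArr g (𝟙 _) := by simp [harr]
  let M : Action A B X :=
    { obj := obj
      arr := arr
      arr_dom := by
        apply pointOver.hom_ext
        intro s p
        rw [reassoc_of% harr, ← Category.assoc p, reassoc_of% hobj]
        simp
      arr_cod := by
        apply pointOver.hom_ext
        intro s p
        rw [reassoc_of% harr, ← Category.assoc p, hobj]
        simp
      arr_ids a x := by
        apply pointOver.hom_ext
        intro s p
        rw [← Category.assoc, prod.comp_lift, harr', ← Category.assoc p a, Action.onArr_idArr,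
          ← hobj', ← prod.comp_lift]
        simp only [Category.assoc]
      arr_seq f g h x h' := by
        apply pointOver.hom_ext
        intro s p
        rw [← Category.assoc, prod.comp_lift, harr', TMulticat.precomp_compOf]
        have e (g : _ ⟶ A.D₁.A) : p ≫ prod.lift g x ≫ arr = (m s (p ≫ x)).onArr (p ≫ g) (𝟙 _) := by
          rw [← Category.assoc, prod.comp_lift, harr']
        have hp : (p ≫ f) ≫ A.tgt = (p ≫ g) ≫ A.src := by simp [h]
        rw [precomp_seq, Action.onArr_seq _ _ _ _ _ (Action.unary_cond _ _ _ _ hp)]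
        refine TMulticat.compOf_congr _ ?_ (e g).symm _
        rw [← e]
        simp only [Category.assoc] }
  refine ⟨M, fun s p => ?_⟩
  apply Action.ext'
  · apply pointOver.hom_ext
    intro s' q
    -- A point of a product with the point over `s` lies over `s`, and its second component is the
    -- identity.
    obtain rfl := pointOver.base_eq (q ≫ prod.snd)
    rw [Action.obj_eq, Action.obj_eq, Action.onObj_res, Action.precomp_onObj, Action.precomp_onObj,
      pointOver.end_eq (q ≫ prod.snd), ← Category.assoc, pointOver.end_eq (q ≫ prod.snd),
      Category.id_comp]
    exact hobj' _ _
  · apply pointOver.hom_ext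
    intro s' q
    obtain rfl := pointOver.base_eq (q ≫ prod.snd)
    rw [Action.arr_eq, Action.arr_eq, Action.onArr_res, Action.precomp_onArr, Action.precomp_onArr,
      pointOver.end_eq (q ≫ prod.snd), ← Category.assoc, pointOver.end_eq (q ≫ prod.snd),
      Category.id_comp]
    exact harr' _ _

section cells

variable {K₀ : Over S} {M : Action A B K₀}

/-- A family of transformations together with its domain and codomain. -/
structure CellFamily (M : Action A B K₀) (X : Over S) where
  dom : X ⟶ T.obj K₀
  cod : X ⟶ K₀
  cells : Cells M dom cod

namespace CellFamily

/-- Equality of the dependent field `cells` is replaced by equality of values, whose type does not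
mention the domain or the codomain. -/
lemma ext_iff_appAt {N N' : CellFamily M X} : N = N' ↔ N.dom = N'.dom ∧ N.cod = N'.cod ∧
    ∀ {Y : Over S} (t : Y ⟶ T.obj (A.underlying.C₀ ⨯ K₀)) (y : Y ⟶ X)
      (h : t ≫ T.map prod.snd = y ≫ N.dom) (h' : t ≫ T.map prod.snd = y ≫ N'.dom),
      N.cells.appAt t y h = N'.cells.appAt t y h' := by
  constructor
  · rintro rfl
    exact ⟨rfl, rfl, fun _ _ _ _ => rfl⟩
  · obtain ⟨d, c, N⟩ := N
    obtain ⟨d', c', N'⟩ := N'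
    rintro ⟨hd, hc, h⟩
    dsimp only at hd hc
    subst hd hc
    obtain rfl : N = N' := Cells.ext_appAt (fun t y h' => h t y h' h')
    rfl

/-- Reindexing of a family of transformations. -/
noncomputable def res {Y : Over S} (k : Y ⟶ X) (N : CellFamily M X) : CellFamily M Y :=
  ⟨k ≫ N.dom, k ≫ N.cod, N.cells.res k⟩

lemma res_cells_appAt {Y Z : Over S} (k : Y ⟶ X) (N : CellFamily M X)
    (t : Z ⟶ T.obj (A.underlying.C₀ ⨯ K₀)) (y : Z ⟶ Y) (h : t ≫ T.map prod.snd = y ≫ k ≫ N.dom)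
    (y' : Z ⟶ X) (hy : y' = y ≫ k) (h' : t ≫ T.map prod.snd = y' ≫ N.dom) :
    (res k N).cells.appAt t y h = N.cells.appAt t y' h' := by
  subst hy
  exact Cells.appAt_res _ _ _ _ _

lemma res_res {Y Z : Over S} (k : Y ⟶ X) (p : Z ⟶ Y) (N : CellFamily M X) :
    res p (res k N) = res (p ≫ k) N := by
  refine ext_iff_appAt.2 ⟨(Category.assoc _ _ _).symm, (Category.assoc _ _ _).symm, ?_⟩
  intro W t y h h'
  simp only [res] at h h' ⊢
  rw [Cells.appAt_res, Cells.appAt_res, Cells.appAt_res]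
  exact Cells.appAt_congr rfl (Category.assoc _ _ _)

lemma ext_res {N N' : CellFamily M X} (h : ∀ s (p : pointOver s ⟶ X), res p N = res p N') :
    N = N' := by
  refine ext_iff_appAt.2 ⟨pointOver.hom_ext fun s p => (ext_iff_appAt.1 (h s p)).1,
    pointOver.hom_ext fun s p => (ext_iff_appAt.1 (h s p)).2.1, ?_⟩
  intro Y t y hd hd'
  apply pointOver.hom_ext
  intro s p
  have hp (N : CellFamily M X) (h : t ≫ T.map prod.snd = y ≫ N.dom) :
      (p ≫ t) ≫ T.map prod.snd = 𝟙 _ ≫ (p ≫ y) ≫ N.dom := by simp [h]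
  rw [Cells.precomp_appAt, Cells.precomp_appAt,
    ← res_cells_appAt (p ≫ y) N (p ≫ t) (𝟙 _) (hp N hd) _ (Category.id_comp _).symm,
    ← res_cells_appAt (p ≫ y) N' (p ≫ t) (𝟙 _) (hp N' hd') _ (Category.id_comp _).symm]
  exact (ext_iff_appAt.1 (h s (p ≫ y))).2.2 _ _ _ _

lemma exists_glue (m : ∀ s, (pointOver s ⟶ X) → CellFamily M (pointOver s)) :
    ∃ N : CellFamily M X, ∀ s p, res p N = m s p := by
  obtain ⟨d, hd⟩ := pointOver.exists_glue (X := X) (fun s p => (m s p).dom)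
  obtain ⟨c, hc⟩ := pointOver.exists_glue (X := X) (fun s p => (m s p).cod)
  -- The given transformations are retyped over the glued domain and codomain, so that their
  -- components can be glued as maps into `B₁`.
  have exists_cells (s) (p : pointOver s ⟶ X) :
      ∃ N : Cells M (p ≫ d) (p ≫ c), m s p = ⟨p ≫ d, p ≫ c, N⟩ := by
    rw [hd, hc]
    exact ⟨_, rfl⟩
  choose N hN using exists_cells
  obtain ⟨app, happ⟩ := pointOver.exists_glue
    (X := pullback (T.map (prod.snd : A.underlying.C₀ ⨯ K₀ ⟶ K₀)) d)
    (fun s q => (N s (q ≫ pullback.snd _ _)).appAt (q ≫ pullback.fst _ _) (𝟙 _)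
      (by simp [pullback.condition]))
  have happ' {s} (t : pointOver s ⟶ T.obj (A.underlying.C₀ ⨯ K₀)) (y : pointOver s ⟶ X) (h) (h') :
      pullback.lift t y h ≫ app = (N s y).appAt t (𝟙 _) h' := by
    have congr {y' t'} (hy : y' = y) (ht : t' = t) (h'') :
        (N s y').appAt t' (𝟙 _) h'' = (N s y).appAt t (𝟙 _) h' := by
      subst hy ht; rfl
    rw [happ]
    exact congr (pullback.lift_snd _ _ _) (pullback.lift_fst _ _ _) _
  obtain ⟨N₀, hN₀⟩ : ∃ N₀ : Cells M d c, N₀.app = app := by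
    refine ⟨⟨app, ?_, ?_, ?_⟩, rfl⟩
    · apply pointOver.hom_ext
      intro s p
      rw [reassoc_of% happ]
      simp
    · apply pointOver.hom_ext
      intro s p
      rw [reassoc_of% happ]
      simp
    · intro Y t y h₁ h₂ h₃ h₄
      apply pointOver.hom_ext
      intro s p
      have cond (f : A.D₁.A ⟶ A.underlying.C₀) :
          ((p ≫ t) ≫ T.map (prod.map f (𝟙 _))) ≫ T.map prod.snd = 𝟙 _ ≫ (p ≫ y) ≫ d := by
        have : t ≫ T.map prod.snd = y ≫ d := by simpa using h₁
        simp [this]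
      have e (f : A.D₁.A ⟶ A.underlying.C₀) (h) :
          p ≫ pullback.lift (t ≫ T.map (prod.map f (𝟙 _))) y h ≫ app =
            (N s (p ≫ y)).appAt ((p ≫ t) ≫ T.map (prod.map f (𝟙 _))) (𝟙 _) (cond f) := by
        rw [← happ' _ _ (by simpa using cond f), ← Category.assoc]
        congr 1
        apply pullback.hom_ext <;> simp
      rw [TMulticat.precomp_compOf, TMulticat.precomp_compOf]
      refine Eq.trans (TMulticat.compOf_congr _ ?_ ?_ _)
        (((N s (p ≫ y)).appAt_natural (𝟙 _) (p ≫ t) rfl rfl (cond _) (cond _) ?_ ?_).trans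
          (TMulticat.compOf_congr _ ?_ (e _ _).symm _))
      · rw [← e _ h₁]; simp only [Category.assoc]
      · simp
      · simp
      · simp
      · simp
  have appAt_point {s s'} (p : pointOver s ⟶ X) (t : pointOver s' ⟶ T.obj (A.underlying.C₀ ⨯ K₀))
      (y : pointOver s' ⟶ pointOver s) (h : t ≫ T.map prod.snd = y ≫ p ≫ d) :
      (N₀.res p).appAt t y h = (N s p).appAt t y h := by
    obtain rfl := pointOver.base_eq y
    obtain rfl := pointOver.end_eq y
    have h' : t ≫ T.map prod.snd = p ≫ d := by rw [h, Category.id_comp]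
    rw [Cells.appAt_res, ← happ' t p h' h, Cells.appAt, hN₀]
    congr 1
  refine ⟨⟨d, c, N₀⟩, fun s p => ?_⟩
  rw [hN]
  refine ext_iff_appAt.2 ⟨rfl, rfl, fun {Y} t y h h' => ?_⟩
  apply pointOver.hom_ext
  intro s' q
  exact (Cells.precomp_appAt _ _ _ _ q).trans
    ((appAt_point p _ _ _).trans (Cells.precomp_appAt _ _ _ _ q).symm)

end CellFamily

/-- Universal families of functors and transformations exist for families of sets. -/
lemma nonempty_classifier (A : TStructCat T) (B : TMulticat T) : Nonempty (Classifier A B) := by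
  obtain ⟨K₀, act, exists_res_eq, hom_ext₀⟩ := pointOver.exists_representation (Action A B)
    (fun k M => M.res k) Action.res_res Action.ext_res Action.exists_glue
  -- Domain and codomain are part of the data represented, which yields the maps `dom` and `cod` out
  -- of `K₁`.
  obtain ⟨K₁, N, exists_hom, hom_ext₁⟩ := pointOver.exists_representation (CellFamily act)
    CellFamily.res CellFamily.res_res CellFamily.ext_res CellFamily.exists_glue
  refine ⟨⟨K₀, act, exists_res_eq, hom_ext₀, K₁, N.dom, N.cod, N.cells, ?_, ?_⟩⟩
  · intro X d c N'
    obtain ⟨k, hk⟩ := exists_hom ⟨d, c, N'⟩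
    obtain ⟨h₁, h₂, h₃⟩ := CellFamily.ext_iff_appAt.1 hk
    refine ⟨k, h₁, h₂, fun t y h h' => ?_⟩
    rw [← h₃ t y (by rw [h, Category.assoc]; rfl) h']
    exact (Cells.appAt_res _ _ _ _ _).symm
  · intro X k k' hd hc h
    apply hom_ext₁
    refine CellFamily.ext_iff_appAt.2 ⟨hd, hc, fun t y h₁ h₂ => ?_⟩
    refine (Cells.appAt_res _ _ _ _ _).trans (Eq.trans ?_ (Cells.appAt_res _ _ _ _ _).symm)
    exact h t y _ _

end cells

end TStructCat

/-! ### Objects of the exponential over `s` as functors between fibres. -/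

namespace pointOver

variable {S : Type u} {P Y : Over S} {s : S}

/-- Every point of `P × pointOver s` is a point of `P` over `s` paired with the identity. -/
lemma prod_hom_ext {f g : P ⨯ pointOver s ⟶ Y}
    (h : ∀ a : pointOver s ⟶ P, prod.lift a (𝟙 _) ≫ f = prod.lift a (𝟙 _) ≫ g) : f = g := by
  apply hom_ext
  intro s' q
  obtain rfl := base_eq (q ≫ prod.snd)
  have : q = prod.lift (q ≫ prod.fst) (𝟙 _) := by
    apply Limits.prod.hom_ext
    · rw [prod.lift_fst]
    · rw [prod.lift_snd]; exact end_eq _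
  rw [this]
  exact h _

lemma exists_prod_glue (m : (pointOver s ⟶ P) → (pointOver s ⟶ Y)) :
    ∃ f : P ⨯ pointOver s ⟶ Y, ∀ a, prod.lift a (𝟙 _) ≫ f = m a := by
  classical
  -- The base `s'` of a point `q` equals `s` only propositionally; the maps `eqToHom` carry `q` over
  -- `s` and its value back.
  obtain ⟨f, hf⟩ := exists_glue (X := P ⨯ pointOver s) (Y := Y) (fun s' q =>
    have e : s' = s := base_eq (q ≫ prod.snd)
    eqToHom (by rw [e]) ≫ m (eqToHom (by rw [e]) ≫ q ≫ prod.fst))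
  refine ⟨f, fun a => ?_⟩
  rw [hf]
  simp

end pointOver

namespace TStructCat

open TMulticat

section unary

variable {E : Type u} [Category.{v} E] [HasFiniteLimits E] {T : Monad E} {A : TStructCat T}
  {B : TMulticat T} {X : E}

/-- The unary arrow of the underlying multicategory given by an arrow. -/
noncomputable def unaryHom (g : X ⟶ A.D₁.A) (a b : A.underlying.Unary X) (ha : g ≫ A.src = a.obj)
    (hb : g ≫ A.tgt = b.obj) : a ⟶ b where
  arr := A.multiMk (a.obj ≫ T.ηAt _) g (by simp [ha])
  dom_eq := multiMk_dom _ _ _ _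
  cod_eq := (multiMk_cod _ _ _ _).trans hb

/-- The tensor product of a one-element family is its member, so unary multi-arrows from `a` to `b`
are arrows of `A` from `a` to `b`. -/
lemma eq_unaryHom {a b : A.underlying.Unary X} (f : a ⟶ b) :
    f = unaryHom (f.arr ≫ A.multiSnd) a b
      (by
        have : f.arr ≫ A.underlying.dom = a.obj ≫ T.ηAt _ := f.dom_eq
        simp [reassoc_of% this])
      (by rw [Category.assoc, multiSnd_tgt]; exact f.cod_eq) := by
  apply Unary.Hom.ext
  apply multi_hom_ext
  · exact f.dom_eq.trans (multiMk_dom _ _ _ _).symm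
  · exact (multiMk_snd _ _ _ _).symm

lemma unaryHom_idArr (a : A.underlying.Unary X) :
    unaryHom (a.obj ≫ A.idArr) a a (by simp) (by simp) = 𝟙 a := by
  apply Unary.Hom.ext
  rw [Unary.id_arr, ids_eq_multiMk, precomp_multiMk]
  rfl

lemma unaryHom_seq {a b c : A.underlying.Unary X} (f g : X ⟶ A.D₁.A) (h : f ≫ A.tgt = g ≫ A.src)
    (h₁ h₂ h₃ h₄) :
    unaryHom (A.seq f g h) a c (by rw [seq_src, h₁]) (by rw [seq_tgt, h₄]) =
      unaryHom f a b h₁ h₂ ≫ unaryHom g b c h₃ h₄ := by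
  apply Unary.Hom.ext
  rw [Unary.comp_arr]
  refine Eq.symm ((TMulticat.compOf_congr _ (ηAt_map T _).symm rfl _).trans
    ((A.compOf_multiMk _ _ _ _ _ _ _ _ ?_ ?_).trans ?_))
  · simpa using h
  · simp [h₁]
  · refine multiMk_congr _ ?_ (seq_congr _ ?_ rfl)
    · simp
    · simp

lemma functor_map_arr_congr {Φ Ψ : A.underlying.Unary X ⥤ B.Unary X} (h : Φ = Ψ)
    {a b : A.underlying.Unary X} (f : a ⟶ b) :
    Unary.Hom.arr (Φ.map f) = Unary.Hom.arr (Ψ.map f) := by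
  subst h; rfl

end unary

variable {S : Type u} {T : Monad (Over S)} {A : TStructCat T} {B D : TMulticat T} {s : S}

/-- Over a single point, an `Action` amounts to functions on the objects and arrows of `A` over `s`.
The values of `Φ` are such functions, and its functoriality gives the laws, checked at points. -/
lemma exists_action (Φ : A.underlying.fibre s ⥤ B.fibre s) :
    ∃ M : Action A B (pointOver s), (∀ a, M.onObj a.obj (𝟙 _) = (Φ.obj a).obj) ∧
      ∀ {a b : A.underlying.fibre s} (f : a ⟶ b),
        M.onArr (f.arr ≫ A.multiSnd) (𝟙 _) = Unary.Hom.arr (Φ.map f) := by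
  obtain ⟨obj, hobj⟩ := pointOver.exists_prod_glue (P := A.underlying.C₀) (s := s)
    (fun a => (Φ.obj ⟨a⟩).obj)
  obtain ⟨arr, harr⟩ := pointOver.exists_prod_glue (P := A.D₁.A) (s := s)
    (fun g => Unary.Hom.arr (Φ.map (unaryHom g ⟨g ≫ A.src⟩ ⟨g ≫ A.tgt⟩ rfl rfl)))
  -- Frees the endpoints of `g` from their canonical form, as needed for identities and composites,
  -- whose endpoints are written differently.
  have harr' (g : pointOver s ⟶ A.D₁.A) {a b : A.underlying.Unary (pointOver s)} (ha hb) :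
      prod.lift g (𝟙 _) ≫ arr = Unary.Hom.arr (Φ.map (unaryHom g a b ha hb)) := by
    obtain ⟨a⟩ := a
    obtain ⟨b⟩ := b
    dsimp only at ha hb
    subst ha hb
    exact harr g
  refine ⟨⟨obj, arr, ?_, ?_, ?_, ?_⟩, fun a => hobj a.obj, fun {a b} f => ?_⟩
  · apply pointOver.prod_hom_ext
    intro g
    rw [reassoc_of% harr, prod.lift_map_assoc, Category.comp_id, reassoc_of% hobj]
    exact Unary.Hom.dom_eq _
  · apply pointOver.prod_hom_ext
    intro g
    rw [reassoc_of% harr, prod.lift_map_assoc, Category.comp_id, hobj]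
    exact Unary.Hom.cod_eq _
  · intro Y a x
    apply pointOver.hom_ext
    intro s' p
    obtain rfl := pointOver.base_eq (p ≫ x)
    rw [← Category.assoc, prod.comp_lift, ← Category.assoc p a, ← Category.assoc p (prod.lift _ _),
      prod.comp_lift, pointOver.end_eq (p ≫ x), reassoc_of% hobj,
      harr' ((p ≫ a) ≫ A.idArr) (a := ⟨p ≫ a⟩) (b := ⟨p ≫ a⟩) (by simp) (by simp),
      unaryHom_idArr ⟨p ≫ a⟩, Φ.map_id]
    rfl
  · intro Y f g h x h'
    apply pointOver.hom_ext
    intro s' p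
    obtain rfl := pointOver.base_eq (p ≫ x)
    have hp : (p ≫ f) ≫ A.tgt = (p ≫ g) ≫ A.src := by simp [h]
    have e (g : Y ⟶ A.D₁.A) : p ≫ prod.lift g x ≫ arr = prod.lift (p ≫ g) (𝟙 _) ≫ arr := by
      rw [← Category.assoc, prod.comp_lift, pointOver.end_eq (p ≫ x)]
    rw [TMulticat.precomp_compOf, e, precomp_seq,
      harr' _ (a := ⟨(p ≫ f) ≫ A.src⟩) (b := ⟨(p ≫ g) ≫ A.tgt⟩) (by simp) (by simp),
      unaryHom_seq (b := ⟨(p ≫ f) ≫ A.tgt⟩) _ _ hp rfl rfl hp.symm rfl, Φ.map_comp, Unary.comp_arr]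
    refine TMulticat.compOf_congr _ ?_ ?_ _
    · rw [← harr', ← e]
      simp only [Category.assoc]
      rfl
    · rw [← harr', ← e]
  · exact (harr' _ _ _).trans (congrArg (fun f => Unary.Hom.arr (Φ.map f)) (eq_unaryHom f).symm)

/-- The hypotheses say that points of `D₀` over `s` correspond to actions over one point, and such
an action carries the same information as the functor `evalAt G e`. -/
lemma evalAt_bijective (G : product A.underlying D ⟶ B)
    (h₁ : ∀ M : Action A B (pointOver s), ∃ e, (toLax G).act.res e = M)
    (h₂ : ∀ {e e' : pointOver s ⟶ D.C₀}, (toLax G).act.res e = (toLax G).act.res e' → e = e') :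
    Function.Bijective
      (fun e : pointOver s ⟶ D.C₀ => (evalAt G e : A.underlying.fibre s ⥤ B.fibre s)) := by
  constructor
  · intro e e' h
    dsimp only at h
    apply h₂
    apply Action.ext'
    · apply pointOver.prod_hom_ext
      intro a
      have := congrArg (fun Φ => ((Functor.obj Φ ⟨a⟩).obj)) h
      simpa [Action.obj_eq, evalAt_obj_obj] using this
    · apply pointOver.prod_hom_ext
      intro g
      have := functor_map_arr_congr h (unaryHom g ⟨g ≫ A.src⟩ ⟨g ≫ A.tgt⟩ rfl rfl)
      simpa [Action.arr_eq, evalAt_map_arr_eq, unaryHom] using this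
  · intro Φ
    obtain ⟨M, hobj, harr⟩ := exists_action Φ
    obtain ⟨e, rfl⟩ := h₁ M
    refine ⟨e, Unary.functor_ext (fun a => ?_) (fun f => ?_)⟩
    · rw [evalAt_obj_obj, ← hobj, Action.onObj_res, Category.id_comp]
    · rw [evalAt_map_arr_eq, ← harr, Action.onArr_res, Category.id_comp]

lemma Classifier.evalAt_ev_bijective (K : Classifier A B) (hT : IsCartesianMonad T) (s : S) :
    Function.Bijective (fun e : pointOver s ⟶ (K.multicat hT).C₀ =>
      (evalAt (K.ev hT) e : A.underlying.fibre s ⥤ B.fibre s)) := by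
  apply evalAt_bijective
  · intro M
    rw [ev, toLax_ofLax]
    exact K.exists_res_eq M
  · intro e e' h
    rw [ev, toLax_ofLax] at h
    exact K.hom_ext₀ h

end TStructCat

/-! ### Exponentiability and the objects of the exponential. -/

theorem theorem4p2p1 {S : Type u} (T : CategoryTheory.Monad (Over S)) (hT : IsCartesianMonad T)
    (A : TStructCat T) :
    Nonempty (Closed A.underlying) ∧
      ∀ [Closed A.underlying] (B : TMulticat T) (s : S),
        Function.Bijective
          (fun e : pointOver s ⟶ ((ihom A.underlying).obj B).C₀ =>
            (TMulticat.evalAt ((ihom.ev A.underlying).app B) e :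
              A.underlying.fibre s ⥤ B.fibre s)) := by
  have K (B : TMulticat T) : TStructCat.Classifier A B := (A.nonempty_classifier B).some
  have h {X B : TMulticat T} (H : MonoidalCategoryStruct.tensorObj A.underlying X ⟶ B) :
      ∃! F : X ⟶ (K B).multicat hT,
        MonoidalCategoryStruct.whiskerLeft A.underlying F ≫ (K B).ev hT = H := by
    simp only [TMulticat.whiskerLeft_eq_pairMap]
    exact (K B).existsUnique_hom hT H
  refine ⟨nonempty_closed_of_existsUnique h, fun {_} B s => ?_⟩
  -- The bijection is known for the constructed exponential; the isomorphism `φ`, bijective on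
  -- objects over `s`, transfers it to the given internal hom.
  obtain ⟨φ, hφ⟩ := exists_iso_of_existsUnique h B
  have hev : TMulticat.pairMap A.underlying φ.hom ≫ (K B).ev hT = (ihom.ev A.underlying).app B :=
    (congrArg (· ≫ (K B).ev hT) (TMulticat.whiskerLeft_eq_pairMap φ.hom).symm).trans hφ
  have hφ₁ : φ.hom.f₀ ≫ φ.inv.f₀ = 𝟙 _ := congrArg TMulticat.Hom.f₀ φ.hom_inv_id
  have hφ₂ : φ.inv.f₀ ≫ φ.hom.f₀ = 𝟙 _ := congrArg TMulticat.Hom.f₀ φ.inv_hom_id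
  have bij : Function.Bijective
      (fun e : pointOver s ⟶ ((ihom A.underlying).obj B).C₀ => e ≫ φ.hom.f₀) := by
    refine Function.bijective_iff_has_inverse.2 ⟨fun e => e ≫ φ.inv.f₀, fun e => ?_, fun e => ?_⟩
    · exact (Category.assoc _ _ _).trans ((congrArg (e ≫ ·) hφ₁).trans (Category.comp_id e))
    · exact (Category.assoc _ _ _).trans ((congrArg (e ≫ ·) hφ₂).trans (Category.comp_id e))
  refine Eq.subst (motive := Function.Bijective) ?_ (((K B).evalAt_ev_bijective hT s).comp bij)
  funext e
  exact (TMulticat.evalAt_pairMap φ.hom ((K B).ev hT) e).symm.trans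
    (congrArg (fun G => TMulticat.evalAt G e) hev)
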